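/- Let $k$ be a field and $H$ a Hopf algebra over $k$ with coproduct $\Delta h=h_{(1)}\otimes h_{(2)}$, counit $\epsilon$ and antipode $S$. A (left) crossed $H$-module is a vector space $V$ with a left action $h\triangleright v$ and a left coaction $v\mapsto v^{(\bar 1)}\otimes v^{(\bar 2)}\in H\otimes V$ such that $$h_{(1)}v^{(\bar1)}\otimes h_{(2)}\triangleright v^{(\bar2)}=(h_{(1)}\triangleright v)^{(\bar1)}h_{(2)}\otimes (h_{(1)}\triangleright v)^{(\bar2)};$$ the braiding of crossed modules is $\Psi(v\otimes w)=v^{(\bar1)}\triangleright w\otimes v^{(\bar2)}$. Let $B$ be a braided group in this category: an algebra and a coalgebra, with coproduct $\underline\Delta b=b_{\underline{(1)}}\otimes b_{\underline{(2)}}$, counit $\underline\epsilon$ and antipode $\underline S$, all of whose structure maps are morphisms of crossed modules, such that $\underline\epsilon$ is an algebra map, $\underline\Delta$ is an algebra map into $B\otimes B$ with the product $(a\otimes b)(c\otimes d)=a\Psi(b\otimes c)d$, and $\underline S$ is the convolution inverse of the identity of $B$. The biproduct $P=B\rtimes H$ is the vector space $B\otimes H$ with the Hopf algebra structure $$(b\otimes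 h)(c\otimes g)=b(h_{(1)}\triangleright c)\otimes h_{(2)}g,\qquad \Delta(b\otimes h)=b_{\underline{(1)}}\otimes b_{\underline{(2)}}{}^{(\bar1)}h_{(1)}\otimes b_{\underline{(2)}}{}^{(\bar2)}\otimes h_{(2)},$$ with $\pi(b\otimes h)=\underline\epsilon(b)h$ and $j(h)=1\otimes h$. It is a trivial quantum principal bundle with coaction $\Delta_R=(\mathrm{id}\otimes\pi)\Delta$ of $H$, base $M=\{u\in P:\Delta_Ru=u\otimes1\}=B$ and trivialisation $j$. For an algebra $A$ let $\Omega^1A=\ker(A\otimes A\to A)$ be the universal 1-forms, with $\mathrm d_Uu=1\otimes u-u\otimes1$. Put $\pi_\epsilon(h)=h-\epsilon(h)1$, $\mathrm{Ad}(h)=h_{(2)}\otimes (Sh_{(1)})h_{(3)}$ and $\chi(u\otimes v)=u\Delta_Rv$. A connection is a linear map $\omega_U:\ker\epsilon_H\to\Omega^1P$ with $\chi\circ\omega_U=1\otimes\mathrm{id}$ and $\Delta_R\circ\omega_U=(\omega_U\otimes\mathrm{id})\circ\mathrm{Ad}$ (tensor product coaction on $P\otimes P$). It is strong if $(\mathrm{id}-\Pi)(\mathrm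 d_UP)\subseteq(\Omega^1M)P$, where $\Pi=\cdot\,(\mathrm{id}\otimes\omega_U)\,\chi:\Omega^1P\to\Omega^1P$ is its projection, and left-invariant if $\Delta_L\omega_U(h)=1\otimes\omega_U(h)$ for all $h$, where $\Delta_L(u\otimes v)=u_{(1)}v_{(1)}\otimes u_{(2)}\otimes v_{(2)}$. 1. The assignment $\beta_U\mapsto\omega_U$, $$\omega_U(h)=j(Sh_{(1)})\,\beta_U(\pi_\epsilon(h_{(2)}))\,j(h_{(3)})+j(Sh_{(1)})\,\mathrm d_Uj(h_{(2)}),$$ is a bijection from the set of linear maps $\beta_U:\ker\epsilon_H\to\Omega^1B$ that are left $B$-invariant, $\underline\Delta_L\beta_U(h)=1\otimes\beta_U(h)$, where $$\underline\Delta_L(b\otimes c)=b_{\underline{(1)}}(b_{\underline{(2)}}{}^{(\bar1)}\triangleright c_{\underline{(1)}})\otimes b_{\underline{(2)}}{}^{(\bar2)}\otimes c_{\underline{(2)}},$$ and intertwine the tensor product coaction $\Delta_H$ of $H$ on $\Omega^1B\subseteq B\otimes B$ with the left adjoint coaction, $\Delta_H(\beta_U(h))=h_{(1)}Sh_{(3)}\otimes\beta_U(h_{(2)})$,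 onto the set of strong left-invariant connections on $B\rtimes H$. 2. The assignment $\gamma\mapsto\beta_U$, $\beta_U(h)=\underline S\gamma(h)_{\underline{(1)}}\,\mathrm d_U\gamma(h)_{\underline{(2)}}$, is a bijection from the set of linear maps $\gamma:\ker\epsilon_H\to\ker\underline\epsilon$ with $\Delta_H(\gamma(h))=h_{(1)}Sh_{(3)}\otimes\gamma(h_{(2)})$, where $\Delta_H$ is the coaction of $H$ on $B$, onto the set of the $\beta_U$ in part 1. 3. For each such $\gamma$, the map $i(h)=\gamma(\pi_\epsilon(h_{(1)}))\otimes h_{(2)}+1\otimes h$ is an $\mathrm{Ad}$-covariant splitting $i:\ker\epsilon_H\to\ker\epsilon_P$ of $\pi$, that is, $\pi\circ i=\mathrm{id}$ and $(\mathrm{id}\otimes\pi)\circ\mathrm{Ad}\circ i=(i\otimes\mathrm{id})\circ\mathrm{Ad}$, and the connection $\omega_U$ that corresponds to $\gamma$ by parts 1 and 2 is the canonical connection of $i$, $\omega_U(h)=(S\,i(h)_{(1)})\,\mathrm d_U\,i(h)_{(2)}$. -/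

import Mathlib

open scoped TensorProduct
open Coalgebra

/-! ### Rearrangements of tensor products -/

/-- `x ⊗ y ⊗ x' ⊗ y' ↦ x ⊗ τ (y ⊗ x') ⊗ y'`: exchange of the two middle factors by means of `τ`. -/
noncomputable def midTwist {k X Y X' Y' Z W : Type*} [Field k]
    [AddCommGroup X] [Module k X] [AddCommGroup Y] [Module k Y]
    [AddCommGroup X'] [Module k X'] [AddCommGroup Y'] [Module k Y']
    [AddCommGroup Z] [Module k Z] [AddCommGroup W] [Module k W]
    (τ : Y ⊗[k] X' →ₗ[k] Z ⊗[k] W) :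
    (X ⊗[k] Y) ⊗[k] (X' ⊗[k] Y') →ₗ[k] (X ⊗[k] Z) ⊗[k] (W ⊗[k] Y') :=
  (TensorProduct.assoc k X Z (W ⊗[k] Y')).symm.toLinearMap ∘ₗ
    ((TensorProduct.assoc k Z W Y').toLinearMap ∘ₗ τ.rTensor Y' ∘ₗ
      (TensorProduct.assoc k Y X' Y').symm.toLinearMap).lTensor X ∘ₗ
    (TensorProduct.assoc k X Y (X' ⊗[k] Y')).toLinearMap

/-- The flip `y ⊗ x ↦ x ⊗ y`. -/
noncomputable abbrev tflip (k Y X : Type*) [Field k] [AddCommGroup Y] [Module k Y]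
    [AddCommGroup X] [Module k X] : Y ⊗[k] X →ₗ[k] X ⊗[k] Y :=
  (TensorProduct.comm k Y X).toLinearMap

/-! ### Crossed modules and braided groups -/

/-- The tensor product `v ⊗ w ↦ v⁽¹⁾ w⁽¹⁾ ⊗ (v⁽²⁾ ⊗ w⁽²⁾)` of two maps `V → H ⊗ V`, `W → H ⊗ W`
(used for left coactions of `H`). -/
noncomputable def leftTensorCoact {k H V W : Type*} [Field k] [Ring H] [Algebra k H]
    [AddCommGroup V] [Module k V] [AddCommGroup W] [Module k W]
    (ρ : V →ₗ[k] H ⊗[k] V) (ρ' : W →ₗ[k] H ⊗[k] W) :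
    V ⊗[k] W →ₗ[k] H ⊗[k] (V ⊗[k] W) :=
  (LinearMap.mul' k H).rTensor (V ⊗[k] W) ∘ₗ midTwist (tflip k V H) ∘ₗ TensorProduct.map ρ ρ'

/-- A (left-left) crossed `H`-module: a left `H`-module `h ▷ v` and left `H`-comodule
`v ↦ v⁽¹⁾ ⊗ v⁽²⁾` with
`h₁ v⁽¹⁾ ⊗ h₂ ▷ v⁽²⁾ = (h₁ ▷ v)⁽¹⁾ h₂ ⊗ (h₁ ▷ v)⁽²⁾`. -/
class CrossedModule (k H V : Type*) [Field k] [Ring H] [HopfAlgebra k H]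
    [AddCommGroup V] [Module k V] where
  /-- the action `h ▷ v` -/
  act : H →ₐ[k] Module.End k V
  /-- the coaction `v ↦ v⁽¹⁾ ⊗ v⁽²⁾` -/
  coact : V →ₗ[k] H ⊗[k] V
  counit_coact : ∀ v, TensorProduct.lid k V ((counit (R := k) (A := H)).rTensor V (coact v)) = v
  coassoc_coact : ∀ v, TensorProduct.assoc k H H V ((comul (R := k) (A := H)).rTensor V (coact v)) =
    coact.lTensor H (coact v)
  crossed : ∀ (h : H) (v : V),
    TensorProduct.map (LinearMap.mul' k H) (TensorProduct.lift act.toLinearMap)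
        (midTwist (tflip k H H) (comul (R := k) h ⊗ₜ[k] coact v)) =
      (LinearMap.mul' k H).rTensor V (TensorProduct.rightComm k H V H
        ((coact ∘ₗ act.toLinearMap.flip v).rTensor H (comul (R := k) h)))

namespace CrossedModule

/-- The action as a map `h ⊗ v ↦ h ▷ v`. -/
noncomputable def actMap (k H V : Type*) [Field k] [Ring H] [HopfAlgebra k H]
    [AddCommGroup V] [Module k V] [CrossedModule k H V] : H ⊗[k] V →ₗ[k] V :=
  TensorProduct.lift (act (k := k) (H := H) (V := V)).toLinearMap

/-- The braiding `Ψ (v ⊗ w) = v⁽¹⁾ ▷ w ⊗ v⁽²⁾` of the category of crossed modules. -/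
noncomputable def braiding (k H V W : Type*) [Field k] [Ring H] [HopfAlgebra k H]
    [AddCommGroup V] [Module k V] [CrossedModule k H V]
    [AddCommGroup W] [Module k W] [CrossedModule k H W] : V ⊗[k] W →ₗ[k] W ⊗[k] V :=
  (actMap k H W).rTensor V ∘ₗ (TensorProduct.rightComm k H V W).toLinearMap ∘ₗ
    (coact (k := k) (H := H) (V := V)).rTensor W

end CrossedModule

open CrossedModule

/-- A braided group (Hopf algebra) `B` in the category of crossed `H`-modules. All structure maps
intertwine the action and the coaction of `H`, and the coproduct and counit are
algebra maps, the former into the braided tensor product algebra with product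
`(a ⊗ b)(c ⊗ d) = a Ψ (b ⊗ c) d`. -/
class BraidedGroup (k H B : Type*) [Field k] [Ring H] [HopfAlgebra k H]
    [Ring B] [Algebra k B] [Coalgebra k B] [CrossedModule k H B] where
  act_one : ∀ h : H, act (k := k) h (1 : B) = counit (R := k) h • (1 : B)
  act_mul : ∀ (h : H) (b c : B), act (k := k) h (b * c) =
    LinearMap.mul' k B (TensorProduct.map ((act (k := k) (H := H) (V := B)).toLinearMap.flip b)
      ((act (k := k) (H := H) (V := B)).toLinearMap.flip c) (comul (R := k) h))
  act_counit : ∀ (h : H) (b : B),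
    counit (R := k) (act (k := k) h b) = counit (R := k) h * counit (R := k) b
  act_comul : ∀ (h : H) (b : B), comul (R := k) (act (k := k) h b) =
    TensorProduct.map (actMap k H B) (actMap k H B)
      (midTwist (tflip k H B) (comul (R := k) h ⊗ₜ[k] comul (R := k) b))
  coact_one : coact (k := k) (H := H) (1 : B) = 1 ⊗ₜ[k] 1
  coact_mul : ∀ b c : B, coact (k := k) (H := H) (b * c) = coact (k := k) b * coact (k := k) c
  coact_counit : ∀ b : B, TensorProduct.rid k H
    ((counit (R := k) (A := B)).lTensor H (coact (k := k) b)) = counit (R := k) b • (1 : H)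
  coact_comul : ∀ b : B, (comul (R := k) (A := B)).lTensor H (coact (k := k) (H := H) b) =
    leftTensorCoact (coact (k := k) (H := H)) (coact (k := k) (H := H)) (comul (R := k) b)
  counit_one : counit (R := k) (1 : B) = 1
  counit_mul : ∀ b c : B, counit (R := k) (b * c) = counit (R := k) b * counit (R := k) c
  comul_one : comul (R := k) (1 : B) = 1 ⊗ₜ[k] 1
  comul_mul : ∀ b c : B, comul (R := k) (b * c) =
    TensorProduct.map (LinearMap.mul' k B) (LinearMap.mul' k B)
      (midTwist (braiding k H B B) (comul (R := k) b ⊗ₜ[k] comul (R := k) c))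
  /-- the braided antipode -/
  bantipode : B →ₗ[k] B
  mul_bantipode_rTensor_comul : ∀ b : B,
    LinearMap.mul' k B (bantipode.rTensor B (comul (R := k) b)) = counit (R := k) b • (1 : B)
  mul_bantipode_lTensor_comul : ∀ b : B,
    LinearMap.mul' k B (bantipode.lTensor B (comul (R := k) b)) = counit (R := k) b • (1 : B)
  bantipode_act : ∀ (h : H) (b : B), bantipode (act (k := k) h b) = act (k := k) h (bantipode b)
  coact_bantipode : ∀ b : B,
    coact (k := k) (H := H) (bantipode b) = bantipode.lTensor H (coact (k := k) b)

/-! ### The biproduct Hopf algebra -/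

/-- The underlying vector space `B ⊗ H` of the biproduct. -/
def Biproduct (k H B : Type*) [Field k] [Ring H] [HopfAlgebra k H]
    [Ring B] [Algebra k B] : Type _ := B ⊗[k] H

namespace Biproduct


section

variable (k H B : Type*) [Field k] [Ring H] [HopfAlgebra k H] [Ring B] [Algebra k B]

noncomputable instance instAddCommGroup : AddCommGroup (Biproduct k H B) := inferInstanceAs (AddCommGroup (B ⊗[k] H))

noncomputable instance instModule : Module k (Biproduct k H B) := inferInstanceAs (Module k (B ⊗[k] H))

/-- The identification of vector spaces `B ⊗ H = Biproduct k H B`. -/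
noncomputable def of : B ⊗[k] H ≃ₗ[k] Biproduct k H B := LinearEquiv.refl k (B ⊗[k] H)

variable [CrossedModule k H B]

/-- `h ⊗ b ↦ h₁ ▷ b ⊗ h₂`. -/
noncomputable def crossMap : H ⊗[k] B →ₗ[k] B ⊗[k] H :=
  (actMap k H B).rTensor H ∘ₗ (TensorProduct.rightComm k H H B).toLinearMap ∘ₗ
    (comul (R := k) (A := H)).rTensor B

/-- `b ⊗ h ↦ b⁽¹⁾ h ⊗ b⁽²⁾`. -/
noncomputable def crossComap : B ⊗[k] H →ₗ[k] H ⊗[k] B :=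
  (LinearMap.mul' k H).rTensor B ∘ₗ (TensorProduct.rightComm k H B H).toLinearMap ∘ₗ
    (coact (k := k) (H := H) (V := B)).rTensor H

/-- The cross product `(b ⊗ h)(c ⊗ g) = b (h₁ ▷ c) ⊗ h₂ g`. -/
noncomputable def mulMap : (B ⊗[k] H) ⊗[k] (B ⊗[k] H) →ₗ[k] B ⊗[k] H :=
  TensorProduct.map (LinearMap.mul' k B) (LinearMap.mul' k H) ∘ₗ midTwist (crossMap k H B)

/-- The cross coproduct `b ⊗ h ↦ (b₁ ⊗ b₂⁽¹⁾ h₁) ⊗ (b₂⁽²⁾ ⊗ h₂)`. -/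
noncomputable def comulMap [Coalgebra k B] : B ⊗[k] H →ₗ[k] (B ⊗[k] H) ⊗[k] (B ⊗[k] H) :=
  midTwist (crossComap k H B) ∘ₗ
    TensorProduct.map (comul (R := k) (A := B)) (comul (R := k) (A := H))

variable {k H B}

theorem crossMap_tmul (h : H) (b : B) : crossMap k H B (h ⊗ₜ b) =
    ((act (k := k) (H := H) (V := B)).toLinearMap.flip b).rTensor H (comul (R := k) h) := by
  simp only [crossMap, LinearMap.comp_apply, LinearMap.rTensor_tmul]
  induction comul (R := k) h using TensorProduct.induction_on with
  | zero => simp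
  | tmul x y => simp [actMap]
  | add x y hx hy => simp only [TensorProduct.add_tmul, map_add, hx, hy]

theorem mulMap_tmul (b c : B) (h g : H) : mulMap k H B ((b ⊗ₜ h) ⊗ₜ (c ⊗ₜ g)) =
    (b ⊗ₜ 1) * crossMap k H B (h ⊗ₜ c) * (1 ⊗ₜ g) := by
  simp only [mulMap, midTwist, LinearMap.comp_apply, LinearEquiv.coe_coe,
    TensorProduct.assoc_tmul, LinearMap.lTensor_tmul, TensorProduct.assoc_symm_tmul,
    LinearMap.rTensor_tmul]
  induction crossMap k H B (h ⊗ₜ c) using TensorProduct.induction_on with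
  | zero => simp
  | tmul x y => simp
  | add x y hx hy =>
    simp only [TensorProduct.add_tmul, TensorProduct.tmul_add, map_add, hx, hy, mul_add, add_mul]

theorem crossMap_mul (h g : H) (b : B) : crossMap k H B ((h * g) ⊗ₜ b) =
    (LinearMap.mul' k H).lTensor B (TensorProduct.assoc k B H H
      ((crossMap k H B ∘ₗ TensorProduct.mk k H B h).rTensor H (crossMap k H B (g ⊗ₜ b)))) := by
  rw [crossMap_tmul, crossMap_tmul, Bialgebra.comul_mul]
  induction comul (R := k) g using TensorProduct.induction_on with
  | zero => simp
  | add x y hx hy => simp only [mul_add, map_add, hx, hy]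
  | tmul x y =>
    simp only [LinearMap.rTensor_tmul, LinearMap.comp_apply, TensorProduct.mk_apply, crossMap_tmul]
    induction comul (R := k) h using TensorProduct.induction_on with
    | zero => simp
    | add x y hx hy => simp only [add_mul, map_add, TensorProduct.add_tmul, hx, hy]
    | tmul x y => simp

theorem crossMap_one_left (b : B) : crossMap k H B (1 ⊗ₜ b) = b ⊗ₜ 1 := by
  simp [crossMap_tmul, Algebra.TensorProduct.one_def]

variable [Coalgebra k B] [BraidedGroup k H B]

theorem crossMap_one_right (h : H) : crossMap k H B (h ⊗ₜ 1) = 1 ⊗ₜ h := by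
  rw [crossMap_tmul]
  have : (act (k := k) (H := H) (V := B)).toLinearMap.flip 1 =
      (LinearMap.toSpanSingleton k B 1) ∘ₗ counit (R := k) (A := H) := by
    ext h; simp [BraidedGroup.act_one]
  rw [this, LinearMap.rTensor_comp_apply, Coalgebra.rTensor_counit_comul]
  simp

theorem crossMap_mul_right (h : H) (b c : B) : crossMap k H B (h ⊗ₜ (b * c)) =
    (LinearMap.mul' k B).rTensor H ((TensorProduct.assoc k B B H).symm
      ((crossMap k H B ∘ₗ (TensorProduct.mk k H B).flip c).lTensor B (crossMap k H B (h ⊗ₜ b)))) := by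
  let F : H ⊗[k] (H ⊗[k] H) →ₗ[k] B ⊗[k] H :=
    (LinearMap.mul' k B ∘ₗ
      TensorProduct.map ((act (k := k) (H := H) (V := B)).toLinearMap.flip b)
      ((act (k := k) (H := H) (V := B)).toLinearMap.flip c)).rTensor H ∘ₗ
      (TensorProduct.assoc k H H H).symm.toLinearMap
  have h1 : crossMap k H B (h ⊗ₜ (b * c)) =
      F (TensorProduct.assoc k H H H ((comul (R := k)).rTensor H (comul (R := k) h))) := by
    rw [crossMap_tmul]
    induction comul (R := k) h using TensorProduct.induction_on with
    | zero => simp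
    | add x y hx hy => simp only [map_add, hx, hy]
    | tmul x y => simp [F, BraidedGroup.act_mul]
  rw [h1, Coalgebra.coassoc_apply, crossMap_tmul]
  induction comul (R := k) h using TensorProduct.induction_on with
  | zero => simp
  | add x y hx hy => simp only [map_add, hx, hy]
  | tmul x y =>
    simp only [F, LinearMap.rTensor_tmul, LinearMap.lTensor_tmul, LinearMap.comp_apply,
      TensorProduct.mk_apply, LinearMap.flip_apply, crossMap_tmul]
    induction comul (R := k) y using TensorProduct.induction_on with
    | zero => simp
    | add x y hx hy => simp only [map_add, TensorProduct.tmul_add, hx, hy]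
    | tmul x y => simp

variable (k H B)

noncomputable instance instOne : One (Biproduct k H B) := ⟨of k H B (1 ⊗ₜ 1)⟩

noncomputable instance instMul : Mul (Biproduct k H B) :=
  ⟨fun x y => of k H B (mulMap k H B ((of k H B).symm x ⊗ₜ (of k H B).symm y))⟩

variable {k H B}

theorem mul_def (x y : B ⊗[k] H) :
    of k H B x * of k H B y = of k H B (mulMap k H B (x ⊗ₜ y)) := rfl

theorem one_def : (1 : Biproduct k H B) = of k H B (1 ⊗ₜ 1) := rfl

theorem induction_on {p : Biproduct k H B → Prop} (x : Biproduct k H B)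
    (hz : p 0) (ht : ∀ b h, p (of k H B (b ⊗ₜ h))) (ha : ∀ x y, p x → p y → p (x + y)) : p x :=
  TensorProduct.induction_on (motive := fun x => p (of k H B x)) x hz ht
    (fun _ _ hx hy => ha _ _ hx hy)

theorem assoc_mul_left (c : B) (t : B ⊗[k] H) : (LinearMap.mul' k B).rTensor H
    ((TensorProduct.assoc k B B H).symm (c ⊗ₜ t)) = (c ⊗ₜ 1) * t := by
  induction t using TensorProduct.induction_on with
  | zero => simp
  | add x y hx hy => simp only [map_add, TensorProduct.tmul_add, mul_add, hx, hy]
  | tmul x y => simp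

theorem assoc_mul_right (d : H) (t : B ⊗[k] H) : (LinearMap.mul' k H).lTensor B
    (TensorProduct.assoc k B H H (t ⊗ₜ d)) = t * (1 ⊗ₜ d) := by
  induction t using TensorProduct.induction_on with
  | zero => simp
  | add x y hx hy => simp only [map_add, TensorProduct.add_tmul, add_mul, hx, hy]
  | tmul x y => simp

theorem mulMap_assoc (x y z : B ⊗[k] H) :
    mulMap k H B (mulMap k H B (x ⊗ₜ y) ⊗ₜ z) = mulMap k H B (x ⊗ₜ mulMap k H B (y ⊗ₜ z)) := by
  induction x using TensorProduct.induction_on with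
  | zero => simp
  | add x y hx hy => simp only [map_add, TensorProduct.add_tmul, hx, hy]
  | tmul a b =>
  induction y using TensorProduct.induction_on with
  | zero => simp
  | add x y hx hy => simp only [map_add, TensorProduct.add_tmul, TensorProduct.tmul_add, hx, hy]
  | tmul c d =>
  induction z using TensorProduct.induction_on with
  | zero => simp
  | add x y hx hy => simp only [map_add, TensorProduct.tmul_add, hx, hy]
  | tmul e f =>
  -- both sides as bilinear expressions in the two twists
  have hL : ∀ t : B ⊗[k] H, mulMap k H B (((a ⊗ₜ 1) * t * (1 ⊗ₜ d)) ⊗ₜ (e ⊗ₜ f)) =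
      (a ⊗ₜ 1) * (LinearMap.mul' k B).rTensor H ((TensorProduct.assoc k B B H).symm
        ((crossMap k H B ∘ₗ (TensorProduct.mk k H B).flip e ∘ₗ
          (LinearMap.mulRight k d)).lTensor B t)) * (1 ⊗ₜ f) := by
    intro t
    induction t using TensorProduct.induction_on with
    | zero => simp
    | add x y hx hy => simp only [map_add, TensorProduct.add_tmul, mul_add, add_mul, hx, hy]
    | tmul c' b' =>
      simp only [Algebra.TensorProduct.tmul_mul_tmul, one_mul, mul_one, mulMap_tmul,
        LinearMap.lTensor_tmul, LinearMap.comp_apply, LinearMap.mulRight_apply,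
        LinearMap.flip_apply, TensorProduct.mk_apply]
      induction crossMap k H B ((b' * d) ⊗ₜ e) using TensorProduct.induction_on with
      | zero => simp
      | add x y hx hy => simp only [map_add, TensorProduct.tmul_add, mul_add, add_mul, hx, hy]
      | tmul c' b' => simp [mul_assoc]
  have hR : ∀ t : B ⊗[k] H, mulMap k H B ((a ⊗ₜ b) ⊗ₜ ((c ⊗ₜ 1) * t * (1 ⊗ₜ f))) =
      (a ⊗ₜ 1) * (LinearMap.mul' k H).lTensor B (TensorProduct.assoc k B H H
      ((crossMap k H B ∘ₗ TensorProduct.mk k H B b ∘ₗ LinearMap.mulLeft k c).rTensor H t)) *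
        (1 ⊗ₜ f) := by
    intro t
    induction t using TensorProduct.induction_on with
    | zero => simp
    | add x y hx hy =>
      simp only [map_add, TensorProduct.tmul_add, mul_add, add_mul, hx, hy]
    | tmul c' b' =>
      simp only [Algebra.TensorProduct.tmul_mul_tmul, one_mul, mul_one, mulMap_tmul,
        LinearMap.rTensor_tmul, LinearMap.comp_apply, LinearMap.mulLeft_apply,
        TensorProduct.mk_apply]
      induction crossMap k H B (b ⊗ₜ (c * c')) using TensorProduct.induction_on with
      | zero => simp
      | add x y hx hy => simp only [map_add, TensorProduct.add_tmul, mul_add, add_mul, hx, hy]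
      | tmul c' b' => simp [mul_assoc]
  rw [mulMap_tmul a c b d, mulMap_tmul c e d f, hL, hR]
  congr 2
  obtain ⟨s, hs⟩ := TensorProduct.exists_finset (crossMap k H B (b ⊗ₜ c))
  obtain ⟨r, hr⟩ := TensorProduct.exists_finset (crossMap k H B (d ⊗ₜ e))
  have e1 : ∀ b' : H, crossMap k H B ((b' * d) ⊗ₜ e) = ∑ j ∈ r,
      crossMap k H B (b' ⊗ₜ j.1) * (1 ⊗ₜ j.2) := by
    intro b'
    rw [crossMap_mul, hr]
    simp [assoc_mul_right]
  have e2 : ∀ e' : B, crossMap k H B (b ⊗ₜ (c * e')) = ∑ i ∈ s,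
      (i.1 ⊗ₜ 1) * crossMap k H B (i.2 ⊗ₜ e') := by
    intro e'
    rw [crossMap_mul_right, hs]
    simp [assoc_mul_left]
  rw [hs, hr]
  simp only [map_sum, LinearMap.lTensor_tmul, LinearMap.rTensor_tmul, LinearMap.comp_apply,
    LinearMap.mulRight_apply, LinearMap.mulLeft_apply, LinearMap.flip_apply,
    TensorProduct.mk_apply, e1, e2, assoc_mul_left, assoc_mul_right, Finset.mul_sum,
    Finset.sum_mul, mul_assoc]
  exact Finset.sum_comm

theorem mul_eq (x y : Biproduct k H B) :
    x * y = of k H B (mulMap k H B ((of k H B).symm x ⊗ₜ (of k H B).symm y)) := rfl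

theorem zero_mul' (x : Biproduct k H B) : 0 * x = 0 := by simp [mul_eq]

theorem mul_zero' (x : Biproduct k H B) : x * 0 = 0 := by simp [mul_eq]

theorem add_mul' (x y z : Biproduct k H B) : (x + y) * z = x * z + y * z := by
  simp [mul_eq, TensorProduct.add_tmul]

theorem mul_add' (x y z : Biproduct k H B) : x * (y + z) = x * y + x * z := by
  simp [mul_eq, TensorProduct.tmul_add]

theorem smul_mul' (r : k) (x y : Biproduct k H B) : (r • x) * y = r • (x * y) := by
  simp [mul_eq, ← TensorProduct.smul_tmul']

theorem mul_smul' (r : k) (x y : Biproduct k H B) : x * (r • y) = r • (x * y) := by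
  simp [mul_eq]

theorem one_mul' (x : Biproduct k H B) : 1 * x = x := by
  induction x using induction_on with
  | hz => exact mul_zero' _
  | ha x y hx hy => rw [mul_add', hx, hy]
  | ht b h => rw [one_def, mul_def, mulMap_tmul, crossMap_one_left]; simp

theorem mul_one' (x : Biproduct k H B) : x * 1 = x := by
  induction x using induction_on with
  | hz => exact zero_mul' _
  | ha x y hx hy => rw [add_mul', hx, hy]
  | ht b h => rw [one_def, mul_def, mulMap_tmul, crossMap_one_right]; simp

noncomputable instance instRing : Ring (Biproduct k H B) :=
  { (inferInstance : AddCommGroup (Biproduct k H B)),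
    (inferInstance : Mul (Biproduct k H B)),
    (inferInstance : One (Biproduct k H B)) with
    mul_assoc := fun x y z => mulMap_assoc x y z
    one_mul := one_mul'
    mul_one := mul_one'
    left_distrib := mul_add'
    right_distrib := add_mul'
    zero_mul := zero_mul'
    mul_zero := mul_zero' }

noncomputable instance instAlgebra : Algebra k (Biproduct k H B) :=
  Algebra.ofModule smul_mul' (fun r x y => mul_smul' r x y)

variable (k H B)

/-- The inclusion `b ↦ b ⊗ 1` of `B`. -/
noncomputable def incl : B →ₐ[k] Biproduct k H B :=
  AlgHom.ofLinearMap ((of k H B).toLinearMap ∘ₗ (TensorProduct.mk k B H).flip 1) rfl (by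
    intro b c
    simp [mul_def, mulMap_tmul, crossMap_one_left])

/-- The inclusion `j h = 1 ⊗ h` of `H`. -/
noncomputable def inclH : H →ₐ[k] Biproduct k H B :=
  AlgHom.ofLinearMap ((of k H B).toLinearMap ∘ₗ TensorProduct.mk k B H 1) rfl (by
    intro b c
    simp [mul_def, mulMap_tmul, crossMap_one_right])

variable {k H B}

theorem incl_apply (b : B) : incl k H B b = of k H B (b ⊗ₜ 1) := rfl

theorem inclH_apply (h : H) : inclH k H B h = of k H B (1 ⊗ₜ h) := rfl

theorem of_tmul (b : B) (h : H) : of k H B (b ⊗ₜ h) = incl k H B b * inclH k H B h := by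
  simp [incl_apply, inclH_apply, mul_def, mulMap_tmul, crossMap_one_left]

theorem inclH_mul_incl (h : H) (b : B) : inclH k H B h * incl k H B b =
    LinearMap.mul' k _ (TensorProduct.map ((incl k H B).toLinearMap ∘ₗ
      (act (k := k) (H := H) (V := B)).toLinearMap.flip b) (inclH k H B).toLinearMap
        (comul (R := k) h)) := by
  rw [incl_apply, inclH_apply, mul_def, mulMap_tmul, crossMap_tmul]
  induction comul (R := k) h using TensorProduct.induction_on with
  | zero => simp
  | add x y hx hy => simp only [map_add, mul_add, add_mul, hx, hy]
  | tmul x y => simp [of_tmul]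

theorem algHom_ext {A : Type*} [Semiring A] [Algebra k A] {f g : Biproduct k H B →ₐ[k] A}
    (h₁ : ∀ b, f (incl k H B b) = g (incl k H B b))
    (h₂ : ∀ h, f (inclH k H B h) = g (inclH k H B h)) : f = g := by
  ext x
  induction x using induction_on with
  | hz => simp
  | ha x y hx hy => simp only [map_add, hx, hy]
  | ht b h => rw [of_tmul, map_mul, map_mul, h₁, h₂]

variable (k H B)

/-- The coaction of `H` on `B` as an algebra map. -/
noncomputable def coactHom : B →ₐ[k] H ⊗[k] B :=
  AlgHom.ofLinearMap (coact (k := k) (H := H)) BraidedGroup.coact_one BraidedGroup.coact_mul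

/-- `b ↦ j b⁽¹⁾ ⊗ b⁽²⁾`. -/
noncomputable def coactP : B →ₐ[k] Biproduct k H B ⊗[k] Biproduct k H B :=
  (Algebra.TensorProduct.map (inclH k H B) (incl k H B)).comp (coactHom k H B)

/-- `h ↦ j h₁ ⊗ j h₂`. -/
noncomputable def comulH : H →ₐ[k] Biproduct k H B ⊗[k] Biproduct k H B :=
  (Algebra.TensorProduct.map (inclH k H B) (inclH k H B)).comp (Bialgebra.comulAlgHom k H)

/-- `b ⊗ c ↦ b j c⁽¹⁾ ⊗ c⁽²⁾`. -/
noncomputable def comulAux : B ⊗[k] B →ₗ[k] Biproduct k H B ⊗[k] Biproduct k H B :=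
  LinearMap.mul' k _ ∘ₗ TensorProduct.map
    (Algebra.TensorProduct.includeLeft.comp (incl k H B) :
      B →ₐ[k] Biproduct k H B ⊗[k] Biproduct k H B).toLinearMap
    (coactP k H B).toLinearMap

/-- `b ↦ b₁ j b₂⁽¹⁾ ⊗ b₂⁽²⁾`. -/
noncomputable def comulB : B →ₗ[k] Biproduct k H B ⊗[k] Biproduct k H B :=
  comulAux k H B ∘ₗ comul (R := k)

/-- The coproduct as a linear map. -/
noncomputable def comulLin : Biproduct k H B →ₗ[k] Biproduct k H B ⊗[k] Biproduct k H B :=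
  TensorProduct.map (of k H B).toLinearMap (of k H B).toLinearMap ∘ₗ comulMap k H B ∘ₗ
    (of k H B).symm.toLinearMap

variable {k H B}

theorem coactP_apply (b : B) : coactP k H B b =
    TensorProduct.map (inclH k H B).toLinearMap (incl k H B).toLinearMap (coact (k := k) b) := rfl

theorem comulH_apply (h : H) : comulH k H B h =
    TensorProduct.map (inclH k H B).toLinearMap (inclH k H B).toLinearMap (comul (R := k) h) := rfl

theorem comulAux_tmul (b c : B) :
    comulAux k H B (b ⊗ₜ c) = (incl k H B b ⊗ₜ 1) * coactP k H B c := rfl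

theorem comulLin_of (b : B) (h : H) :
    comulLin k H B (of k H B (b ⊗ₜ h)) = comulB k H B b * comulH k H B h := by
  simp only [comulLin, comulMap, LinearMap.comp_apply, LinearEquiv.coe_coe,
    LinearEquiv.symm_apply_apply, TensorProduct.map_tmul, comulB, comulH_apply]
  induction comul (R := k) b using TensorProduct.induction_on with
  | zero => simp
  | add x y hx hy => simp only [map_add, add_mul, TensorProduct.add_tmul, hx, hy]
  | tmul b c =>
  induction comul (R := k) h using TensorProduct.induction_on with
  | zero => simp
  | add x y hx hy => simp only [map_add, mul_add, TensorProduct.tmul_add, hx, hy]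
  | tmul h g =>
  simp only [comulAux_tmul, coactP_apply, midTwist, crossComap, LinearMap.comp_apply,
    LinearEquiv.coe_coe,
    TensorProduct.assoc_tmul, LinearMap.lTensor_tmul, TensorProduct.assoc_symm_tmul,
    LinearMap.rTensor_tmul]
  induction coact (k := k) (H := H) c using TensorProduct.induction_on with
  | zero => simp
  | add x y hx hy =>
    simp only [map_add, mul_add, add_mul, TensorProduct.add_tmul, TensorProduct.tmul_add, hx, hy]
  | tmul x y => simp [of_tmul, mul_assoc]

theorem coactP_mul_incl (b c : B) : coactP k H B b * (incl k H B c ⊗ₜ 1) =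
    comulAux k H B (braiding k H B B (b ⊗ₜ c)) := by
  let F : H ⊗[k] (H ⊗[k] B) →ₗ[k] Biproduct k H B ⊗[k] Biproduct k H B :=
    TensorProduct.map (LinearMap.mul' k _ ∘ₗ TensorProduct.map ((incl k H B).toLinearMap ∘ₗ
      (act (k := k) (H := H) (V := B)).toLinearMap.flip c) (inclH k H B).toLinearMap)
      (incl k H B).toLinearMap ∘ₗ (TensorProduct.assoc k H H B).symm.toLinearMap
  have h1 : coactP k H B b * (incl k H B c ⊗ₜ 1) =
      F (TensorProduct.assoc k H H B ((comul (R := k)).rTensor B (coact (k := k) b))) := by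
    rw [coactP_apply]
    induction coact (k := k) (H := H) b using TensorProduct.induction_on with
    | zero => simp
    | add x y hx hy => simp only [map_add, add_mul, hx, hy]
    | tmul x y => simp [F, inclH_mul_incl]
  rw [h1, CrossedModule.coassoc_coact]
  simp only [braiding, LinearMap.comp_apply, LinearMap.rTensor_tmul]
  induction coact (k := k) (H := H) b using TensorProduct.induction_on with
  | zero => simp
  | add x y hx hy => simp only [map_add, TensorProduct.add_tmul, hx, hy]
  | tmul x y =>
    simp only [F, LinearMap.lTensor_tmul, LinearEquiv.coe_coe, TensorProduct.rightComm_tmul,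
      LinearMap.rTensor_tmul, comulAux_tmul, coactP_apply, actMap, TensorProduct.lift.tmul,
      LinearMap.comp_apply]
    induction coact (k := k) (H := H) y using TensorProduct.induction_on with
    | zero => simp
    | add x y hx hy => simp only [map_add, TensorProduct.tmul_add, mul_add, hx, hy]
    | tmul x y => simp

theorem comulB_mul (b c : B) : comulB k H B (b * c) = comulB k H B b * comulB k H B c := by
  simp only [comulB, LinearMap.comp_apply, BraidedGroup.comul_mul (k := k) (H := H)]
  induction comul (R := k) b using TensorProduct.induction_on with
  | zero => simp
  | add x y hx hy => simp only [map_add, add_mul, TensorProduct.add_tmul, hx, hy]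
  | tmul b b' =>
  induction comul (R := k) c using TensorProduct.induction_on with
  | zero => simp
  | add x y hx hy => simp only [map_add, mul_add, TensorProduct.tmul_add, hx, hy]
  | tmul c c' =>
  have : comulAux k H B (b ⊗ₜ b') * comulAux k H B (c ⊗ₜ c') =
      (incl k H B b ⊗ₜ 1) * comulAux k H B (braiding k H B B (b' ⊗ₜ c)) * coactP k H B c' := by
    rw [← coactP_mul_incl, comulAux_tmul, comulAux_tmul]; simp only [mul_assoc]
  rw [this]
  simp only [midTwist, LinearMap.comp_apply, LinearEquiv.coe_coe,
    TensorProduct.assoc_tmul, LinearMap.lTensor_tmul, TensorProduct.assoc_symm_tmul,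
    LinearMap.rTensor_tmul]
  induction braiding k H B B (b' ⊗ₜ c) using TensorProduct.induction_on with
  | zero => simp
  | add x y hx hy =>
    simp only [map_add, mul_add, add_mul, TensorProduct.add_tmul, TensorProduct.tmul_add, hx, hy]
  | tmul x y =>
    simp only [TensorProduct.assoc_tmul, TensorProduct.assoc_symm_tmul, TensorProduct.map_tmul,
      LinearMap.mul'_apply, comulAux_tmul, map_mul]
    rw [← mul_one (1 : Biproduct k H B), ← Algebra.TensorProduct.tmul_mul_tmul]
    simp only [mul_assoc, mul_one]

theorem comulH_mul_incl (h : H) (b : B) : comulH k H B h * (incl k H B b ⊗ₜ 1) =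
    LinearMap.mul' k _ (TensorProduct.map
      ((Algebra.TensorProduct.includeLeft.comp (incl k H B) :
      B →ₐ[k] Biproduct k H B ⊗[k] Biproduct k H B).toLinearMap ∘ₗ
      (act (k := k) (H := H) (V := B)).toLinearMap.flip b) (comulH k H B).toLinearMap
      (comul (R := k) h)) := by
  let F : H ⊗[k] (H ⊗[k] H) →ₗ[k] Biproduct k H B ⊗[k] Biproduct k H B :=
    TensorProduct.map (LinearMap.mul' k _ ∘ₗ TensorProduct.map ((incl k H B).toLinearMap ∘ₗ
      (act (k := k) (H := H) (V := B)).toLinearMap.flip b) (inclH k H B).toLinearMap)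
      (inclH k H B).toLinearMap ∘ₗ (TensorProduct.assoc k H H H).symm.toLinearMap
  have h1 : comulH k H B h * (incl k H B b ⊗ₜ 1) =
      F (TensorProduct.assoc k H H H ((comul (R := k)).rTensor H (comul (R := k) h))) := by
    rw [comulH_apply]
    induction comul (R := k) h using TensorProduct.induction_on with
    | zero => simp
    | add x y hx hy => simp only [map_add, add_mul, hx, hy]
    | tmul x y => simp [F, inclH_mul_incl]
  rw [h1, Coalgebra.coassoc_apply]
  induction comul (R := k) h using TensorProduct.induction_on with
  | zero => simp
  | add x y hx hy => simp only [map_add, hx, hy]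
  | tmul x y =>
    simp only [F, LinearMap.lTensor_tmul, LinearEquiv.coe_coe, TensorProduct.map_tmul,
      LinearMap.comp_apply, AlgHom.toLinearMap_apply, comulH_apply, LinearMap.mul'_apply]
    induction comul (R := k) y using TensorProduct.induction_on with
    | zero => simp
    | add x y hx hy => simp only [map_add, TensorProduct.tmul_add, mul_add, hx, hy]
    | tmul x y => simp

theorem comulH_mul_coactP (h : H) (b : B) : comulH k H B h * coactP k H B b =
    LinearMap.mul' k _ (TensorProduct.map ((coactP k H B).toLinearMap ∘ₗ
      (act (k := k) (H := H) (V := B)).toLinearMap.flip b) (comulH k H B).toLinearMap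
      (comul (R := k) h)) := by
  let Y : H ⊗[k] H →ₗ[k] H ⊗[k] B :=
    TensorProduct.map (LinearMap.mul' k H) (actMap k H B) ∘ₗ midTwist (tflip k H H) ∘ₗ
      (TensorProduct.mk k (H ⊗[k] H) (H ⊗[k] B)).flip (coact (k := k) b)
  let Y' : H ⊗[k] H →ₗ[k] H ⊗[k] B :=
    (LinearMap.mul' k H).rTensor B ∘ₗ (TensorProduct.rightComm k H B H).toLinearMap ∘ₗ
        (coact (k := k) ∘ₗ (act (k := k) (H := H) (V := B)).toLinearMap.flip b).rTensor H
  have hY : ∀ x : H, Y (comul (R := k) x) = Y' (comul (R := k) x) :=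
    fun x => CrossedModule.crossed x b
  let G : (H ⊗[k] B) ⊗[k] H →ₗ[k] Biproduct k H B ⊗[k] Biproduct k H B :=
    LinearMap.mul' k _ ∘ₗ TensorProduct.map
      (TensorProduct.map (inclH k H B).toLinearMap (incl k H B).toLinearMap)
      ((Algebra.TensorProduct.includeRight.comp (inclH k H B) :
      H →ₐ[k] Biproduct k H B ⊗[k] Biproduct k H B).toLinearMap)
  have h1 : comulH k H B h * coactP k H B b = G (Y.rTensor H ((TensorProduct.assoc k H H H).symm
      ((comul (R := k)).lTensor H (comul (R := k) h)))) := by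
    rw [comulH_apply, coactP_apply]
    induction comul (R := k) h using TensorProduct.induction_on with
    | zero => simp
    | add x y hx hy => simp only [map_add, add_mul, hx, hy]
    | tmul x y =>
      simp only [Y, midTwist, tflip]
      induction coact (k := k) (H := H) b using TensorProduct.induction_on with
      | zero => simp
      | add x y hx hy =>
        simp only [map_add, mul_add, LinearMap.comp_add, LinearMap.rTensor_add,
          LinearMap.add_apply, hx, hy]
      | tmul z w =>
        simp only [TensorProduct.map_tmul, AlgHom.toLinearMap_apply,
          Algebra.TensorProduct.tmul_mul_tmul, inclH_mul_incl, LinearMap.lTensor_tmul]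
        induction comul (R := k) y using TensorProduct.induction_on with
        | zero => simp
        | add x y hx hy =>
          simp only [map_add, TensorProduct.tmul_add, hx, hy]
        | tmul p q => simp [G, actMap]
  rw [h1, Coalgebra.coassoc_symm_apply]
  have h2 : Y.rTensor H ((comul (R := k)).rTensor H (comul (R := k) h)) =
      Y'.rTensor H ((comul (R := k)).rTensor H (comul (R := k) h)) := by
    rw [← LinearMap.rTensor_comp_apply, ← LinearMap.rTensor_comp_apply,
      show Y ∘ₗ comul = Y' ∘ₗ comul from LinearMap.ext hY]
  rw [h2, ← Coalgebra.coassoc_symm_apply]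
  induction comul (R := k) h using TensorProduct.induction_on with
  | zero => simp
  | add x y hx hy => simp only [map_add, hx, hy]
  | tmul x y =>
    simp only [LinearMap.lTensor_tmul, TensorProduct.map_tmul,
      LinearMap.comp_apply, AlgHom.toLinearMap_apply, comulH_apply, coactP_apply,
      LinearMap.mul'_apply, LinearMap.flip_apply]
    induction comul (R := k) y using TensorProduct.induction_on with
    | zero => simp
    | add x y hx hy => simp only [map_add, TensorProduct.tmul_add, mul_add, hx, hy]
    | tmul p q =>
      simp only [Y', G, LinearMap.comp_apply, LinearMap.rTensor_tmul,
        TensorProduct.assoc_symm_tmul, LinearMap.flip_apply, AlgHom.toLinearMap_apply]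
      induction coact (k := k) (H := H) (act (k := k) x b) using TensorProduct.induction_on with
      | zero => simp
      | add x y hx hy =>
        simp only [map_add, TensorProduct.add_tmul, add_mul, hx, hy]
      | tmul z w => simp

theorem comulH_mul_comulAux (h : H) (t : B ⊗[k] B) : comulH k H B h * comulAux k H B t =
    LinearMap.mul' k _ (TensorProduct.map (comulAux k H B ∘ₗ
      TensorProduct.map (actMap k H B) (actMap k H B) ∘ₗ midTwist (tflip k H B) ∘ₗ
      (TensorProduct.mk k (H ⊗[k] H) (B ⊗[k] B)).flip t ∘ₗ comul (R := k))
      (comulH k H B).toLinearMap (comul (R := k) h)) := by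
  induction t using TensorProduct.induction_on with
  | zero => simp
  | add x y hx hy =>
    simp only [map_add, mul_add, LinearMap.comp_add, LinearMap.add_comp,
      TensorProduct.map_add_left, LinearMap.add_apply, hx, hy]
  | tmul b c =>
  let i₁ : B →ₗ[k] Biproduct k H B ⊗[k] Biproduct k H B :=
    (Algebra.TensorProduct.includeLeft.comp (incl k H B) :
      B →ₐ[k] Biproduct k H B ⊗[k] Biproduct k H B).toLinearMap
  let F : H ⊗[k] (H ⊗[k] H) →ₗ[k] Biproduct k H B ⊗[k] Biproduct k H B :=
    LinearMap.mul' k _ ∘ₗ TensorProduct.map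
      (i₁ ∘ₗ (act (k := k) (H := H) (V := B)).toLinearMap.flip b)
      (LinearMap.mul' k _ ∘ₗ TensorProduct.map ((coactP k H B).toLinearMap ∘ₗ
      (act (k := k) (H := H) (V := B)).toLinearMap.flip c) (comulH k H B).toLinearMap)
  have h1 : comulH k H B h * comulAux k H B (b ⊗ₜ c) =
      F ((comul (R := k)).lTensor H (comul (R := k) h)) := by
    rw [comulAux_tmul, ← mul_assoc, comulH_mul_incl]
    induction comul (R := k) h using TensorProduct.induction_on with
    | zero => simp
    | add x y hx hy => simp only [map_add, add_mul, hx, hy]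
    | tmul x y => simp [F, i₁, mul_assoc, comulH_mul_coactP]
  rw [h1, ← Coalgebra.coassoc_apply]
  induction comul (R := k) h using TensorProduct.induction_on with
  | zero => simp
  | add x y hx hy => simp only [map_add, hx, hy]
  | tmul x y =>
    simp only [LinearMap.rTensor_tmul, TensorProduct.map_tmul, LinearMap.comp_apply]
    induction comul (R := k) x using TensorProduct.induction_on with
    | zero => simp
    | add x y hx hy =>
      simp only [map_add, TensorProduct.add_tmul, hx, hy]
    | tmul p q => simp [F, i₁, midTwist, actMap, comulAux_tmul, mul_assoc]

theorem comulH_mul_comulB (h : H) (b : B) : comulH k H B h * comulB k H B b =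
    LinearMap.mul' k _ (TensorProduct.map (comulB k H B) (comulH k H B).toLinearMap
      (crossMap k H B (h ⊗ₜ b))) := by
  have : comulB k H B b = comulAux k H B (comul (R := k) b) := rfl
  rw [this, comulH_mul_comulAux, crossMap_tmul, LinearMap.rTensor, ← LinearMap.comp_apply
    (TensorProduct.map _ _) (TensorProduct.map _ _), ← TensorProduct.map_comp, LinearMap.comp_id]
  congr 3
  ext x
  simp only [LinearMap.comp_apply, LinearMap.flip_apply, TensorProduct.mk_apply, comulB,
    AlgHom.toLinearMap_apply, BraidedGroup.act_comul]

theorem comulLin_mul (x y : Biproduct k H B) :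
    comulLin k H B (x * y) = comulLin k H B x * comulLin k H B y := by
  induction x using induction_on with
  | hz => simp
  | ha x y hx hy => simp only [map_add, add_mul, hx, hy]
  | ht b h =>
  induction y using induction_on with
  | hz => simp
  | ha x y hx hy => simp only [map_add, mul_add, hx, hy]
  | ht c g =>
  have key : ∀ t : B ⊗[k] H, comulLin k H B (of k H B ((b ⊗ₜ 1) * t * (1 ⊗ₜ g))) =
      comulB k H B b * LinearMap.mul' k _ (TensorProduct.map (comulB k H B)
        (comulH k H B).toLinearMap t) * comulH k H B g := by
    intro t
    induction t using TensorProduct.induction_on with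
    | zero => simp
    | add x y hx hy => simp only [map_add, mul_add, add_mul, hx, hy]
    | tmul x y => simp [comulLin_of, comulB_mul, mul_assoc]
  rw [mul_def, mulMap_tmul, key, ← comulH_mul_comulB, comulLin_of, comulLin_of]
  simp only [mul_assoc]

theorem coactP_one : coactP k H B 1 = 1 := map_one _

theorem comulB_one : comulB k H B 1 = 1 := by
  rw [comulB, LinearMap.comp_apply, BraidedGroup.comul_one (k := k) (H := H), comulAux_tmul,
    map_one, map_one, mul_one, ← Algebra.TensorProduct.one_def]

variable (k H B)

/-- The coproduct of the biproduct, as an algebra map. -/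
noncomputable def comulHom : Biproduct k H B →ₐ[k] Biproduct k H B ⊗[k] Biproduct k H B :=
  AlgHom.ofLinearMap (comulLin k H B) (by
    rw [one_def, comulLin_of, comulB_one, map_one, one_mul]) comulLin_mul

/-- The counit `b ⊗ h ↦ ε(b) ε(h)` as a linear map. -/
noncomputable def counitLin : Biproduct k H B →ₗ[k] k :=
  LinearMap.mul' k k ∘ₗ TensorProduct.map (counit (R := k) (A := B)) (counit (R := k) (A := H)) ∘ₗ
    (of k H B).symm.toLinearMap

variable {k H B}

theorem counitLin_of (b : B) (h : H) :
    counitLin k H B (of k H B (b ⊗ₜ h)) = counit (R := k) b * counit (R := k) h := by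
  simp [counitLin]

theorem counitLin_mul (x y : Biproduct k H B) :
    counitLin k H B (x * y) = counitLin k H B x * counitLin k H B y := by
  induction x using induction_on with
  | hz => simp
  | ha x y hx hy => simp only [map_add, add_mul, hx, hy]
  | ht b h =>
  induction y using induction_on with
  | hz => simp
  | ha x y hx hy => simp only [map_add, mul_add, hx, hy]
  | ht c g =>
  have key : ∀ t : H ⊗[k] H, counitLin k H B (of k H B ((b ⊗ₜ 1) *
      ((act (k := k) (H := H) (V := B)).toLinearMap.flip c).rTensor H t * (1 ⊗ₜ g))) =
      counit (R := k) b * (counit (R := k) c * counit (R := k) (TensorProduct.lid k H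
        ((counit (R := k)).rTensor H t))) * counit (R := k) g := by
    intro t
    induction t using TensorProduct.induction_on with
    | zero => simp
    | add x y hx hy => simp only [map_add, mul_add, add_mul, hx, hy]
    | tmul x y =>
      simp [counitLin_of, BraidedGroup.counit_mul (k := k) (H := H),
        BraidedGroup.act_counit (k := k) (H := H)]
      ring
  rw [mul_def, mulMap_tmul, crossMap_tmul, key, counitLin_of, counitLin_of]
  simp
  ring

variable (k H B)

/-- The counit of the biproduct, as an algebra map. -/
noncomputable def counitHom : Biproduct k H B →ₐ[k] k :=
  AlgHom.ofLinearMap (counitLin k H B) (by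
    rw [one_def, counitLin_of]; simp [BraidedGroup.counit_one (k := k) (H := H) (B := B)])
    counitLin_mul

variable {k H B}

theorem comulHom_incl (b : B) : comulHom k H B (incl k H B b) = comulB k H B b := by
  change comulLin k H B _ = _
  rw [incl_apply, comulLin_of, map_one, mul_one]

theorem comulHom_inclH (h : H) : comulHom k H B (inclH k H B h) = comulH k H B h := by
  change comulLin k H B _ = _
  rw [inclH_apply, comulLin_of, comulB_one, one_mul]

theorem counitHom_incl (b : B) : counitHom k H B (incl k H B b) = counit (R := k) b := by
  rw [counitHom, AlgHom.ofLinearMap_apply, incl_apply, counitLin_of]; simp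

theorem counitHom_inclH (h : H) : counitHom k H B (inclH k H B h) = counit (R := k) h := by
  rw [counitHom, AlgHom.ofLinearMap_apply, inclH_apply, counitLin_of]; simp [BraidedGroup.counit_one (k := k) (H := H) (B := B)]

variable (k H B)

/-- `x ⊗ y ↦ x ⊗ (y ⊗ 1)`. -/
noncomputable def inc12 : Biproduct k H B ⊗[k] Biproduct k H B →ₐ[k]
    Biproduct k H B ⊗[k] (Biproduct k H B ⊗[k] Biproduct k H B) :=
  Algebra.TensorProduct.map (AlgHom.id k _) Algebra.TensorProduct.includeLeft

/-- `b ↦ j b⁽¹⁾ ⊗ j b⁽²⁾ ⊗ b⁽³⁾`. -/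
noncomputable def coactP₂ : B →ₐ[k] Biproduct k H B ⊗[k] (Biproduct k H B ⊗[k] Biproduct k H B) :=
  (Algebra.TensorProduct.map (inclH k H B) (coactP k H B)).comp (coactHom k H B)

variable {k H B}

theorem inc12_tmul (x y : Biproduct k H B) : inc12 k H B (x ⊗ₜ y) = x ⊗ₜ (y ⊗ₜ 1) := rfl

theorem assoc_comul_coactP (b : B) : Algebra.TensorProduct.assoc k k k _ _ _
    (Algebra.TensorProduct.map (comulHom k H B) (AlgHom.id k _) (coactP k H B b)) =
      coactP₂ k H B b := by
  have e : coactP₂ k H B b = TensorProduct.map (inclH k H B).toLinearMap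
      (TensorProduct.map (inclH k H B).toLinearMap (incl k H B).toLinearMap)
      ((coact (k := k)).lTensor H (coact (k := k) b)) := by
    simp only [coactP₂, AlgHom.comp_apply]
    change TensorProduct.map _ _ (coact (k := k) b) = _
    induction coact (k := k) (H := H) b using TensorProduct.induction_on with
    | zero => simp
    | add x y hx hy => simp only [map_add, hx, hy]
    | tmul x y => rfl
  rw [e, ← CrossedModule.coassoc_coact, coactP_apply]
  induction coact (k := k) (H := H) b using TensorProduct.induction_on with
  | zero => simp
  | add x y hx hy => simp only [map_add, hx, hy]
  | tmul x y =>
    simp only [TensorProduct.map_tmul, AlgHom.toLinearMap_apply, Algebra.TensorProduct.map_tmul,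
      comulHom_inclH, comulH_apply, LinearMap.rTensor_tmul, AlgHom.id_apply]
    induction comul (R := k) x using TensorProduct.induction_on with
    | zero => simp
    | add x y hx hy => simp only [map_add, TensorProduct.add_tmul, hx, hy]
    | tmul x y => simp

theorem assoc_tmul_one (t : Biproduct k H B ⊗[k] Biproduct k H B) :
    Algebra.TensorProduct.assoc k k k _ _ _ (t ⊗ₜ[k] (1 : Biproduct k H B)) = inc12 k H B t := by
  induction t using TensorProduct.induction_on with
  | zero => simp
  | add x y hx hy => simp only [map_add, TensorProduct.add_tmul, hx, hy]
  | tmul x y => simp [inc12]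

theorem map_comulAux (c : B) : TensorProduct.map (inclH k H B).toLinearMap (comulB k H B)
    (coact (k := k) c) = LinearMap.mul' k _ (TensorProduct.map
      ((inc12 k H B).toLinearMap ∘ₗ (coactP k H B).toLinearMap) (coactP₂ k H B).toLinearMap
      (comul (R := k) c)) := by
  rw [comulB, ← LinearMap.comp_id (inclH k H B).toLinearMap, TensorProduct.map_comp,
    LinearMap.comp_apply]
  change TensorProduct.map _ _ ((comul (R := k)).lTensor H _) = _
  rw [BraidedGroup.coact_comul]
  induction comul (R := k) c using TensorProduct.induction_on with
  | zero => simp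
  | add x y hx hy => simp only [map_add, hx, hy]
  | tmul b c =>
  simp only [leftTensorCoact, LinearMap.comp_apply, TensorProduct.map_tmul, LinearMap.mul'_apply,
    AlgHom.toLinearMap_apply, coactP_apply, coactP₂, AlgHom.comp_apply]
  change _ = _ * TensorProduct.map (inclH k H B).toLinearMap (coactP k H B).toLinearMap
    (coact (k := k) c)
  induction coact (k := k) (H := H) b using TensorProduct.induction_on with
  | zero => simp
  | add x y hx hy => simp only [map_add, add_mul, TensorProduct.add_tmul, hx, hy]
  | tmul x y =>
  induction coact (k := k) (H := H) c using TensorProduct.induction_on with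
  | zero => simp
  | add x y hx hy => simp only [map_add, mul_add, TensorProduct.tmul_add, hx, hy]
  | tmul z w => simp [midTwist, inc12, comulAux_tmul]

theorem coassoc_incl (b : B) : Algebra.TensorProduct.assoc k k k _ _ _
    (Algebra.TensorProduct.map (comulHom k H B) (AlgHom.id k _) (comulB k H B b)) =
    Algebra.TensorProduct.map (AlgHom.id k _) (comulHom k H B) (comulB k H B b) := by
  let Q : B ⊗[k] (B ⊗[k] B) →ₗ[k]
      Biproduct k H B ⊗[k] (Biproduct k H B ⊗[k] Biproduct k H B) :=
    LinearMap.mul' k _ ∘ₗ TensorProduct.map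
      (Algebra.TensorProduct.includeLeft.comp (incl k H B) :
        B →ₐ[k] Biproduct k H B ⊗[k] (Biproduct k H B ⊗[k] Biproduct k H B)).toLinearMap
      (LinearMap.mul' k _ ∘ₗ TensorProduct.map
      ((inc12 k H B).toLinearMap ∘ₗ (coactP k H B).toLinearMap) (coactP₂ k H B).toLinearMap)
  have h1 : Algebra.TensorProduct.assoc k k k _ _ _
      (Algebra.TensorProduct.map (comulHom k H B) (AlgHom.id k _) (comulB k H B b)) =
      Q (TensorProduct.assoc k B B B ((comul (R := k)).rTensor B (comul (R := k) b))) := by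
    rw [comulB, LinearMap.comp_apply]
    induction comul (R := k) b using TensorProduct.induction_on with
    | zero => simp
    | add x y hx hy => simp only [map_add, hx, hy]
    | tmul b c =>
      rw [comulAux_tmul, map_mul, map_mul, assoc_comul_coactP, Algebra.TensorProduct.map_tmul,
        comulHom_incl, map_one, assoc_tmul_one, LinearMap.rTensor_tmul, comulB,
        LinearMap.comp_apply]
      induction comul (R := k) b using TensorProduct.induction_on with
      | zero => simp
      | add x y hx hy => simp only [map_add, add_mul, TensorProduct.add_tmul, hx, hy]
      | tmul x y => simp [Q, comulAux_tmul, inc12_tmul, mul_assoc, Algebra.TensorProduct.one_def]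
  rw [h1, Coalgebra.coassoc_apply]
  change _ = Algebra.TensorProduct.map (AlgHom.id k _) (comulHom k H B)
    (comulAux k H B (comul (R := k) b))
  induction comul (R := k) b using TensorProduct.induction_on with
  | zero => simp
  | add x y hx hy => simp only [map_add, hx, hy]
  | tmul b c =>
    have e : Algebra.TensorProduct.map (AlgHom.id k _) (comulHom k H B) (coactP k H B c) =
        TensorProduct.map (inclH k H B).toLinearMap (comulB k H B) (coact (k := k) c) := by
      rw [coactP_apply]
      induction coact (k := k) (H := H) c using TensorProduct.induction_on with
      | zero => simp
      | add x y hx hy => simp only [map_add, hx, hy]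
      | tmul x y => simp [comulHom_incl]
    rw [comulAux_tmul, map_mul, e, map_comulAux]
    simp [Q]

theorem map_counit_coactP (b : B) :
    Algebra.TensorProduct.map (counitHom k H B) (AlgHom.id k _) (coactP k H B b) =
      1 ⊗ₜ incl k H B b := by
  conv_rhs => rw [← CrossedModule.counit_coact (k := k) (H := H) b]
  rw [ coactP_apply]
  induction coact (k := k) (H := H) b using TensorProduct.induction_on with
  | zero => simp
  | add x y hx hy => simp only [map_add, TensorProduct.tmul_add, hx, hy]
  | tmul x y => simp [counitHom_inclH, TensorProduct.smul_tmul']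

theorem map_counit_coactP' (b : B) :
    Algebra.TensorProduct.map (AlgHom.id k _) (counitHom k H B) (coactP k H B b) =
      1 ⊗ₜ counit (R := k) b := by
  have := congrArg (fun x => inclH k H B x ⊗ₜ[k] (1 : k))
    (BraidedGroup.coact_counit (k := k) (H := H) b)
  simp only [map_smul, map_one, TensorProduct.smul_tmul, smul_eq_mul, mul_one] at this
  rw [← this, coactP_apply]
  induction coact (k := k) (H := H) b using TensorProduct.induction_on with
  | zero => simp
  | add x y hx hy => simp only [map_add, TensorProduct.add_tmul, hx, hy]
  | tmul x y => simp [counitHom_incl, TensorProduct.smul_tmul]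

variable (k H B)

noncomputable instance instBialgebra : Bialgebra k (Biproduct k H B) :=
  Bialgebra.ofAlgHom (comulHom k H B) (counitHom k H B)
    (algHom_ext (fun b => by
      simp only [AlgHom.comp_apply, comulHom_incl]
      exact coassoc_incl b)
    (fun h => by
      simp only [AlgHom.comp_apply, comulHom_inclH, comulH_apply]
      have h1 : ∀ t : H ⊗[k] H, Algebra.TensorProduct.assoc k k k _ _ _
          (Algebra.TensorProduct.map (comulHom k H B) (AlgHom.id k _) (TensorProduct.map
            (inclH k H B).toLinearMap (inclH k H B).toLinearMap t)) =
          TensorProduct.map (inclH k H B).toLinearMap (TensorProduct.map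
            (inclH k H B).toLinearMap (inclH k H B).toLinearMap)
            (TensorProduct.assoc k H H H ((comul (R := k)).rTensor H t)) := by
        intro t
        induction t using TensorProduct.induction_on with
        | zero => simp
        | add x y hx hy => simp only [map_add, hx, hy]
        | tmul x y =>
          simp only [TensorProduct.map_tmul, AlgHom.toLinearMap_apply, comulHom_inclH,
            Algebra.TensorProduct.map_tmul, comulH_apply, LinearMap.rTensor_tmul, AlgHom.id_apply]
          induction comul (R := k) x using TensorProduct.induction_on with
          | zero => simp
          | add x y hx hy => simp only [map_add, TensorProduct.add_tmul, hx, hy]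
          | tmul x y => simp
      have h2 : ∀ t : H ⊗[k] H,
          Algebra.TensorProduct.map (AlgHom.id k _) (comulHom k H B) (TensorProduct.map
            (inclH k H B).toLinearMap (inclH k H B).toLinearMap t) =
          TensorProduct.map (inclH k H B).toLinearMap (TensorProduct.map
            (inclH k H B).toLinearMap (inclH k H B).toLinearMap)
            ((comul (R := k)).lTensor H t) := by
        intro t
        induction t using TensorProduct.induction_on with
        | zero => simp
        | add x y hx hy => simp only [map_add, hx, hy]
        | tmul x y => simp [comulHom_inclH, comulH_apply]
      rw [h2, ← Coalgebra.coassoc_apply, ← h1]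
      rfl))
    (algHom_ext (fun b => by
      simp only [AlgHom.comp_apply, comulHom_incl, comulB, LinearMap.comp_apply]
      have h1 : ∀ t : B ⊗[k] B, Algebra.TensorProduct.map (counitHom k H B) (AlgHom.id k _)
          (comulAux k H B t) =
          1 ⊗ₜ incl k H B (TensorProduct.lid k B ((counit (R := k)).rTensor B t)) := by
        intro t
        induction t using TensorProduct.induction_on with
        | zero => simp
        | add x y hx hy => simp only [map_add, TensorProduct.tmul_add, hx, hy]
        | tmul x y =>
          rw [comulAux_tmul, map_mul, map_counit_coactP]
          simp [counitHom_incl, TensorProduct.smul_tmul']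
      rw [h1]
      simp)
    (fun h => by
      simp only [AlgHom.comp_apply, comulHom_inclH, comulH_apply]
      have h1 : ∀ t : H ⊗[k] H, Algebra.TensorProduct.map (counitHom k H B) (AlgHom.id k _)
          (TensorProduct.map (inclH k H B).toLinearMap (inclH k H B).toLinearMap t) =
          1 ⊗ₜ inclH k H B (TensorProduct.lid k H ((counit (R := k)).rTensor H t)) := by
        intro t
        induction t using TensorProduct.induction_on with
        | zero => simp
        | add x y hx hy => simp only [map_add, TensorProduct.tmul_add, hx, hy]
        | tmul x y => simp [counitHom_inclH, TensorProduct.smul_tmul']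
      rw [h1]
      simp))
    (algHom_ext (fun b => by
      simp only [AlgHom.comp_apply, comulHom_incl, comulB, LinearMap.comp_apply]
      have h1 : ∀ t : B ⊗[k] B, Algebra.TensorProduct.map (AlgHom.id k _) (counitHom k H B)
          (comulAux k H B t) =
          incl k H B (TensorProduct.rid k B ((counit (R := k)).lTensor B t)) ⊗ₜ 1 := by
        intro t
        induction t using TensorProduct.induction_on with
        | zero => simp
        | add x y hx hy => simp only [map_add, TensorProduct.add_tmul, hx, hy]
        | tmul x y =>
          rw [comulAux_tmul, map_mul, map_counit_coactP']
          simp [TensorProduct.smul_tmul]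
      rw [h1]
      simp)
    (fun h => by
      simp only [AlgHom.comp_apply, comulHom_inclH, comulH_apply]
      have h1 : ∀ t : H ⊗[k] H, Algebra.TensorProduct.map (AlgHom.id k _) (counitHom k H B)
          (TensorProduct.map (inclH k H B).toLinearMap (inclH k H B).toLinearMap t) =
          inclH k H B (TensorProduct.rid k H ((counit (R := k)).lTensor H t)) ⊗ₜ 1 := by
        intro t
        induction t using TensorProduct.induction_on with
        | zero => simp
        | add x y hx hy => simp only [map_add, TensorProduct.add_tmul, hx, hy]
        | tmul x y => simp [counitHom_inclH, TensorProduct.smul_tmul]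
      rw [h1]
      simp))

variable {k H B}

theorem comul_incl (b : B) : comul (R := k) (incl k H B b) = comulB k H B b := comulHom_incl b

theorem comul_inclH (h : H) : comul (R := k) (inclH k H B h) = comulH k H B h := comulHom_inclH h

theorem counit_incl (b : B) : counit (R := k) (incl k H B b) = counit (R := k) b :=
  counitHom_incl b

theorem counit_inclH (h : H) : counit (R := k) (inclH k H B h) = counit (R := k) h :=
  counitHom_inclH h

open BraidedGroup (bantipode)

variable (k H B)

/-- The antipode `S (b ⊗ h) = j (S (b⁽¹⁾ h)) S̲ b⁽²⁾`. -/
noncomputable def antipodeLin : Biproduct k H B →ₗ[k] Biproduct k H B :=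
  LinearMap.mul' k _ ∘ₗ
    TensorProduct.map ((inclH k H B).toLinearMap ∘ₗ HopfAlgebra.antipode k)
      ((incl k H B).toLinearMap ∘ₗ bantipode (k := k) H) ∘ₗ
    crossComap k H B ∘ₗ (of k H B).symm.toLinearMap

variable {k H B}

theorem antipodeLin_of (b : B) (h : H) : antipodeLin k H B (of k H B (b ⊗ₜ h)) =
    LinearMap.mul' k _ (TensorProduct.map ((inclH k H B).toLinearMap ∘ₗ HopfAlgebra.antipode k ∘ₗ
      LinearMap.mulRight k h) ((incl k H B).toLinearMap ∘ₗ bantipode (k := k) H)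
        (coact (k := k) b)) := by
  simp only [antipodeLin, crossComap, LinearMap.comp_apply, LinearEquiv.coe_coe,
    LinearEquiv.symm_apply_apply, LinearMap.rTensor_tmul]
  induction coact (k := k) (H := H) b using TensorProduct.induction_on with
  | zero => simp
  | add x y hx hy => simp only [map_add, TensorProduct.add_tmul, hx, hy]
  | tmul x y => simp

theorem antipode_left_aux (b : B) (s : H ⊗[k] H) :
    LinearMap.mul' k _ ((antipodeLin k H B).rTensor _ (comulB k H B b *
      TensorProduct.map (inclH k H B).toLinearMap (inclH k H B).toLinearMap s)) =
    counit (R := k) b • inclH k H B (LinearMap.mul' k H ((HopfAlgebra.antipode k).rTensor H s)) := by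
  induction s using TensorProduct.induction_on with
  | zero => simp
  | add x y hx hy => simp only [map_add, mul_add, smul_add, hx, hy]
  | tmul h g =>
  let R : H ⊗[k] (B ⊗[k] B) →ₗ[k] Biproduct k H B :=
    LinearMap.mulRight k (inclH k H B g) ∘ₗ LinearMap.mul' k _ ∘ₗ TensorProduct.map
      ((inclH k H B).toLinearMap ∘ₗ HopfAlgebra.antipode k ∘ₗ LinearMap.mulRight k h)
      ((incl k H B).toLinearMap ∘ₗ LinearMap.mul' k B ∘ₗ (bantipode (k := k) H).rTensor B)
  have h1 : LinearMap.mul' k _ ((antipodeLin k H B).rTensor _ (comulB k H B b *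
      TensorProduct.map (inclH k H B).toLinearMap (inclH k H B).toLinearMap (h ⊗ₜ g))) =
      R (leftTensorCoact (coact (k := k)) (coact (k := k)) (comul (R := k) b)) := by
    rw [comulB, LinearMap.comp_apply]
    induction comul (R := k) b using TensorProduct.induction_on with
    | zero => simp
    | add x y hx hy => simp only [map_add, add_mul, hx, hy]
    | tmul b c =>
    simp only [comulAux_tmul, coactP_apply, leftTensorCoact, LinearMap.comp_apply,
      TensorProduct.map_tmul]
    induction coact (k := k) (H := H) c using TensorProduct.induction_on with
    | zero => simp
    | add x y hx hy => simp only [map_add, mul_add, add_mul, TensorProduct.tmul_add, hx, hy]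
    | tmul z w =>
    simp only [TensorProduct.map_tmul, AlgHom.toLinearMap_apply,
      Algebra.TensorProduct.tmul_mul_tmul, LinearMap.rTensor_tmul, one_mul, mul_assoc]
    rw [← map_mul (inclH k H B), ← of_tmul, antipodeLin_of]
    induction coact (k := k) (H := H) b using TensorProduct.induction_on with
    | zero => simp
    | add x y hx hy => simp only [map_add, TensorProduct.add_tmul, hx, hy]
    | tmul x y => simp [R, midTwist, mul_assoc]
  rw [h1, ← BraidedGroup.coact_comul]
  have h2 : ∀ t : H ⊗[k] B, R ((comul (R := k)).lTensor H t) = inclH k H B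
      (HopfAlgebra.antipode k (TensorProduct.rid k H ((counit (R := k)).lTensor H t) * h) * g) := by
    intro t
    induction t using TensorProduct.induction_on with
    | zero => simp
    | add x y hx hy => simp only [map_add, add_mul, hx, hy]
    | tmul x y =>
      simp [R, BraidedGroup.mul_bantipode_rTensor_comul]
  rw [h2, BraidedGroup.coact_counit]
  simp

theorem antipode_right_aux (c : B) (h : H) :
    LinearMap.mul' k _ ((antipodeLin k H B).lTensor _ (coactP k H B c * comulH k H B h)) =
    counit (R := k) h • incl k H B (bantipode (k := k) H c) := by
  let V : H ⊗[k] H → H ⊗[k] (H ⊗[k] B) →ₗ[k] Biproduct k H B := fun s =>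
    LinearMap.mul' k _ ∘ₗ TensorProduct.map
      ((inclH k H B).toLinearMap ∘ₗ LinearMap.mul' k H ∘ₗ (HopfAlgebra.antipode k).lTensor H ∘ₗ
        LinearMap.mulRight k s)
      ((incl k H B).toLinearMap ∘ₗ bantipode (k := k) H) ∘ₗ
      (TensorProduct.assoc k H H B).symm.toLinearMap
  have V0 : V 0 = 0 := by simp [V]
  have Va : ∀ s t, V (s + t) = V s + V t := by
    intro s t
    have e : LinearMap.mulRight k (s + t) = LinearMap.mulRight k s + LinearMap.mulRight k t := by
      ext; simp [mul_add]
    simp only [V, e, LinearMap.comp_add, LinearMap.add_comp, TensorProduct.map_add_left]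
  have h1 : ∀ s : H ⊗[k] H, LinearMap.mul' k _ ((antipodeLin k H B).lTensor _ (coactP k H B c *
      TensorProduct.map (inclH k H B).toLinearMap (inclH k H B).toLinearMap s)) =
      V s ((coact (k := k)).lTensor H (coact (k := k) c)) := by
    intro s
    induction s using TensorProduct.induction_on with
    | zero => simp [V0]
    | add x y hx hy => simp only [map_add, mul_add, Va, LinearMap.add_apply, hx, hy]
    | tmul h g =>
    rw [coactP_apply]
    induction coact (k := k) (H := H) c using TensorProduct.induction_on with
    | zero => simp
    | add x y hx hy => simp only [map_add, add_mul, hx, hy]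
    | tmul z w =>
    simp only [TensorProduct.map_tmul, AlgHom.toLinearMap_apply,
      Algebra.TensorProduct.tmul_mul_tmul, LinearMap.lTensor_tmul]
    rw [← of_tmul, antipodeLin_of]
    induction coact (k := k) (H := H) w using TensorProduct.induction_on with
    | zero => simp
    | add x y hx hy => simp only [map_add, TensorProduct.tmul_add, hx, hy]
    | tmul x y => simp [V, mul_assoc]
  rw [comulH_apply, h1, ← CrossedModule.coassoc_coact]
  have h2 : ∀ t : H ⊗[k] B, V (comul (R := k) h) (TensorProduct.assoc k H H B
      ((comul (R := k)).rTensor B t)) = counit (R := k) h • incl k H B (bantipode (k := k) H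
        (TensorProduct.lid k B ((counit (R := k)).rTensor B t))) := by
    intro t
    induction t using TensorProduct.induction_on with
    | zero => simp
    | add x y hx hy => simp only [map_add, smul_add, hx, hy]
    | tmul x y =>
      simp only [V, LinearMap.comp_apply, LinearEquiv.coe_coe, LinearMap.rTensor_tmul,
        LinearEquiv.symm_apply_apply, TensorProduct.map_tmul, LinearMap.mulRight_apply,
        ← Bialgebra.comul_mul, HopfAlgebra.mul_antipode_lTensor_comul_apply]
      simp [Algebra.algebraMap_eq_smul_one, smul_smul, mul_comm]
  rw [h2, CrossedModule.counit_coact]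

variable (k H B)

noncomputable instance instHopfAlgebra : HopfAlgebra k (Biproduct k H B) where
  antipode := antipodeLin k H B
  mul_antipode_rTensor_comul := by
    ext x
    induction x using induction_on with
    | hz => simp
    | ha x y hx hy => simp only [map_add, hx, hy]
    | ht b h =>
    rw [LinearMap.comp_apply, LinearMap.comp_apply, of_tmul, Bialgebra.comul_mul, comul_incl,
      comul_inclH, comulH_apply, antipode_left_aux]
    simp [counit_incl, counit_inclH, Algebra.smul_def]
  mul_antipode_lTensor_comul := by
    ext x
    induction x using induction_on with
    | hz => simp
    | ha x y hx hy => simp only [map_add, hx, hy]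
    | ht b h =>
    rw [LinearMap.comp_apply, LinearMap.comp_apply, of_tmul, Bialgebra.comul_mul, comul_incl,
      comul_inclH, comulB, LinearMap.comp_apply]
    have h1 : ∀ (b : B) (t : Biproduct k H B ⊗[k] Biproduct k H B),
        LinearMap.mul' k _ ((antipodeLin k H B).lTensor _ ((incl k H B b ⊗ₜ 1) * t)) =
          incl k H B b * LinearMap.mul' k _ ((antipodeLin k H B).lTensor _ t) := by
      intro b t
      induction t using TensorProduct.induction_on with
      | zero => simp
      | add x y hx hy => simp only [map_add, mul_add, hx, hy]
      | tmul x y => simp [mul_assoc]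
    have h2 : ∀ t : B ⊗[k] B, LinearMap.mul' k _ ((antipodeLin k H B).lTensor _
        (comulAux k H B t * comulH k H B h)) = counit (R := k) h • incl k H B
          (LinearMap.mul' k B ((bantipode (k := k) H).lTensor B t)) := by
      intro t
      induction t using TensorProduct.induction_on with
      | zero => simp
      | add x y hx hy => simp only [map_add, add_mul, smul_add, hx, hy]
      | tmul x y => rw [comulAux_tmul, mul_assoc, h1, antipode_right_aux]; simp
    rw [h2, BraidedGroup.mul_bantipode_lTensor_comul]
    simp [counit_incl, counit_inclH, Algebra.smul_def, mul_comm]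

/-- The projection `π (b ⊗ h) = ε(b) h` as a linear map. -/
noncomputable def projLin : Biproduct k H B →ₗ[k] H :=
  (TensorProduct.lid k H).toLinearMap ∘ₗ (counit (R := k) (A := B)).rTensor H ∘ₗ
    (of k H B).symm.toLinearMap

variable {k H B}

theorem projLin_of (b : B) (h : H) :
    projLin k H B (of k H B (b ⊗ₜ h)) = counit (R := k) b • h := by
  simp [projLin]

theorem projLin_mul (x y : Biproduct k H B) :
    projLin k H B (x * y) = projLin k H B x * projLin k H B y := by
  induction x using induction_on with
  | hz => simp
  | ha x y hx hy => simp only [map_add, add_mul, hx, hy]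
  | ht b h =>
  induction y using induction_on with
  | hz => simp
  | ha x y hx hy => simp only [map_add, mul_add, hx, hy]
  | ht c g =>
  have key : ∀ t : H ⊗[k] H, projLin k H B (of k H B ((b ⊗ₜ 1) *
      ((act (k := k) (H := H) (V := B)).toLinearMap.flip c).rTensor H t * (1 ⊗ₜ g))) =
      counit (R := k) b • counit (R := k) c • (TensorProduct.lid k H
        ((counit (R := k)).rTensor H t) * g) := by
    intro t
    induction t using TensorProduct.induction_on with
    | zero => simp
    | add x y hx hy => simp only [map_add, mul_add, add_mul, smul_add, hx, hy]
    | tmul x y =>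
      simp [projLin_of, BraidedGroup.counit_mul (k := k) (H := H), smul_smul,
        BraidedGroup.act_counit (k := k) (H := H), mul_comm, mul_assoc]
  rw [mul_def, mulMap_tmul, crossMap_tmul, key, projLin_of, projLin_of]
  simp [smul_smul, mul_comm]

variable (k H B)

/-- The projection `π (b ⊗ h) = ε(b) h` as an algebra map. -/
noncomputable def projHom : Biproduct k H B →ₐ[k] H :=
  AlgHom.ofLinearMap (projLin k H B) (by
    rw [one_def, projLin_of]; simp [BraidedGroup.counit_one (k := k) (H := H) (B := B)])
    projLin_mul

variable {k H B}

theorem projHom_incl (b : B) : projHom k H B (incl k H B b) = counit (R := k) b • 1 := by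
  rw [projHom, AlgHom.ofLinearMap_apply, incl_apply, projLin_of]

theorem projHom_inclH (h : H) : projHom k H B (inclH k H B h) = h := by
  rw [projHom, AlgHom.ofLinearMap_apply, inclH_apply, projLin_of]
  simp [BraidedGroup.counit_one (k := k) (H := H) (B := B)]

theorem map_proj_comulH (h : H) : Algebra.TensorProduct.map (projHom k H B) (projHom k H B)
    (comulH k H B h) = comul (R := k) h := by
  rw [comulH_apply]
  induction comul (R := k) h using TensorProduct.induction_on with
  | zero => simp
  | add x y hx hy => simp only [map_add, hx, hy]
  | tmul x y => simp [projHom_inclH]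

theorem map_proj_coactP (b : B) : Algebra.TensorProduct.map (projHom k H B) (projHom k H B)
    (coactP k H B b) = counit (R := k) b • 1 := by
  have e : ∀ t : H ⊗[k] B, Algebra.TensorProduct.map (projHom k H B) (projHom k H B)
      (TensorProduct.map (inclH k H B).toLinearMap (incl k H B).toLinearMap t) =
      (TensorProduct.rid k H ((counit (R := k) (A := B)).lTensor H t)) ⊗ₜ 1 := by
    intro t
    induction t using TensorProduct.induction_on with
    | zero => simp
    | add x y hx hy => simp only [map_add, TensorProduct.add_tmul, hx, hy]
    | tmul x y => simp [projHom_inclH, projHom_incl, TensorProduct.smul_tmul]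
  rw [coactP_apply, e, BraidedGroup.coact_counit, TensorProduct.smul_tmul,
    TensorProduct.tmul_smul, Algebra.TensorProduct.one_def]

theorem map_proj_comulB (b : B) : Algebra.TensorProduct.map (projHom k H B) (projHom k H B)
    (comulB k H B b) = counit (R := k) b • 1 := by
  have e : ∀ t : B ⊗[k] B, Algebra.TensorProduct.map (projHom k H B) (projHom k H B)
      (comulAux k H B t) =
      (counit (R := k) (TensorProduct.lid k B ((counit (R := k)).rTensor B t))) • 1 := by
    intro t
    induction t using TensorProduct.induction_on with
    | zero => simp
    | add x y hx hy => simp only [map_add, add_smul, hx, hy]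
    | tmul x y =>
      rw [comulAux_tmul, map_mul, map_proj_coactP]
      simp [projHom_incl, smul_smul, Algebra.TensorProduct.one_def, TensorProduct.smul_tmul',
        mul_comm]
  rw [comulB, LinearMap.comp_apply, e]
  simp

variable (k H B)

/-- The Hopf algebra projection `π (b ⊗ h) = ε(b) h`. -/
noncomputable def proj : Biproduct k H B →ₐc[k] H :=
  BialgHom.ofAlgHom (projHom k H B)
    (algHom_ext (fun b => by simp [projHom_incl, counit_incl])
      (fun h => by simp [projHom_inclH, counit_inclH]))
    (algHom_ext (fun b => by
        simp only [AlgHom.comp_apply, Bialgebra.comulAlgHom_apply, comul_incl, map_proj_comulB,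
          projHom_incl, map_smul, map_one])
      (fun h => by
        simp only [AlgHom.comp_apply, Bialgebra.comulAlgHom_apply, comul_inclH, map_proj_comulH,
          projHom_inclH]))

variable {k H B}

theorem proj_of (b : B) (h : H) : proj k H B (of k H B (b ⊗ₜ h)) = counit (R := k) b • h :=
  projLin_of b h

end

end Biproduct

/-! ### The universal differential calculus -/

/-- The universal 1-forms `Ω¹A = ker (A ⊗ A → A)`. -/
noncomputable def univForms (k A : Type*) [Field k] [Ring A] [Algebra k A] :
    Submodule k (A ⊗[k] A) := LinearMap.ker (LinearMap.mul' k A)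

namespace univForms

section

variable (k A : Type*) [Field k] [Ring A] [Algebra k A]

/-- The universal differential `d u = 1 ⊗ u - u ⊗ 1`. -/
noncomputable def d : A →ₗ[k] univForms k A :=
  (TensorProduct.mk k A A 1 - (TensorProduct.mk k A A).flip 1).codRestrict _ (fun u => by
    simp [univForms])

/-- The left multiplication `u ⊗ η ↦ u η` of forms, where `u (x ⊗ y) = u x ⊗ y`. -/
noncomputable def lmul : A ⊗[k] univForms k A →ₗ[k] univForms k A :=
  ((LinearMap.mul' k A).rTensor A ∘ₗ (TensorProduct.assoc k A A A).symm.toLinearMap ∘ₗ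
    (univForms k A).subtype.lTensor A).codRestrict _ (fun t => by
      have key : ∀ s : A ⊗[k] (A ⊗[k] A), LinearMap.mul' k A ((LinearMap.mul' k A).rTensor A
          ((TensorProduct.assoc k A A A).symm s)) =
          LinearMap.mul' k A ((LinearMap.mul' k A).lTensor A s) := fun s => by
        induction s using TensorProduct.induction_on with
        | zero => simp
        | add x y hx hy => simp only [map_add, hx, hy]
        | tmul x y =>
          induction y using TensorProduct.induction_on with
          | zero => simp
          | add x y hx hy => simp only [TensorProduct.tmul_add, map_add, hx, hy]
          | tmul y z => simp [mul_assoc]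
      change LinearMap.mul' k A ((LinearMap.mul' k A).rTensor A
          ((TensorProduct.assoc k A A A).symm ((univForms k A).subtype.lTensor A t))) = 0
      rw [key, ← LinearMap.lTensor_comp_apply]
      have : LinearMap.mul' k A ∘ₗ (univForms k A).subtype = 0 :=
        LinearMap.ext fun x => x.2
      rw [this]
      simp)

/-- The right multiplication `η ⊗ v ↦ η v` of forms, where `(x ⊗ y) v = x ⊗ y v`. -/
noncomputable def rmul : univForms k A ⊗[k] A →ₗ[k] univForms k A :=
  ((LinearMap.mul' k A).lTensor A ∘ₗ (TensorProduct.assoc k A A A).toLinearMap ∘ₗ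
    (univForms k A).subtype.rTensor A).codRestrict _ (fun t => by
      have key : ∀ s : (A ⊗[k] A) ⊗[k] A, LinearMap.mul' k A ((LinearMap.mul' k A).lTensor A
          (TensorProduct.assoc k A A A s)) =
          LinearMap.mul' k A ((LinearMap.mul' k A).rTensor A s) := fun s => by
        induction s using TensorProduct.induction_on with
        | zero => simp
        | add x y hx hy => simp only [map_add, hx, hy]
        | tmul x y =>
          induction x using TensorProduct.induction_on with
          | zero => simp
          | add x y hx hy => simp only [TensorProduct.add_tmul, map_add, hx, hy]
          | tmul y z => simp [mul_assoc]
      change LinearMap.mul' k A ((LinearMap.mul' k A).lTensor A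
          (TensorProduct.assoc k A A A ((univForms k A).subtype.rTensor A t))) = 0
      rw [key, ← LinearMap.rTensor_comp_apply]
      have : LinearMap.mul' k A ∘ₗ (univForms k A).subtype = 0 :=
        LinearMap.ext fun x => x.2
      rw [this]
      simp)

/-- `u ⊗ v ↦ u d v`. -/
noncomputable def mulD : A ⊗[k] A →ₗ[k] univForms k A := lmul k A ∘ₗ (d k A).lTensor A

variable {k A}

/-- The map `Ω¹A → Ω¹A'` induced by an algebra map. -/
noncomputable def map {A' : Type*} [Ring A'] [Algebra k A'] (f : A →ₐ[k] A') :
    univForms k A →ₗ[k] univForms k A' :=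
  (TensorProduct.map f.toLinearMap f.toLinearMap).restrict (fun t ht => by
    have key : ∀ s : A ⊗[k] A, LinearMap.mul' k A'
        (TensorProduct.map f.toLinearMap f.toLinearMap s) = f (LinearMap.mul' k A s) := fun s => by
      induction s using TensorProduct.induction_on with
      | zero => simp
      | add x y hx hy => simp only [map_add, hx, hy]
      | tmul x y => simp
    change LinearMap.mul' k A' _ = 0
    rw [key, show LinearMap.mul' k A t = 0 from ht, map_zero])

end

end univForms

/-! ### Augmentation ideals and adjoint coactions -/

/-- The kernel of the counit. -/
noncomputable def augKer (k A : Type*) [Field k] [Ring A] [Algebra k A] [Coalgebra k A] :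
    Submodule k A := LinearMap.ker (counit (R := k) (A := A))

/-- The projection `π_ε h = h - ε(h) 1` onto the kernel of the counit. -/
noncomputable def augProj (k A : Type*) [Field k] [Ring A] [Bialgebra k A] :
    A →ₗ[k] augKer k A :=
  (LinearMap.id - (LinearMap.toSpanSingleton k A 1) ∘ₗ counit (R := k)).codRestrict _ (fun h => by
    change counit (R := k) _ = 0
    simp)

section Adjoint

variable (k A : Type*) [Field k] [Ring A] [HopfAlgebra k A]

/-- The left adjoint coaction `h ↦ h₁ S h₃ ⊗ h₂`. -/
noncomputable def adL : A →ₗ[k] A ⊗[k] A :=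
  (LinearMap.mul' k A ∘ₗ (HopfAlgebra.antipode k).lTensor A).rTensor A ∘ₗ
    (TensorProduct.assoc k A A A).symm.toLinearMap ∘ₗ
    (tflip k A A ∘ₗ comul (R := k)).lTensor A ∘ₗ comul (R := k)

/-- The right adjoint coaction `h ↦ h₂ ⊗ (S h₁) h₃`. -/
noncomputable def adR : A →ₗ[k] A ⊗[k] A :=
  (LinearMap.mul' k A ∘ₗ (HopfAlgebra.antipode k).rTensor A).lTensor A ∘ₗ
    (TensorProduct.assoc k A A A).toLinearMap ∘ₗ
    (tflip k A A ∘ₗ comul (R := k)).rTensor A ∘ₗ comul (R := k)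

end Adjoint

/-! ### Connections on quantum principal bundles with the universal calculus -/

section Bundle

variable {k P H : Type*} [Field k] [Ring P] [Algebra k P] [Ring H] [HopfAlgebra k H]

/-- The base `M = {u ∈ P | Δ_R u = u ⊗ 1}` of a bundle with right coaction `δ = Δ_R`. -/
noncomputable def base (δ : P →ₐ[k] P ⊗[k] H) : Subalgebra k P :=
  AlgHom.equalizer δ Algebra.TensorProduct.includeLeft

/-- The map `χ (u ⊗ v) = u Δ_R v`. -/
noncomputable def canMap (δ : P →ₐ[k] P ⊗[k] H) : P ⊗[k] P →ₗ[k] P ⊗[k] H :=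
  (LinearMap.mul' k P).rTensor H ∘ₗ (TensorProduct.assoc k P P H).symm.toLinearMap ∘ₗ
    δ.toLinearMap.lTensor P

/-- The tensor product coaction of `H` on `P ⊗ P`. -/
noncomputable def rightTensorCoact (δ : P →ₐ[k] P ⊗[k] H) :
    P ⊗[k] P →ₗ[k] (P ⊗[k] P) ⊗[k] H :=
  (LinearMap.mul' k H).lTensor (P ⊗[k] P) ∘ₗ midTwist (tflip k H P) ∘ₗ
    TensorProduct.map δ.toLinearMap δ.toLinearMap

/-- A connection `ω : ker ε → Ω¹P`: `χ ∘ ω = 1 ⊗ id` and `Δ_R ∘ ω = (ω ⊗ id) ∘ Ad`. (As `Ad`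
preserves `ker ε`, the extension `ω ∘ π_ε` of `ω` to `H` may be used on the right-hand side.) -/
structure IsConnection (δ : P →ₐ[k] P ⊗[k] H) (ω : augKer k H →ₗ[k] univForms k P) : Prop where
  canMap_eq : ∀ h : augKer k H, canMap δ (ω h : P ⊗[k] P) = 1 ⊗ₜ[k] (h : H)
  equivariant : ∀ h : augKer k H, rightTensorCoact δ (ω h : P ⊗[k] P) =
    ((univForms k P).subtype ∘ₗ ω ∘ₗ augProj k H).rTensor H (adR k H h)

/-- The projection `Π : Ω¹P → Ω¹P` of a connection, `Π = · ∘ (id ⊗ ω) ∘ χ`. -/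
noncomputable def connProj (δ : P →ₐ[k] P ⊗[k] H) (ω : augKer k H →ₗ[k] univForms k P) :
    univForms k P →ₗ[k] univForms k P :=
  univForms.lmul k P ∘ₗ (ω ∘ₗ augProj k H).lTensor P ∘ₗ canMap δ ∘ₗ (univForms k P).subtype

/-- The subspace `(Ω¹M) P` of `Ω¹P`. -/
noncomputable def strongHor (δ : P →ₐ[k] P ⊗[k] H) : Submodule k (univForms k P) :=
  LinearMap.range (univForms.rmul k P ∘ₗ (univForms.map (base δ).val).rTensor P)

/-- A connection is strong if `(id - Π)(d P) ⊆ (Ω¹M) P`. -/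
def IsStrong (δ : P →ₐ[k] P ⊗[k] H) (ω : augKer k H →ₗ[k] univForms k P) : Prop :=
  ∀ u : P, univForms.d k P u - connProj δ ω (univForms.d k P u) ∈ strongHor δ

/-- The connection
`ω (h) = Φ⁻¹(h₁) β(π_ε h₂) Φ(h₃) + Φ⁻¹(h₁) d Φ(h₂)` on a trivial bundle with trivialisation `Φ` and
convolution inverse `Φ' = Φ⁻¹`, defined by `β : ker ε → Ω¹M`. Here `f : M → P` is the inclusion. -/
noncomputable def connOfForm {M : Type*} [Ring M] [Algebra k M] (f : M →ₐ[k] P)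
    (Φ Φ' : H →ₗ[k] P) (β : augKer k H →ₗ[k] univForms k M) :
    augKer k H →ₗ[k] univForms k P :=
  (univForms.lmul k P ∘ₗ
      TensorProduct.map Φ' (univForms.rmul k P ∘ₗ
        TensorProduct.map (univForms.map f ∘ₗ β ∘ₗ augProj k H) Φ ∘ₗ comul (R := k)) ∘ₗ
      comul (R := k) +
    univForms.mulD k P ∘ₗ TensorProduct.map Φ' Φ ∘ₗ comul (R := k)) ∘ₗ (augKer k H).subtype

end Bundle

/-! ### Homogeneous bundles: the total space is a Hopf algebra -/

section Homogeneous

variable {k P H : Type*} [Field k] [Ring P] [HopfAlgebra k P] [Ring H] [HopfAlgebra k H]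

/-- The right coaction `Δ_R = (id ⊗ π) Δ` defined by a Hopf algebra map `π : P → H`. -/
noncomputable def homogCoact (π : P →ₐc[k] H) : P →ₐ[k] P ⊗[k] H :=
  (Algebra.TensorProduct.map (AlgHom.id k P) (π : P →ₐ[k] H)).comp (Bialgebra.comulAlgHom k P)

/-- The left regular coaction `Δ_L (u ⊗ v) = u₁ v₁ ⊗ (u₂ ⊗ v₂)` of `P` on `P ⊗ P`. -/
noncomputable def leftRegCoact (k P : Type*) [Field k] [Ring P] [HopfAlgebra k P] :
    P ⊗[k] P →ₗ[k] P ⊗[k] (P ⊗[k] P) :=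
  leftTensorCoact (comul (R := k)) (comul (R := k))

/-- Left-invariance `Δ_L (ω h) = 1 ⊗ ω h`. -/
def IsLeftInvariant (ω : augKer k H →ₗ[k] univForms k P) : Prop :=
  ∀ h : augKer k H, leftRegCoact k P (ω h : P ⊗[k] P) = 1 ⊗ₜ[k] (ω h : P ⊗[k] P)

/-- An `Ad`-covariant splitting `i : ker ε_H → ker ε_P` of `π`: `π ∘ i = id` and
`(id ⊗ π) ∘ Ad ∘ i = (i ⊗ id) ∘ Ad`. -/
structure IsSplitting (π : P →ₐc[k] H) (i : augKer k H →ₗ[k] augKer k P) : Prop where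
  proj_eq : ∀ h : augKer k H, π (i h : P) = h
  covariant : ∀ h : augKer k H,
    (π : P →ₐ[k] H).toLinearMap.lTensor P (adR k P (i h : P)) =
      ((augKer k P).subtype ∘ₗ i ∘ₗ augProj k H).rTensor H (adR k H h)

/-- The canonical connection `ω (h) = S i(h)₁ d i(h)₂` associated to `i`. -/
noncomputable def canonicalConn (i : augKer k H →ₗ[k] augKer k P) :
    augKer k H →ₗ[k] univForms k P :=
  univForms.mulD k P ∘ₗ (HopfAlgebra.antipode k).rTensor P ∘ₗ comul (R := k) ∘ₗ
    (augKer k P).subtype ∘ₗ i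

end Homogeneous

/-! ### The biproduct as a trivial bundle over `B` -/

namespace Biproduct

section

variable {k H B : Type*} [Field k] [Ring H] [HopfAlgebra k H] [Ring B] [Algebra k B]
  [Coalgebra k B] [CrossedModule k H B] [BraidedGroup k H B]

theorem homogCoact_apply (x : Biproduct k H B) : homogCoact (proj k H B) x =
    Algebra.TensorProduct.map (AlgHom.id k _) (projHom k H B) (comul (R := k) x) := rfl

theorem homogCoact_incl (b : B) :
    homogCoact (proj k H B) (incl k H B b) = incl k H B b ⊗ₜ 1 := by
  have e : ∀ b : B, Algebra.TensorProduct.map (AlgHom.id k _) (projHom k H B) (coactP k H B b) =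
      counit (R := k) b • 1 := by
    intro b
    have e : ∀ t : H ⊗[k] B, Algebra.TensorProduct.map (AlgHom.id k _) (projHom k H B)
        (TensorProduct.map (inclH k H B).toLinearMap (incl k H B).toLinearMap t) =
        inclH k H B (TensorProduct.rid k H ((counit (R := k) (A := B)).lTensor H t)) ⊗ₜ 1 := by
      intro t
      induction t using TensorProduct.induction_on with
      | zero => simp
      | add x y hx hy => simp only [map_add, TensorProduct.add_tmul, hx, hy]
      | tmul x y => simp [projHom_incl, TensorProduct.smul_tmul]
    rw [coactP_apply, e, BraidedGroup.coact_counit, map_smul, map_one, TensorProduct.smul_tmul,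
      TensorProduct.tmul_smul, Algebra.TensorProduct.one_def]
  have e' : ∀ t : B ⊗[k] B, Algebra.TensorProduct.map (AlgHom.id k _) (projHom k H B)
      (comulAux k H B t) =
      incl k H B (TensorProduct.rid k B ((counit (R := k)).lTensor B t)) ⊗ₜ 1 := by
    intro t
    induction t using TensorProduct.induction_on with
    | zero => simp
    | add x y hx hy => simp only [map_add, TensorProduct.add_tmul, hx, hy]
    | tmul x y => rw [comulAux_tmul, map_mul, e]; simp [TensorProduct.smul_tmul']
  rw [homogCoact_apply, comul_incl, comulB, LinearMap.comp_apply, e']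
  simp

theorem homogCoact_inclH (h : H) : homogCoact (proj k H B) (inclH k H B h) =
    (inclH k H B).toLinearMap.rTensor H (comul (R := k) h) := by
  rw [homogCoact_apply, comul_inclH, comulH_apply]
  induction comul (R := k) h using TensorProduct.induction_on with
  | zero => simp
  | add x y hx hy => simp only [map_add, hx, hy]
  | tmul x y => simp [projHom_inclH]

/-- The base of the bundle is `B`. -/
theorem base_eq : base (homogCoact (proj k H B)) = (incl k H B).range := by
  let f : Biproduct k H B →ₗ[k] B :=
    (TensorProduct.rid k B).toLinearMap ∘ₗ (counit (R := k) (A := H)).lTensor B ∘ₗ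
      (of k H B).symm.toLinearMap
  let F : Biproduct k H B ⊗[k] H →ₗ[k] Biproduct k H B :=
    LinearMap.mul' k _ ∘ₗ TensorProduct.map ((incl k H B).toLinearMap ∘ₗ f)
      (inclH k H B).toLinearMap
  have hF : ∀ x, F (homogCoact (proj k H B) x) = x := by
    intro x
    induction x using induction_on with
    | hz => simp
    | ha x y hx hy => simp only [map_add, hx, hy]
    | ht b h =>
      have : ∀ t : H ⊗[k] H, F ((incl k H B b ⊗ₜ 1) * (inclH k H B).toLinearMap.rTensor H t) =
          incl k H B b * inclH k H B (TensorProduct.lid k H ((counit (R := k)).rTensor H t)) := by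
        intro t
        induction t using TensorProduct.induction_on with
        | zero => simp
        | add x y hx hy => simp only [map_add, mul_add, hx, hy]
        | tmul x y => simp [F, f, ← of_tmul]
      rw [of_tmul, map_mul, homogCoact_incl, homogCoact_inclH, this]
      simp
  ext x
  constructor
  · intro hx
    have hx' : homogCoact (proj k H B) x = x ⊗ₜ 1 := hx
    refine ⟨f x, ?_⟩
    have := hF x
    rw [hx'] at this
    simpa [F] using this
  · rintro ⟨b, rfl⟩
    exact homogCoact_incl b

open WithConv in
/-- `j` is a trivialisation of the bundle: it is unital, equivariant, and
convolution-invertible with inverse `j ∘ S`. -/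
theorem inclH_trivialisation :
    inclH k H B 1 = 1 ∧
    (∀ h : H, homogCoact (proj k H B) (inclH k H B h) =
      (inclH k H B).toLinearMap.rTensor H (comul (R := k) h)) ∧
    toConv (inclH k H B).toLinearMap *
      toConv ((inclH k H B).toLinearMap ∘ₗ HopfAlgebra.antipode k) = 1 ∧
    toConv ((inclH k H B).toLinearMap ∘ₗ HopfAlgebra.antipode k) *
      toConv (inclH k H B).toLinearMap = 1 := by
  refine ⟨map_one _, homogCoact_inclH, ?_, ?_⟩
  · ext h
    have : ∀ t : H ⊗[k] H, LinearMap.mul' k _ (TensorProduct.map (inclH k H B).toLinearMap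
        ((inclH k H B).toLinearMap ∘ₗ HopfAlgebra.antipode k) t) =
        inclH k H B (LinearMap.mul' k H ((HopfAlgebra.antipode k).lTensor H t)) := by
      intro t
      induction t using TensorProduct.induction_on with
      | zero => simp
      | add x y hx hy => simp only [map_add, hx, hy]
      | tmul x y => simp
    simp [this]
  · ext h
    have : ∀ t : H ⊗[k] H, LinearMap.mul' k _ (TensorProduct.map
        ((inclH k H B).toLinearMap ∘ₗ HopfAlgebra.antipode k) (inclH k H B).toLinearMap t) =
        inclH k H B (LinearMap.mul' k H ((HopfAlgebra.antipode k).rTensor H t)) := by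
      intro t
      induction t using TensorProduct.induction_on with
      | zero => simp
      | add x y hx hy => simp only [map_add, hx, hy]
      | tmul x y => simp
    simp [this]

end

end Biproduct

/-! ### Data on the braided group -/

section Braided

variable {k H B : Type*} [Field k] [Ring H] [HopfAlgebra k H] [Ring B] [Algebra k B]
  [Coalgebra k B] [CrossedModule k H B]

variable (k H B) in
/-- The braided left coaction
`b ⊗ c ↦ b₁ Ψ(b₂ ⊗ c₁) ⊗ c₂ = b₁ (b₂⁽¹⁾ ▷ c₁) ⊗ (b₂⁽²⁾ ⊗ c₂)` of `B` on `B ⊗ B`. -/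
noncomputable def braidedLeftCoact : B ⊗[k] B →ₗ[k] B ⊗[k] (B ⊗[k] B) :=
  (LinearMap.mul' k B).rTensor (B ⊗[k] B) ∘ₗ midTwist (braiding k H B B) ∘ₗ
    TensorProduct.map (comul (R := k)) (comul (R := k))

/-- `β` takes values in the forms that are invariant under the braided coaction of `B`. -/
def IsBraidedInvariant (β : augKer k H →ₗ[k] univForms k B) : Prop :=
  ∀ h : augKer k H, braidedLeftCoact k H B (β h : B ⊗[k] B) = 1 ⊗ₜ[k] (β h : B ⊗[k] B)

/-- A map `f` from `ker ε` to a space `V` with left coaction `ρ` of `H` intertwines it with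
the left adjoint coaction: `ρ (f h) = h₁ S h₃ ⊗ f(h₂)`. (As the left adjoint coaction
preserves `ker ε`, the extension `f ∘ π_ε` of `f` to `H` may be used on the right-hand side.) -/
def IntertwinesAd {V : Type*} [AddCommGroup V] [Module k V] (ρ : V →ₗ[k] H ⊗[k] V)
    (f : augKer k H →ₗ[k] V) : Prop :=
  ∀ h : augKer k H, ρ (f h) = (f ∘ₗ augProj k H).lTensor H (adL k H h)

variable (k H B) in
/-- The left coaction `b ⊗ c ↦ b⁽¹⁾ c⁽¹⁾ ⊗ (b⁽²⁾ ⊗ c⁽²⁾)` of `H` on `B ⊗ B`. -/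
noncomputable def coactTensor : B ⊗[k] B →ₗ[k] H ⊗[k] (B ⊗[k] B) :=
  leftTensorCoact (coact (k := k) (H := H) (V := B)) (coact (k := k) (H := H) (V := B))

variable (k H B) in
/-- The maps `β : ker ε_H → Ω¹B` that are left `B`-invariant under the braided coproduct and
intertwine the left `H`-coaction on `Ω¹B` with the left adjoint coaction. -/
def invariantForms : Set (augKer k H →ₗ[k] univForms k B) :=
  {β | IsBraidedInvariant β ∧ IntertwinesAd (coactTensor k H B) ((univForms k B).subtype ∘ₗ β)}

variable (k H B) in
/-- The maps `γ : ker ε_H → ker ε_B` that intertwine the left `H`-coaction with the left adjoint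
coaction. -/
def adIntertwiners : Set (augKer k H →ₗ[k] augKer k B) :=
  {γ | IntertwinesAd (coact (k := k) (H := H) (V := B)) ((augKer k B).subtype ∘ₗ γ)}

variable [BraidedGroup k H B]

variable (k H B) in
/-- The strong left-invariant connections on the biproduct, as a homogeneous bundle by `π`. -/
def strongLeftInvariantConnections : Set (augKer k H →ₗ[k] univForms k (Biproduct k H B)) :=
  {ω | IsConnection (homogCoact (Biproduct.proj k H B)) ω ∧
    IsStrong (homogCoact (Biproduct.proj k H B)) ω ∧ IsLeftInvariant ω}

/-- The connection `ω (h) = j(S h₁) β(π_ε h₂) j(h₃) + j(S h₁) d j(h₂)` on the biproduct as a trivial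
bundle, with trivialisation `j (h) = 1 ⊗ h` and its convolution inverse `j ∘ S`. -/
noncomputable def biproductConn (β : augKer k H →ₗ[k] univForms k B) :
    augKer k H →ₗ[k] univForms k (Biproduct k H B) :=
  connOfForm (Biproduct.incl k H B) (Biproduct.inclH k H B).toLinearMap
    ((Biproduct.inclH k H B).toLinearMap ∘ₗ HopfAlgebra.antipode k) β

/-- `β (h) = S̲ γ(h)₁ d γ(h)₂`. -/
noncomputable def formOfMap (γ : augKer k H →ₗ[k] augKer k B) :
    augKer k H →ₗ[k] univForms k B :=
  univForms.mulD k B ∘ₗ (BraidedGroup.bantipode (k := k) H).rTensor B ∘ₗ comul (R := k) ∘ₗ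
    (augKer k B).subtype ∘ₗ γ

/-- `i (h) = γ(π_ε h₁) ⊗ h₂ + 1 ⊗ h`. -/
noncomputable def splittingOfMap (γ : augKer k H →ₗ[k] augKer k B) :
    augKer k H →ₗ[k] augKer k (Biproduct k H B) :=
  ((Biproduct.of k H B).toLinearMap ∘ₗ
    (((augKer k B).subtype ∘ₗ γ ∘ₗ augProj k H).rTensor H ∘ₗ comul (R := k) +
      TensorProduct.mk k B H 1) ∘ₗ (augKer k H).subtype).codRestrict _ (fun h => by
    have e : ∀ x : B ⊗[k] H, counit (R := k) (Biproduct.of k H B x) =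
        LinearMap.mul' k k (TensorProduct.map (counit (R := k)) (counit (R := k)) x) :=
      fun x => rfl
    have e0 : counit (R := k) ∘ₗ (augKer k B).subtype ∘ₗ γ ∘ₗ augProj k H = 0 :=
      LinearMap.ext fun x => (γ (augProj k H x)).2
    rw [augKer, LinearMap.mem_ker, LinearMap.comp_apply, LinearEquiv.coe_coe, e,
      LinearMap.comp_apply, LinearMap.add_apply, map_add, map_add, LinearMap.comp_apply,
      LinearMap.rTensor, ← LinearMap.comp_apply (TensorProduct.map _ _) (TensorProduct.map _ _),
      ← TensorProduct.map_comp, e0]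
    have : counit (R := k) (h : H) = 0 := h.2
    simp [this])

end Braided

/-!
Convolution with a Hopf algebra homomorphism is invertible, so every identity between linear maps
out of `H` can be solved for its factors, and the canonical map `u ⊗ v ↦ u v₁ ⊗ v₂` of a Hopf
algebra, or of a braided group, is a bijection which takes the left-invariant forms to `1 ⊗ ker ε`.
Its inverse takes `1 ⊗ c` to `S c₁ ⊗ c₂`. Left-invariant forms on `P` or on `B` are therefore
determined by elements of `ker ε`, which yields the second bijection, and identifies the
left-invariant connections on a homogeneous bundle `P → H` with the `Ad`-covariant splittings
`i : ker ε_H → ker ε_P`.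

The canonical map also recognises the forms in `(Ω¹M)P`, as those which it sends into the cotensor
product of `P` and `P` over `H`. Applied to `(id - Π)(d u)` this shows that the connection of `i` is
strong exactly if the extension of `i` by `1 ↦ 1` is left `H`-colinear, and then `Ad`-covariance
amounts to right colinearity. On the biproduct the right colinear maps are `h ↦ γ(h₁) ⊗ h₂`, and
such a map is left colinear exactly if `γ` intertwines the coaction of `B` with the left adjoint
coaction.
-/

/-! ### Convolution -/

section Convolution

open WithConv LinearMap Algebra.TensorProduct

variable {R C A A' : Type*} [CommSemiring R] [AddCommMonoid C] [Module R C] [Semiring A]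
  [Algebra R A] [Semiring A'] [Algebra R A']

/-- The inclusion `x ↦ x ⊗ 1` of the first tensor factor as a linear map; it turns the products
of elements in different factors into convolution products. -/
noncomputable abbrev inLeft (R A A' : Type*) [CommSemiring R] [Semiring A] [Algebra R A]
    [Semiring A'] [Algebra R A'] : A →ₗ[R] A ⊗[R] A' :=
  (includeLeft : A →ₐ[R] A ⊗[R] A').toLinearMap

/-- The inclusion `y ↦ 1 ⊗ y` of the second tensor factor as a linear map. -/
noncomputable abbrev inRight (R A A' : Type*) [CommSemiring R] [Semiring A] [Algebra R A]
    [Semiring A'] [Algebra R A'] : A' →ₗ[R] A ⊗[R] A' :=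
  (includeRight : A' →ₐ[R] A ⊗[R] A').toLinearMap

section

variable [CoalgebraStruct R C]

theorem toConv_comp_comul {T : C ⊗[R] C →ₗ[R] A} {f g : WithConv (C →ₗ[R] A)}
    (h : ∀ x y, T (x ⊗ₜ y) = f x * g y) : toConv (T ∘ₗ comul) = f * g := by
  rw [LinearMap.convMul_def, ← comp_assoc,
    show T = mul' R A ∘ₗ TensorProduct.map f.ofConv g.ofConv from TensorProduct.ext' h]

theorem toConv_comp_convMul {T : A →ₗ[R] A'} {f g : WithConv (C →ₗ[R] A)}
    {f' g' : WithConv (C →ₗ[R] A')} (h : ∀ x y, T (f x * g y) = f' x * g' y) :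
    toConv (T ∘ₗ (f * g).ofConv) = f' * g' :=
  toConv_comp_comul (T := T ∘ₗ mul' R A ∘ₗ TensorProduct.map f.ofConv g.ofConv) h

theorem toConv_algHom_comp_convMul (φ : A →ₐ[R] A') (f g : WithConv (C →ₗ[R] A)) :
    toConv (φ.toLinearMap ∘ₗ (f * g).ofConv) =
      toConv (φ.toLinearMap ∘ₗ f.ofConv) * toConv (φ.toLinearMap ∘ₗ g.ofConv) :=
  congrArg toConv (algHom_comp_convMul_distrib φ f g)

theorem toConv_map_comul (f : C →ₗ[R] A) (g : C →ₗ[R] A') :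
    toConv (TensorProduct.map f g ∘ₗ comul) =
      toConv (inLeft R A A' ∘ₗ f) * toConv (inRight R A A' ∘ₗ g) :=
  toConv_comp_comul fun x y => by simp

end

theorem toConv_algHom_comp_mul_eq_one [Coalgebra R C] (φ : A →ₐ[R] A') {f g : C →ₗ[R] A}
    (h : toConv f * toConv g = 1) :
    toConv (φ.toLinearMap ∘ₗ f) * toConv (φ.toLinearMap ∘ₗ g) = 1 := by
  refine (toConv_algHom_comp_convMul φ (toConv f) (toConv g)).symm.trans ?_
  rw [h]
  ext c
  exact φ.commutes _

theorem convMul_apply_one {D : Type*} [Semiring D] [Bialgebra R D]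
    (f g : WithConv (D →ₗ[R] A)) : (f * g) 1 = f 1 * g 1 := by
  simp [convMul_apply, Algebra.TensorProduct.one_def]

end Convolution

section Antipode

open WithConv LinearMap HopfAlgebra

variable {R H A : Type*} [CommSemiring R] [Semiring H] [HopfAlgebra R H] [Semiring A] [Algebra R A]

theorem toConv_comp_antipode_mul (φ : H →ₐ[R] A) :
    toConv (φ.toLinearMap ∘ₗ antipode R) * toConv φ.toLinearMap = 1 := by
  simpa only [comp_id] using toConv_algHom_comp_mul_eq_one φ (antipode_mul_id (R := R) (C := H))

theorem toConv_mul_comp_antipode (φ : H →ₐ[R] A) :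
    toConv φ.toLinearMap * toConv (φ.toLinearMap ∘ₗ antipode R) = 1 := by
  simpa only [comp_id] using toConv_algHom_comp_mul_eq_one φ (id_mul_antipode (R := R) (C := H))

theorem toConv_comp_antipode_of_eq_mul {φ ψ χ : H →ₐ[R] A}
    (h : toConv φ.toLinearMap = toConv ψ.toLinearMap * toConv χ.toLinearMap) :
    toConv (φ.toLinearMap ∘ₗ antipode R) =
      toConv (χ.toLinearMap ∘ₗ antipode R) * toConv (ψ.toLinearMap ∘ₗ antipode R) := by
  refine left_inv_eq_right_inv (toConv_comp_antipode_mul φ) ?_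
  rw [h, mul_assoc, ← mul_assoc (toConv χ.toLinearMap), toConv_mul_comp_antipode, one_mul,
    toConv_mul_comp_antipode]

theorem bialgHom_comp_antipode {P : Type*} [Semiring P] [HopfAlgebra R P] (π : P →ₐc[R] H) :
    (π : P →ₐ[R] H).toLinearMap ∘ₗ antipode R = antipode R ∘ₗ (π : P →ₐ[R] H).toLinearMap := by
  have h : toConv (π : P →ₐ[R] H).toLinearMap *
      toConv (antipode R ∘ₗ (π : P →ₐ[R] H).toLinearMap) = 1 := by
    refine (congrArg toConv (convMul_comp_coalgHom_distrib (toConv LinearMap.id)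
      (toConv (antipode R (A := H))) (π : P →ₗc[R] H))).symm.trans ?_
    rw [id_mul_antipode]
    ext p
    exact congrArg (algebraMap R H) (CoalgHomClass.counit_comp_apply π p)
  exact toConv_injective
    (left_inv_eq_right_inv (toConv_comp_antipode_mul (π : P →ₐ[R] H)) h)

end Antipode

/-! ### The canonical map of a coalgebra with product -/

section LeftExtension

open WithConv LinearMap

variable {R A D V C : Type*} [CommSemiring R] [Semiring A] [Algebra R A] [Semiring D] [Algebra R D]
  [AddCommMonoid V] [Module R V] [AddCommMonoid C] [Module R C]

/-- The left `A`-linear extension `u ⊗ v ↦ (u ⊗ 1) f(v)` of a linear map `f : V → A ⊗ D`. -/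
noncomputable def leftExt (f : V →ₗ[R] A ⊗[R] D) : A ⊗[R] V →ₗ[R] A ⊗[R] D :=
  mul' R (A ⊗[R] D) ∘ₗ TensorProduct.map (inLeft R A D) f

theorem leftExt_tmul (f : V →ₗ[R] A ⊗[R] D) (u : A) (v : V) :
    leftExt f (u ⊗ₜ v) = (u ⊗ₜ 1) * f v := rfl

theorem leftExt_one_tmul (f : V →ₗ[R] A ⊗[R] D) (v : V) : leftExt f (1 ⊗ₜ v) = f v := by
  rw [leftExt_tmul, ← Algebra.TensorProduct.one_def, one_mul]

theorem leftExt_inRight : leftExt (inRight R A D) = LinearMap.id :=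
  TensorProduct.ext' fun u v => by simp [leftExt_tmul]

variable {D' : Type*} [Semiring D'] [Algebra R D']

theorem leftExt_mul (f : D →ₗ[R] A ⊗[R] D') (u : A) (t : A ⊗[R] D) :
    leftExt f ((u ⊗ₜ 1) * t) = (u ⊗ₜ 1) * leftExt f t := by
  induction t using TensorProduct.induction_on with
  | zero => simp
  | add x y hx hy => simp only [map_add, mul_add, hx, hy]
  | tmul x y => simp [leftExt_tmul, ← mul_assoc]

theorem leftExt_comp_leftExt (g : D →ₗ[R] A ⊗[R] D') (f : V →ₗ[R] A ⊗[R] D) :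
    leftExt g ∘ₗ leftExt f = leftExt (leftExt g ∘ₗ f) :=
  TensorProduct.ext' fun u v => leftExt_mul g u (f v)

theorem toConv_leftExt_comp_convMul [CoalgebraStruct R C] (f : D →ₗ[R] A ⊗[R] D')
    (a : C →ₗ[R] A) (b : C →ₗ[R] D) :
    toConv (leftExt f ∘ₗ (toConv (inLeft R A D ∘ₗ a) * toConv (inRight R A D ∘ₗ b)).ofConv) =
      toConv (inLeft R A D' ∘ₗ a) * toConv (f ∘ₗ b) :=
  toConv_comp_convMul fun x y => (leftExt_mul f (a x) (1 ⊗ₜ b y)).trans <|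
    congrArg (_ * ·) (leftExt_one_tmul f (b y))

end LeftExtension

section Galois

open WithConv LinearMap

variable (R C : Type*) [CommSemiring R] [Semiring C] [Algebra R C] [Coalgebra R C]

/-- The Hopf–Galois map `u ⊗ v ↦ u v₁ ⊗ v₂`. It is defined for any algebra that is a coalgebra, so
as to apply to Hopf algebras and to braided groups alike. -/
noncomputable def galois : C ⊗[R] C →ₗ[R] C ⊗[R] C := leftExt comul

variable {C} in
/-- The map `u ⊗ v ↦ ε(u) v`, which recovers `c` from `S c₁ ⊗ c₂`. -/
noncomputable def counitLeft {V : Type*} [AddCommMonoid V] [Module R V] : C ⊗[R] V →ₗ[R] V :=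
  (TensorProduct.lid R V).toLinearMap ∘ₗ (counit (R := R)).rTensor V

variable {R C}

/-- The form `c ↦ S c₁ ⊗ c₂`; it agrees with the Maurer–Cartan form `c ↦ S c₁ d c₂` on the kernel
of the counit. -/
noncomputable def maurerCartan (S : C →ₗ[R] C) : C →ₗ[R] C ⊗[R] C := S.rTensor C ∘ₗ comul

theorem counitLeft_tmul {V : Type*} [AddCommMonoid V] [Module R V] (u : C) (v : V) :
    counitLeft R (u ⊗ₜ v) = counit (R := R) u • v := by
  simp [counitLeft]

theorem counitLeft_comul (c : C) : counitLeft R (comul (R := R) c) = c := by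
  simp [counitLeft]

theorem counitLeft_lTensor {V W : Type*} [AddCommMonoid V] [Module R V] [AddCommMonoid W]
    [Module R W] (f : V →ₗ[R] W) (t : C ⊗[R] V) :
    counitLeft R (f.lTensor C t) = f (counitLeft R t) := by
  suffices counitLeft R ∘ₗ f.lTensor C = f ∘ₗ counitLeft R from LinearMap.congr_fun this t
  exact TensorProduct.ext' fun u v => by simp [counitLeft_tmul]

theorem toConv_comul :
    toConv (comul (R := R) (A := C)) = toConv (inLeft R C C) * toConv (inRight R C C) := by
  simpa using toConv_map_comul (R := R) (LinearMap.id : C →ₗ[R] C) LinearMap.id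

theorem toConv_maurerCartan (S : C →ₗ[R] C) :
    toConv (maurerCartan S) = toConv (inLeft R C C ∘ₗ S) * toConv (inRight R C C) :=
  toConv_map_comul S LinearMap.id

theorem galois_comp_maurerCartan {S : C →ₗ[R] C} (hS : toConv S * toConv LinearMap.id = 1) :
    galois R C ∘ₗ maurerCartan S = inRight R C C := by
  apply toConv_injective
  have h := toConv_leftExt_comp_convMul (comul (R := R) (A := C)) S LinearMap.id
  rw [comp_id, ← toConv_maurerCartan, comp_id, toConv_comul, ← mul_assoc] at h
  exact h.trans <| (congrArg (· * _) (toConv_algHom_comp_mul_eq_one _ hS)).trans (one_mul _)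

theorem galois_maurerCartan {S : C →ₗ[R] C} (hS : toConv S * toConv LinearMap.id = 1) (c : C) :
    galois R C (maurerCartan S c) = 1 ⊗ₜ c :=
  LinearMap.congr_fun (galois_comp_maurerCartan hS) c

theorem leftExt_maurerCartan_comp_galois {S : C →ₗ[R] C}
    (hS : toConv LinearMap.id * toConv S = 1) :
    leftExt (maurerCartan S) ∘ₗ galois R C = LinearMap.id := by
  have h : leftExt (maurerCartan S) ∘ₗ comul = inRight R C C := by
    apply toConv_injective
    have h := toConv_leftExt_comp_convMul (maurerCartan S) LinearMap.id LinearMap.id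
    rw [comp_id, comp_id, ← toConv_comul, comp_id, toConv_maurerCartan, ← mul_assoc] at h
    exact h.trans <| (congrArg (· * _) (toConv_algHom_comp_mul_eq_one _ hS)).trans (one_mul _)
  rw [galois, leftExt_comp_leftExt, h, leftExt_inRight]

theorem eq_maurerCartan_iff {S : C →ₗ[R] C} (hS : toConv S * toConv LinearMap.id = 1)
    (hS' : toConv LinearMap.id * toConv S = 1) {t : C ⊗[R] C} {c : C} :
    t = maurerCartan S c ↔ galois R C t = 1 ⊗ₜ c := by
  refine ⟨fun h => h ▸ galois_maurerCartan hS c, fun h => ?_⟩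
  rw [← leftExt_one_tmul (maurerCartan S), ← h]
  exact (LinearMap.congr_fun (leftExt_maurerCartan_comp_galois hS') t).symm

theorem counitLeft_mul
    (hε : ∀ b c : C, counit (R := R) (b * c) = counit (R := R) b * counit (R := R) c)
    {D : Type*} [Semiring D] [Algebra R D] (u : C) (t : C ⊗[R] D) :
    counitLeft R ((u ⊗ₜ 1) * t) = counit (R := R) u • counitLeft R t := by
  induction t using TensorProduct.induction_on with
  | zero => simp
  | add x y hx hy => simp only [map_add, mul_add, smul_add, hx, hy]
  | tmul x y => simp [counitLeft_tmul, hε, mul_smul]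

theorem counitLeft_galois
    (hε : ∀ b c : C, counit (R := R) (b * c) = counit (R := R) b * counit (R := R) c)
    (t : C ⊗[R] C) : counitLeft R (galois R C t) = counitLeft R t := by
  suffices counitLeft R ∘ₗ galois R C = counitLeft R from LinearMap.congr_fun this t
  refine TensorProduct.ext' fun u v => ?_
  rw [LinearMap.comp_apply, galois, leftExt_tmul, counitLeft_mul hε, counitLeft_comul,
    counitLeft_tmul]

theorem counit_counitLeft
    (hε : ∀ b c : C, counit (R := R) (b * c) = counit (R := R) b * counit (R := R) c)
    (t : C ⊗[R] C) : counit (R := R) (counitLeft R t) = counit (R := R) (mul' R C t) := by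
  suffices counit ∘ₗ counitLeft R = counit ∘ₗ mul' R C from LinearMap.congr_fun this t
  exact TensorProduct.ext' fun u v => by simp [counitLeft_tmul, hε]

theorem counitLeft_maurerCartan {S : C →ₗ[R] C} (hS : toConv S * toConv LinearMap.id = 1)
    (hε : ∀ b c : C, counit (R := R) (b * c) = counit (R := R) b * counit (R := R) c)
    (hε₁ : counit (R := R) (1 : C) = 1) (c : C) : counitLeft R (maurerCartan S c) = c := by
  rw [← counitLeft_galois hε, galois_maurerCartan hS, counitLeft_tmul, hε₁, one_smul]

theorem comul_rTensor_eq_one_tmul_iff (h₁ : comul (R := R) (1 : C) = 1 ⊗ₜ 1) {V : Type*}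
    [AddCommMonoid V] [Module R V] (t : C ⊗[R] V) :
    TensorProduct.assoc R C C V ((comul (R := R)).rTensor V t) = 1 ⊗ₜ t ↔
      t = 1 ⊗ₜ counitLeft R t := by
  constructor
  · intro h
    have hε : (counitLeft R).lTensor C ∘ₗ (TensorProduct.assoc R C C V).toLinearMap ∘ₗ
        (comul (R := R)).rTensor V = LinearMap.id := by
      refine TensorProduct.ext' fun c v => ?_
      have (s : C ⊗[R] C) : (counitLeft R).lTensor C (TensorProduct.assoc R C C V (s ⊗ₜ v)) =
          TensorProduct.rid R C ((counit (R := R)).lTensor C s) ⊗ₜ v := by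
        induction s using TensorProduct.induction_on with
        | zero => simp
        | add x y hx hy => simp only [map_add, TensorProduct.add_tmul, hx, hy]
        | tmul x y => simp [counitLeft_tmul, TensorProduct.smul_tmul]
      simp [this]
    have := congrArg ((counitLeft R).lTensor C) h
    exact (LinearMap.congr_fun hε t).symm.trans this
  · intro h
    rw [h]
    simp [h₁]

/-- The hypothesis `hL` says that `galois` transports `L` to the coproduct on the left factor, whose
invariants are the elements `1 ⊗ c`. -/
theorem coact_eq_one_tmul_iff {L : C ⊗[R] C →ₗ[R] C ⊗[R] (C ⊗[R] C)}
    (hL : ∀ t, (galois R C).lTensor C (L t) =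
      TensorProduct.assoc R C C C ((comul (R := R)).rTensor C (galois R C t)))
    (h₁ : comul (R := R) (1 : C) = 1 ⊗ₜ 1)
    (hε : ∀ b c : C, counit (R := R) (b * c) = counit (R := R) b * counit (R := R) c)
    {S : C →ₗ[R] C} (hS : toConv S * toConv LinearMap.id = 1)
    (hS' : toConv LinearMap.id * toConv S = 1) (t : C ⊗[R] C) :
    L t = 1 ⊗ₜ t ↔ t = maurerCartan S (counitLeft R t) := by
  have hinj : Function.Injective ((galois R C).lTensor C) :=
    Function.LeftInverse.injective (g := (leftExt (maurerCartan S)).lTensor C) fun s => by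
      rw [← lTensor_comp_apply, leftExt_maurerCartan_comp_galois hS', lTensor_id, id_apply]
  rw [← hinj.eq_iff, hL, lTensor_tmul, comul_rTensor_eq_one_tmul_iff h₁, counitLeft_galois hε,
    eq_maurerCartan_iff hS hS']

end Galois

section BraidedProduct

open LinearMap

variable {k C : Type*} [Field k] [Ring C] [Algebra k C]

theorem midTwist_tmul {X Y X' Y' Z W : Type*} [AddCommGroup X] [Module k X] [AddCommGroup Y]
    [Module k Y] [AddCommGroup X'] [Module k X'] [AddCommGroup Y'] [Module k Y']
    [AddCommGroup Z] [Module k Z] [AddCommGroup W] [Module k W]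
    (τ : Y ⊗[k] X' →ₗ[k] Z ⊗[k] W) (x : X) (y : Y) (x' : X') (y' : Y') :
    midTwist τ ((x ⊗ₜ y) ⊗ₜ (x' ⊗ₜ y')) = (TensorProduct.assoc k X Z (W ⊗[k] Y')).symm
      (x ⊗ₜ TensorProduct.assoc k Z W Y' (τ (y ⊗ₜ x') ⊗ₜ y')) := by
  simp [midTwist]

/-- The product `(a ⊗ b)(c ⊗ d) = a τ(b ⊗ c) d` on `C ⊗ C` defined by a braiding `τ`. -/
noncomputable def braidedMul (τ : C ⊗[k] C →ₗ[k] C ⊗[k] C) :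
    (C ⊗[k] C) ⊗[k] (C ⊗[k] C) →ₗ[k] C ⊗[k] C :=
  TensorProduct.map (mul' k C) (mul' k C) ∘ₗ midTwist τ

theorem braidedMul_tmul (τ : C ⊗[k] C →ₗ[k] C ⊗[k] C) (a b c d : C) :
    braidedMul τ ((a ⊗ₜ b) ⊗ₜ (c ⊗ₜ d)) = (a ⊗ₜ 1) * τ (b ⊗ₜ c) * (1 ⊗ₜ d) := by
  rw [braidedMul, LinearMap.comp_apply, midTwist_tmul]
  induction τ (b ⊗ₜ c) using TensorProduct.induction_on with
  | zero => simp
  | add x y hx hy => simp only [TensorProduct.add_tmul, TensorProduct.tmul_add, map_add, mul_add,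
      add_mul, hx, hy]
  | tmul x y => simp

theorem assoc_rTensor_braidedMul (τ : C ⊗[k] C →ₗ[k] C ⊗[k] C) (a b c : C) (r : C ⊗[k] C) :
    TensorProduct.assoc k C C C ((braidedMul τ ∘ₗ TensorProduct.mk k _ _ (a ⊗ₜ b)).rTensor C
      ((TensorProduct.assoc k C C C).symm (c ⊗ₜ r))) =
    Algebra.TensorProduct.map (AlgHom.id k C) Algebra.TensorProduct.includeLeft
      ((a ⊗ₜ 1) * τ (b ⊗ₜ c)) * (1 ⊗ₜ r) := by
  induction r using TensorProduct.induction_on with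
  | zero => simp
  | add x y hx hy => simp only [TensorProduct.tmul_add, map_add, mul_add, hx, hy]
  | tmul e f =>
    rw [TensorProduct.assoc_symm_tmul, rTensor_tmul, LinearMap.comp_apply, TensorProduct.mk_apply,
      braidedMul_tmul]
    induction (a ⊗ₜ 1) * τ (b ⊗ₜ c) using TensorProduct.induction_on with
    | zero => simp
    | add x y hx hy => simp only [TensorProduct.add_tmul, map_add, add_mul, hx, hy]
    | tmul x y => simp

variable [Coalgebra k C]

theorem galois_midTwist (τ : C ⊗[k] C →ₗ[k] C ⊗[k] C) (s r : C ⊗[k] C) :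
    (galois k C).lTensor C ((mul' k C).rTensor (C ⊗[k] C) (midTwist τ (s ⊗ₜ r))) =
      TensorProduct.assoc k C C C ((braidedMul τ ∘ₗ TensorProduct.mk k _ _ s).rTensor C
        ((TensorProduct.assoc k C C C).symm ((comul (R := k)).lTensor C r))) := by
  induction s using TensorProduct.induction_on with
  | zero => simp
  | add x y hx hy =>
    simp only [TensorProduct.add_tmul, map_add, comp_add, rTensor_add, LinearMap.add_apply, hx, hy]
  | tmul a b =>
  induction r using TensorProduct.induction_on with
  | zero => simp
  | add x y hx hy => simp only [TensorProduct.tmul_add, map_add, hx, hy]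
  | tmul c d =>
  rw [midTwist_tmul, lTensor_tmul, assoc_rTensor_braidedMul]
  induction τ (b ⊗ₜ c) using TensorProduct.induction_on with
  | zero => simp
  | add x y hx hy =>
    simp only [TensorProduct.add_tmul, TensorProduct.tmul_add, map_add, mul_add, add_mul, hx, hy]
  | tmul x y => simp [galois, leftExt_tmul]

theorem galois_coact {τ : C ⊗[k] C →ₗ[k] C ⊗[k] C}
    (hτ : ∀ b c : C, comul (R := k) (b * c) =
      braidedMul τ (comul (R := k) b ⊗ₜ comul (R := k) c)) (t : C ⊗[k] C) :
    (galois k C).lTensor C ((mul' k C).rTensor (C ⊗[k] C) (midTwist τ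
      (TensorProduct.map comul comul t))) =
    TensorProduct.assoc k C C C ((comul (R := k)).rTensor C (galois k C t)) := by
  induction t using TensorProduct.induction_on with
  | zero => simp
  | add x y hx hy => simp only [map_add, hx, hy]
  | tmul u v =>
  have h (r : C ⊗[k] C) : (comul (R := k)).rTensor C ((u ⊗ₜ 1) * r) =
      (braidedMul τ ∘ₗ TensorProduct.mk k _ _ (comul u)).rTensor C
        ((comul (R := k)).rTensor C r) := by
    induction r using TensorProduct.induction_on with
    | zero => simp
    | add x y hx hy => simp only [map_add, mul_add, hx, hy]
    | tmul c d => simp [hτ]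
  rw [galois, leftExt_tmul, h, TensorProduct.map_tmul, ← galois, galois_midTwist,
    Coalgebra.coassoc_symm_apply]

end BraidedProduct

/-! ### Maps on the kernel of the counit -/

section Augmentation

open WithConv LinearMap HopfAlgebra

variable {k H : Type*} [Field k] [Ring H]

section

variable [Bialgebra k H]

theorem augProj_coe (h : augKer k H) : augProj k H h = h := by
  have : counit (R := k) (h : H) = 0 := h.2
  ext
  simp [augProj, this]

theorem augProj_one : augProj k H 1 = 0 := by
  ext
  simp [augProj]

theorem augProj_add_counit (h : H) : (augProj k H h : H) + counit (R := k) h • 1 = h := by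
  simp [augProj]

theorem linearMap_ext_augKer {V : Type*} [AddCommGroup V] [Module k V] {f g : H →ₗ[k] V}
    (h₁ : f 1 = g 1) (h : ∀ x : augKer k H, f x = g x) : f = g := by
  ext x
  rw [← augProj_add_counit (k := k) x, map_add, map_add, h, map_smul, map_smul, h₁]

variable {A A' : Type*} [Ring A] [Algebra k A] [Ring A'] [Algebra k A']

/-- The extension of a map on `ker ε` to `H` by `1 ↦ 1`. Passing to it turns covariance conditions
on `f` into identities between convolution products. -/
noncomputable def augExt (f : augKer k H →ₗ[k] A) : H →ₗ[k] A :=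
  f ∘ₗ augProj k H + Algebra.linearMap k A ∘ₗ counit

theorem augExt_coe (f : augKer k H →ₗ[k] A) (h : augKer k H) : augExt f h = f h := by
  have : counit (R := k) (h : H) = 0 := h.2
  simp [augExt, augProj_coe, this]

theorem augExt_one (f : augKer k H →ₗ[k] A) : augExt f 1 = 1 := by
  simp [augExt, augProj_one]

theorem augExt_unique {f : augKer k H →ₗ[k] A} {g : H →ₗ[k] A} (h₁ : g 1 = 1)
    (h : ∀ x : augKer k H, g x = f x) : g = augExt f :=
  linearMap_ext_augKer (by rw [h₁, augExt_one]) fun x => by rw [h, augExt_coe]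

theorem comp_augExt {T : A →ₗ[k] A'} (hT : T 1 = 1) (f : augKer k H →ₗ[k] A) :
    T ∘ₗ augExt f = augExt (T ∘ₗ f) :=
  augExt_unique (by simp [augExt_one, hT]) fun x => by simp [augExt_coe]

theorem augExt_subtype_comp_injective [Coalgebra k A] : Function.Injective
    fun f : augKer k H →ₗ[k] augKer k A => augExt ((augKer k A).subtype ∘ₗ f) := fun f g h =>
  LinearMap.ext fun x => Subtype.ext <| by simpa [augExt_coe] using congr($h (x : H))

theorem toConv_comp_augProj {T : A →ₗ[k] A'} (hT : T 1 = 1) (f : augKer k H →ₗ[k] A) :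
    toConv (T ∘ₗ f ∘ₗ augProj k H) = toConv (T ∘ₗ augExt f) - 1 := by
  rw [comp_augExt hT]
  exact eq_sub_of_add_eq rfl

theorem forall_augKer_eq_conj_iff {a b : WithConv (H →ₗ[k] A')} (hab : a * b = 1)
    {ρ T : A →ₗ[k] A'} (hρ : ρ 1 = 1) (hT : T 1 = 1) (f : augKer k H →ₗ[k] A) :
    (∀ h : augKer k H, ρ (f h) = (a * toConv (T ∘ₗ f ∘ₗ augProj k H) * b) h) ↔
      toConv (ρ ∘ₗ augExt f) = a * toConv (T ∘ₗ augExt f) * b := by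
  have hconj (h : augKer k H) : (a * toConv (T ∘ₗ f ∘ₗ augProj k H) * b) h =
      (a * toConv (T ∘ₗ augExt f) * b) h := by
    have hε : counit (R := k) (h : H) = 0 := h.2
    rw [toConv_comp_augProj hT, mul_sub, sub_mul, mul_one, hab]
    change _ - algebraMap k A' (counit (R := k) (h : H)) = _
    rw [hε, map_zero, sub_zero]
    rfl
  have hone : (a * toConv (T ∘ₗ augExt f) * b) 1 = 1 := by
    have hT' : toConv (T ∘ₗ augExt f) 1 = 1 := (congrArg T (augExt_one f)).trans hT
    rw [convMul_apply_one, convMul_apply_one, hT', mul_one, ← convMul_apply_one, hab]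
    simp
  refine ⟨fun hf => congrArg toConv (linearMap_ext_augKer
    (g := (a * toConv (T ∘ₗ augExt f) * b).ofConv) ?_ fun h => ?_), fun hf h => ?_⟩
  · exact ((congrArg ρ (augExt_one f)).trans hρ).trans hone.symm
  · exact (congrArg ρ (augExt_coe f h)).trans ((hf h).trans (hconj h))
  · rw [hconj, ← hf, ← augExt_coe f]
    rfl

end

section AdjointCoaction

variable [HopfAlgebra k H] {A B : Type*} [Ring A] [Algebra k A] [Ring B] [Algebra k B]

theorem toConv_map_adL (g : H →ₐ[k] B) (f : H →ₗ[k] A) :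
    toConv (TensorProduct.map g.toLinearMap f ∘ₗ adL k H) =
      toConv (inLeft k B A ∘ₗ g.toLinearMap) * toConv (inRight k B A ∘ₗ f) *
        toConv (inLeft k B A ∘ₗ g.toLinearMap ∘ₗ antipode k) := by
  simp only [adL, ← comp_assoc, mul_assoc]
  refine toConv_comp_comul fun x y => ?_
  rw [LinearMap.convMul_apply]
  simp only [LinearMap.comp_apply, lTensor_tmul]
  induction comul (R := k) y using TensorProduct.induction_on with
  | zero => simp
  | add y z hy hz => simp only [map_add, TensorProduct.tmul_add, mul_add, hy, hz]
  | tmul y z => simp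

theorem toConv_map_adR (f : H →ₗ[k] A) (g : H →ₐ[k] B) :
    toConv (TensorProduct.map f g.toLinearMap ∘ₗ adR k H) =
      toConv (inRight k A B ∘ₗ g.toLinearMap ∘ₗ antipode k) * toConv (inLeft k A B ∘ₗ f) *
        toConv (inRight k A B ∘ₗ g.toLinearMap) := by
  simp only [adR, ← comp_assoc]
  refine toConv_comp_comul fun x y => ?_
  rw [LinearMap.convMul_apply]
  simp only [LinearMap.comp_apply, rTensor_tmul]
  induction comul (R := k) x using TensorProduct.induction_on with
  | zero => simp
  | add x z hx hz => simp only [map_add, TensorProduct.add_tmul, add_mul, hx, hz]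
  | tmul x z => simp

open Algebra.TensorProduct (includeLeft includeRight)

theorem intertwinesAd_iff {ρ : A →ₗ[k] H ⊗[k] A} (hρ : ρ 1 = 1) (f : augKer k H →ₗ[k] A) :
    IntertwinesAd ρ f ↔ toConv (ρ ∘ₗ augExt f) = toConv (inLeft k H A) *
      toConv (inRight k H A ∘ₗ augExt f) * toConv (inLeft k H A ∘ₗ antipode k) := by
  rw [← forall_augKer_eq_conj_iff
    (toConv_mul_comp_antipode (includeLeft : H →ₐ[k] H ⊗[k] A)) hρ
    (map_one (includeRight : A →ₐ[k] H ⊗[k] A))]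
  refine forall_congr' fun h => Eq.congr_right ?_
  exact congr($(toConv_map_adL (AlgHom.id k H) (f ∘ₗ augProj k H)) h)

theorem adR_covariant_iff {ρ : A →ₗ[k] A ⊗[k] H} (hρ : ρ 1 = 1) (f : augKer k H →ₗ[k] A) :
    (∀ h : augKer k H, ρ (f h) = (f ∘ₗ augProj k H).rTensor H (adR k H h)) ↔
      toConv (ρ ∘ₗ augExt f) = toConv (inRight k A H ∘ₗ antipode k) *
        toConv (inLeft k A H ∘ₗ augExt f) * toConv (inRight k A H) := by
  rw [← forall_augKer_eq_conj_iff
    (toConv_comp_antipode_mul (includeRight : H →ₐ[k] A ⊗[k] H)) hρ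
    (map_one (includeLeft : A →ₐ[k] A ⊗[k] H))]
  refine forall_congr' fun h => Eq.congr_right ?_
  exact congr($(toConv_map_adR (f ∘ₗ augProj k H) (AlgHom.id k H)) h)

theorem IntertwinesAd.comp {V W : Type*} [AddCommGroup V] [Module k V] [AddCommGroup W]
    [Module k W] {ρ : V →ₗ[k] H ⊗[k] V} {ρ' : W →ₗ[k] H ⊗[k] W} {f : augKer k H →ₗ[k] V}
    (hf : IntertwinesAd ρ f) (σ : V →ₗ[k] W) (hσ : ∀ v, ρ' (σ v) = σ.lTensor H (ρ v)) :
    IntertwinesAd ρ' (σ ∘ₗ f) := fun h => by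
  rw [LinearMap.comp_apply, hσ, hf h, ← lTensor_comp_apply]
  rfl

end AdjointCoaction

end Augmentation

/-! ### Invariant forms -/

namespace univForms

variable {k A : Type*} [Field k] [Ring A] [Algebra k A]

theorem coe_lmul (u : A) (η : univForms k A) :
    (lmul k A (u ⊗ₜ η) : A ⊗[k] A) = (u ⊗ₜ 1) * (η : A ⊗[k] A) := by
  change (LinearMap.mul' k A).rTensor A ((TensorProduct.assoc k A A A).symm (u ⊗ₜ η.1)) = _
  induction (η : A ⊗[k] A) using TensorProduct.induction_on with
  | zero => simp
  | add x y hx hy => simp only [TensorProduct.tmul_add, map_add, mul_add, hx, hy]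
  | tmul x y => simp

theorem coe_rmul (u : A) (η : univForms k A) :
    (rmul k A (η ⊗ₜ u) : A ⊗[k] A) = (η : A ⊗[k] A) * (1 ⊗ₜ u) := by
  change (LinearMap.mul' k A).lTensor A (TensorProduct.assoc k A A A (η.1 ⊗ₜ u)) = _
  induction (η : A ⊗[k] A) using TensorProduct.induction_on with
  | zero => simp
  | add x y hx hy => simp only [TensorProduct.add_tmul, map_add, add_mul, hx, hy]
  | tmul x y => simp

theorem coe_d (u : A) : (d k A u : A ⊗[k] A) = 1 ⊗ₜ u - u ⊗ₜ 1 := rfl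

theorem coe_mulD (t : A ⊗[k] A) :
    (mulD k A t : A ⊗[k] A) = t - LinearMap.mul' k A t ⊗ₜ 1 := by
  induction t using TensorProduct.induction_on with
  | zero => simp
  | add x y hx hy => simp only [map_add, TensorProduct.add_tmul, Submodule.coe_add, hx, hy]; abel
  | tmul x y =>
    rw [mulD, LinearMap.comp_apply, LinearMap.lTensor_tmul, coe_lmul, coe_d]
    simp [mul_sub]

theorem coe_map {A' : Type*} [Ring A'] [Algebra k A'] (f : A →ₐ[k] A') (η : univForms k A) :
    (map f η : A' ⊗[k] A') = Algebra.TensorProduct.map f f (η : A ⊗[k] A) := rfl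

end univForms

section HopfInvariants

open WithConv LinearMap HopfAlgebra

theorem maurerCartan_one {R C : Type*} [CommSemiring R] [Semiring C] [Algebra R C] [Coalgebra R C]
    (h₁ : comul (R := R) (1 : C) = 1 ⊗ₜ 1) {S : C →ₗ[R] C} (hS : S 1 = 1) :
    maurerCartan S (1 : C) = 1 := by
  simp [maurerCartan, h₁, hS, Algebra.TensorProduct.one_def]

open Algebra.TensorProduct (includeLeft includeRight) in
theorem rightTensorCoact_tmul {k P H : Type*} [Field k] [Ring P] [Algebra k P] [Ring H]
    [HopfAlgebra k H] (δ : P →ₐ[k] P ⊗[k] H) (u v : P) :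
    rightTensorCoact δ (u ⊗ₜ v) =
      Algebra.TensorProduct.map (includeLeft : P →ₐ[k] P ⊗[k] P) (AlgHom.id k H) (δ u) *
        Algebra.TensorProduct.map (includeRight : P →ₐ[k] P ⊗[k] P) (AlgHom.id k H) (δ v) := by
  simp only [rightTensorCoact, LinearMap.comp_apply, TensorProduct.map_tmul,
    AlgHom.toLinearMap_apply]
  induction δ u using TensorProduct.induction_on with
  | zero => simp
  | add x y hx hy => simp only [TensorProduct.add_tmul, map_add, add_mul, hx, hy]
  | tmul a b =>
  induction δ v using TensorProduct.induction_on with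
  | zero => simp
  | add x y hx hy => simp only [TensorProduct.tmul_add, map_add, mul_add, hx, hy]
  | tmul c d => simp [midTwist_tmul]

variable {k P H : Type*} [Field k] [Ring P] [HopfAlgebra k P] [Ring H] [HopfAlgebra k H]

theorem galois_leftRegCoact (t : P ⊗[k] P) : (galois k P).lTensor P (leftRegCoact k P t) =
    TensorProduct.assoc k P P P ((comul (R := k)).rTensor P (galois k P t)) := by
  refine galois_coact (τ := tflip k P P) (fun b c => ?_) t
  rw [Bialgebra.comul_mul]
  induction comul (R := k) b using TensorProduct.induction_on with
  | zero => simp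
  | add x y hx hy => simp only [TensorProduct.add_tmul, map_add, add_mul, hx, hy]
  | tmul x y =>
  induction comul (R := k) c using TensorProduct.induction_on with
  | zero => simp
  | add x y hx hy => simp only [TensorProduct.tmul_add, map_add, mul_add, hx, hy]
  | tmul z w => simp [braidedMul_tmul]

theorem leftRegCoact_eq_iff (t : P ⊗[k] P) : leftRegCoact k P t = 1 ⊗ₜ t ↔
    t = maurerCartan (antipode k) (counitLeft k t) :=
  coact_eq_one_tmul_iff galois_leftRegCoact Bialgebra.comul_one Bialgebra.counit_mul
    antipode_mul_id id_mul_antipode t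

theorem counitLeft_maurerCartan_antipode (p : P) :
    counitLeft k (maurerCartan (antipode k) p) = p :=
  counitLeft_maurerCartan antipode_mul_id Bialgebra.counit_mul Bialgebra.counit_one p

theorem coe_canonicalConn (i : augKer k H →ₗ[k] augKer k P) (h : augKer k H) :
    (canonicalConn i h : P ⊗[k] P) = maurerCartan (antipode k) (i h : P) := by
  have : counit (R := k) (i h : P) = 0 := (i h).2
  simp [canonicalConn, univForms.coe_mulD, maurerCartan, this]

theorem toConv_homogCoact (π : P →ₐc[k] H) : toConv (homogCoact π).toLinearMap =
    toConv (inLeft k P H) * toConv (inRight k P H ∘ₗ (π : P →ₐ[k] H).toLinearMap) :=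
  toConv_map_comul LinearMap.id (π : P →ₐ[k] H).toLinearMap

theorem canMap_homogCoact (π : P →ₐc[k] H) (t : P ⊗[k] P) : canMap (homogCoact π) t =
    (π : P →ₐ[k] H).toLinearMap.lTensor P (galois k P t) := by
  induction t using TensorProduct.induction_on with
  | zero => simp
  | add x y hx hy => simp only [map_add, hx, hy]
  | tmul u v =>
    rw [galois, leftExt_tmul]
    simp only [canMap, homogCoact, LinearMap.comp_apply, lTensor_tmul, AlgHom.toLinearMap_apply,
      AlgHom.comp_apply, Bialgebra.comulAlgHom_apply]
    induction comul (R := k) v using TensorProduct.induction_on with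
    | zero => simp
    | add x y hx hy => simp only [map_add, mul_add, TensorProduct.tmul_add, hx, hy]
    | tmul x y => simp

open Algebra.TensorProduct (includeLeft includeRight) in
theorem rightTensorCoact_comp_maurerCartan (π : P →ₐc[k] H) :
    rightTensorCoact (homogCoact π) ∘ₗ maurerCartan (antipode k) =
      TensorProduct.map (maurerCartan (antipode k)) (π : P →ₐ[k] H).toLinearMap ∘ₗ adR k P := by
  let incl : P ⊗[k] P →ₐ[k] (P ⊗[k] P) ⊗[k] H := includeLeft
  let last : P →ₐ[k] (P ⊗[k] P) ⊗[k] H := includeRight.comp (π : P →ₐ[k] H)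
  let coactVia (e : P →ₐ[k] P ⊗[k] P) : P →ₐ[k] (P ⊗[k] P) ⊗[k] H :=
    (Algebra.TensorProduct.map e (AlgHom.id k H)).comp (homogCoact π)
  have coactVia_eq (e : P →ₐ[k] P ⊗[k] P) : toConv (coactVia e).toLinearMap =
      toConv (incl.comp e).toLinearMap * toConv last.toLinearMap :=
    toConv_comp_comul (T := ((Algebra.TensorProduct.map e (AlgHom.id k H)).comp
      (Algebra.TensorProduct.map (AlgHom.id k P) (π : P →ₐ[k] H))).toLinearMap) fun x y => by
        simp [incl, last]
  have maurerCartan_eq : toConv (incl.toLinearMap ∘ₗ maurerCartan (antipode k)) =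
      toConv ((incl.comp includeLeft).toLinearMap ∘ₗ antipode k) *
        toConv (incl.comp includeRight).toLinearMap :=
    toConv_comp_comul (T := incl.toLinearMap ∘ₗ (antipode k).rTensor P) fun x y => by simp [incl]
  apply toConv_injective
  calc toConv (rightTensorCoact (homogCoact π) ∘ₗ maurerCartan (antipode k))
      = toConv ((coactVia includeLeft).toLinearMap ∘ₗ antipode k) *
          toConv (coactVia includeRight).toLinearMap :=
        toConv_comp_comul (T := rightTensorCoact (homogCoact π) ∘ₗ (antipode k).rTensor P)
          fun x y => rightTensorCoact_tmul _ _ _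
    _ = toConv (last.toLinearMap ∘ₗ antipode k) *
          toConv (incl.toLinearMap ∘ₗ maurerCartan (antipode k)) * toConv last.toLinearMap := by
        rw [toConv_comp_antipode_of_eq_mul (coactVia_eq includeLeft), coactVia_eq includeRight,
          maurerCartan_eq]
        simp only [mul_assoc]
    _ = _ := (toConv_map_adR (maurerCartan (antipode k)) (π : P →ₐ[k] H)).symm

end HopfInvariants

theorem leftTensorCoact_map {k H V W V' W' : Type*} [Field k] [Ring H] [Algebra k H]
    [AddCommGroup V] [Module k V] [AddCommGroup W] [Module k W] [AddCommGroup V'] [Module k V']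
    [AddCommGroup W'] [Module k W'] {ρ : V →ₗ[k] H ⊗[k] V} {σ : W →ₗ[k] H ⊗[k] W}
    {ρ' : V' →ₗ[k] H ⊗[k] V'} {σ' : W' →ₗ[k] H ⊗[k] W'} {f : V →ₗ[k] V'} {g : W →ₗ[k] W'}
    (hf : ∀ v, ρ' (f v) = f.lTensor H (ρ v)) (hg : ∀ w, σ' (g w) = g.lTensor H (σ w))
    (t : V ⊗[k] W) : leftTensorCoact ρ' σ' (TensorProduct.map f g t) =
      (TensorProduct.map f g).lTensor H (leftTensorCoact ρ σ t) := by
  induction t using TensorProduct.induction_on with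
  | zero => simp
  | add x y hx hy => simp only [map_add, hx, hy]
  | tmul v w =>
  simp only [leftTensorCoact, LinearMap.comp_apply, TensorProduct.map_tmul, hf, hg]
  induction ρ v using TensorProduct.induction_on with
  | zero => simp
  | add x y hx hy => simp only [map_add, TensorProduct.add_tmul, hx, hy]
  | tmul x y =>
  induction σ w using TensorProduct.induction_on with
  | zero => simp
  | add x y hx hy => simp only [map_add, TensorProduct.tmul_add, hx, hy]
  | tmul z w => simp [midTwist_tmul]

section BraidedInvariants

open WithConv LinearMap BraidedGroup

variable {k H B : Type*} [Field k] [Ring H] [HopfAlgebra k H] [Ring B] [Algebra k B]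
  [Coalgebra k B] [CrossedModule k H B] [BraidedGroup k H B]

variable (k H B) in
theorem bantipode_mul_id : toConv (bantipode (k := k) (B := B) H) * toConv LinearMap.id = 1 := by
  ext b
  rw [convMul_apply, convOne_apply, Algebra.algebraMap_eq_smul_one]
  exact mul_bantipode_rTensor_comul (H := H) b

variable (k H B) in
theorem id_mul_bantipode : toConv LinearMap.id * toConv (bantipode (k := k) (B := B) H) = 1 := by
  ext b
  rw [convMul_apply, convOne_apply, Algebra.algebraMap_eq_smul_one]
  exact mul_bantipode_lTensor_comul (H := H) b

theorem braidedLeftCoact_eq_iff (t : B ⊗[k] B) : braidedLeftCoact k H B t = 1 ⊗ₜ t ↔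
    t = maurerCartan (bantipode (k := k) H) (counitLeft k t) :=
  coact_eq_one_tmul_iff (L := braidedLeftCoact k H B)
    (galois_coact (BraidedGroup.comul_mul (k := k) (H := H) (B := B)))
    (BraidedGroup.comul_one (H := H)) (BraidedGroup.counit_mul (H := H))
    (bantipode_mul_id k H B) (id_mul_bantipode k H B) t

theorem counitLeft_maurerCartan_bantipode (b : B) :
    counitLeft k (maurerCartan (bantipode (k := k) H) b) = b :=
  counitLeft_maurerCartan (bantipode_mul_id k H B) (BraidedGroup.counit_mul (H := H))
    (BraidedGroup.counit_one (H := H)) b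

variable (k H B) in
theorem bantipode_one : bantipode (k := k) H (1 : B) = 1 := by
  have := mul_bantipode_rTensor_comul (k := k) (H := H) (1 : B)
  rw [BraidedGroup.comul_one (H := H), BraidedGroup.counit_one (H := H)] at this
  simpa using this

theorem coactTensor_maurerCartan (b : B) :
    coactTensor k H B (maurerCartan (bantipode (k := k) H) b) =
      (maurerCartan (bantipode (k := k) H)).lTensor H (coact (k := k) b) := by
  rw [maurerCartan, LinearMap.comp_apply, rTensor, coactTensor,
    leftTensorCoact_map coact_bantipode (fun c => by rw [lTensor_id]; rfl), ← coact_comul,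
    ← lTensor_comp_apply]

theorem coact_counitLeft (t : B ⊗[k] B) : coact (k := k) (H := H) (counitLeft k t) =
    (counitLeft k).lTensor H (coactTensor k H B t) := by
  induction t using TensorProduct.induction_on with
  | zero => simp
  | add x y hx hy => simp only [map_add, hx, hy]
  | tmul b c =>
  have counit_first (s t : H ⊗[k] B) : (counitLeft k).lTensor H ((mul' k H).rTensor (B ⊗[k] B)
      (midTwist (tflip k B H) (s ⊗ₜ t))) =
      (TensorProduct.rid k H ((counit (R := k)).lTensor H s) ⊗ₜ 1) * t := by
    induction s using TensorProduct.induction_on with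
    | zero => simp
    | add x y hx hy => simp only [map_add, TensorProduct.add_tmul, add_mul, hx, hy]
    | tmul x y =>
    induction t using TensorProduct.induction_on with
    | zero => simp
    | add x y hx hy => simp only [map_add, TensorProduct.tmul_add, mul_add, hx, hy]
    | tmul z w => simp [midTwist_tmul, counitLeft_tmul, TensorProduct.smul_tmul']
  simp only [coactTensor, leftTensorCoact, LinearMap.comp_apply, TensorProduct.map_tmul]
  rw [counit_first, coact_counit, counitLeft_tmul, map_smul, ← TensorProduct.smul_tmul',
    smul_mul_assoc, ← Algebra.TensorProduct.one_def, one_mul]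

theorem coe_formOfMap (γ : augKer k H →ₗ[k] augKer k B) (h : augKer k H) :
    (formOfMap γ h : B ⊗[k] B) = maurerCartan (bantipode (k := k) H) (γ h : B) := by
  have hε : counit (R := k) (γ h : B) = 0 := (γ h).2
  rw [formOfMap, LinearMap.comp_apply, univForms.coe_mulD]
  simp only [LinearMap.comp_apply, Submodule.subtype_apply, mul_bantipode_rTensor_comul, hε,
    maurerCartan, zero_smul, TensorProduct.zero_tmul, sub_zero]

theorem formOfMap_bijOn : Set.BijOn formOfMap (adIntertwiners k H B) (invariantForms k H B) := by
  refine ⟨fun γ hγ => ⟨fun h => ?_, ?_⟩, fun γ _ γ' _ hγ => ?_, fun β hβ => ?_⟩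
  · rw [braidedLeftCoact_eq_iff, coe_formOfMap, counitLeft_maurerCartan_bantipode]
  · have : (univForms k B).subtype ∘ₗ formOfMap γ =
        maurerCartan (bantipode (k := k) H) ∘ₗ (augKer k B).subtype ∘ₗ γ :=
      LinearMap.ext (coe_formOfMap γ)
    rw [this]
    exact IntertwinesAd.comp hγ _ coactTensor_maurerCartan
  · ext h
    have := congrArg (fun β => counitLeft k (β h : B ⊗[k] B)) hγ
    simpa only [coe_formOfMap, counitLeft_maurerCartan_bantipode] using this
  · refine ⟨(counitLeft k ∘ₗ (univForms k B).subtype ∘ₗ β).codRestrict _ fun h => ?_,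
      IntertwinesAd.comp hβ.2 (counitLeft k) coact_counitLeft, ?_⟩
    · change counit (R := k) (counitLeft k (β h : B ⊗[k] B)) = 0
      rw [counit_counitLeft (BraidedGroup.counit_mul (H := H)), show mul' k B _ = 0 from (β h).2,
        map_zero]
    · ext h : 2
      rw [coe_formOfMap]
      exact ((braidedLeftCoact_eq_iff _).1 (hβ.1 h)).symm

end BraidedInvariants

/-! ### Strong connections -/

section StrongForms

open LinearMap

variable {k P H : Type*} [Field k] [Ring P] [Algebra k P] [Ring H] [HopfAlgebra k H]

theorem ker_sub_inLeft (δ : P →ₐ[k] P ⊗[k] H) :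
    ker (δ.toLinearMap - inLeft k P H) = range (base δ).val.toLinearMap := by
  ext m
  rw [mem_ker, LinearMap.sub_apply, sub_eq_zero]
  exact ⟨fun hm => ⟨⟨m, hm⟩, rfl⟩, fun ⟨m', hm'⟩ => hm' ▸ m'.2⟩

theorem rTensor_eq_iff_mem_range (δ : P →ₐ[k] P ⊗[k] H) (t : P ⊗[k] P) :
    δ.toLinearMap.rTensor P t = (inLeft k P H).rTensor P t ↔
      t ∈ range ((base δ).val.toLinearMap.rTensor P) := by
  rw [← (Module.Flat.rTensor_exact P (exact_iff.2 (ker_sub_inLeft δ))).linearMap_ker_eq,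
    mem_ker, rTensor_sub, LinearMap.sub_apply, sub_eq_zero]

theorem mem_strongHor_iff (δ : P →ₐ[k] P ⊗[k] H) (t : univForms k P) :
    t ∈ strongHor δ ↔
      δ.toLinearMap.rTensor P (t : P ⊗[k] P) = (inLeft k P H).rTensor P (t : P ⊗[k] P) := by
  rw [rTensor_eq_iff_mem_range]
  constructor
  · rintro ⟨s, rfl⟩
    induction s using TensorProduct.induction_on with
    | zero => simp
    | add x y hx hy => rw [map_add]; exact add_mem hx hy
    | tmul η y =>
      rw [LinearMap.comp_apply, rTensor_tmul, univForms.coe_rmul, univForms.coe_map]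
      induction (η : base δ ⊗[k] base δ) using TensorProduct.induction_on with
      | zero => simp
      | add x y hx hy => rw [map_add, add_mul]; exact add_mem hx hy
      | tmul m m' => exact ⟨m ⊗ₜ (m' * y), by simp⟩
  · rintro ⟨s, hs⟩
    have sum_d (s : base δ ⊗[k] P) : (univForms.rmul k P ((univForms.map (base δ).val).rTensor P
        ((univForms.d k (base δ)).rTensor P s)) : P ⊗[k] P) =
        1 ⊗ₜ mul' k P ((base δ).val.toLinearMap.rTensor P s) -
          (base δ).val.toLinearMap.rTensor P s := by
      induction s using TensorProduct.induction_on with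
      | zero => simp
      | add x y hx hy =>
        simp only [map_add, Submodule.coe_add, hx, hy, TensorProduct.tmul_add]
        abel
      | tmul m y => simp [univForms.coe_rmul, univForms.coe_map, univForms.coe_d, sub_mul]
    refine neg_mem_iff.1 ⟨(univForms.d k (base δ)).rTensor P s, Subtype.ext ?_⟩
    refine (sum_d s).trans ?_
    rw [hs, show mul' k P t = 0 from t.2, TensorProduct.tmul_zero, zero_sub, Submodule.coe_neg]

end StrongForms

section Cotensor

open WithConv LinearMap HopfAlgebra

theorem rTensor_comp_leftExt {R A A' D V : Type*} [CommSemiring R] [Semiring A] [Algebra R A]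
    [Semiring A'] [Algebra R A'] [Semiring D] [Algebra R D] [AddCommMonoid V] [Module R V]
    (φ : A →ₐ[R] A') (f : V →ₗ[R] A ⊗[R] D) : φ.toLinearMap.rTensor D ∘ₗ leftExt f =
      leftExt (φ.toLinearMap.rTensor D ∘ₗ f) ∘ₗ φ.toLinearMap.rTensor V := by
  refine TensorProduct.ext' fun u v => ?_
  simp only [LinearMap.comp_apply, leftExt_tmul, rTensor_tmul, AlgHom.toLinearMap_apply]
  induction f v using TensorProduct.induction_on with
  | zero => simp
  | add x y hx hy => simp only [map_add, mul_add, hx, hy]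
  | tmul x y => simp

theorem leftExt_rTensor_comul_injective {R C A : Type*} [CommSemiring R] [Semiring C] [Algebra R C]
    [Coalgebra R C] [Semiring A] [Algebra R A] (φ : C →ₐ[R] A) {S : C →ₗ[R] C}
    (hS : toConv LinearMap.id * toConv S = 1) :
    Function.Injective (leftExt (φ.toLinearMap.rTensor C ∘ₗ comul)) := by
  have h : leftExt (maurerCartan S) ∘ₗ comul = inRight R C C := by
    ext c
    refine .trans ?_ (LinearMap.congr_fun (leftExt_maurerCartan_comp_galois hS) (1 ⊗ₜ c))
    rw [LinearMap.comp_apply, LinearMap.comp_apply, galois, leftExt_one_tmul]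
  have hleft : leftExt (φ.toLinearMap.rTensor C ∘ₗ maurerCartan S) ∘ₗ
      leftExt (φ.toLinearMap.rTensor C ∘ₗ comul) = LinearMap.id := by
    rw [leftExt_comp_leftExt, ← LinearMap.comp_assoc, ← rTensor_comp_leftExt, LinearMap.comp_assoc,
      h, ← leftExt_inRight]
    congr 1
    ext c
    simp
  exact injective_of_comp_eq_id _ _ hleft

variable {k P H : Type*} [Field k] [Ring P] [HopfAlgebra k P] [Ring H] [HopfAlgebra k H]

/-- The left coaction `(π ⊗ id) Δ` of `H` on `P` defined by a Hopf algebra map `π : P → H`. -/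
noncomputable def homogLeftCoact (π : P →ₐc[k] H) : P →ₐ[k] H ⊗[k] P :=
  (Algebra.TensorProduct.map (π : P →ₐ[k] H) (AlgHom.id k P)).comp (Bialgebra.comulAlgHom k P)

theorem toLinearMap_homogCoact (π : P →ₐc[k] H) : (homogCoact π).toLinearMap =
    (π : P →ₐ[k] H).toLinearMap.lTensor P ∘ₗ comul := rfl

theorem toLinearMap_homogLeftCoact (π : P →ₐc[k] H) : (homogLeftCoact π).toLinearMap =
    (π : P →ₐ[k] H).toLinearMap.rTensor P ∘ₗ comul := rfl

theorem assoc_rTensor_homogCoact_comul (π : P →ₐc[k] H) (u : P) :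
    TensorProduct.assoc k P H P ((homogCoact π).toLinearMap.rTensor P (comul (R := k) u)) =
      (homogLeftCoact π).toLinearMap.lTensor P (comul (R := k) u) := by
  have assoc_middle : (TensorProduct.assoc k P H P).toLinearMap ∘ₗ
      ((π : P →ₐ[k] H).toLinearMap.lTensor P).rTensor P =
        ((π : P →ₐ[k] H).toLinearMap.rTensor P).lTensor P ∘ₗ
          (TensorProduct.assoc k P P P).toLinearMap :=
    TensorProduct.ext_threefold fun x y z => rfl
  rw [toLinearMap_homogCoact, rTensor_comp_apply, toLinearMap_homogLeftCoact, lTensor_comp_apply,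
    ← Coalgebra.coassoc_apply]
  exact LinearMap.congr_fun assoc_middle _

theorem assoc_rTensor_homogCoact (π : P →ₐc[k] H) (u : P) :
    TensorProduct.assoc k P H H ((homogCoact π).toLinearMap.rTensor H (homogCoact π u)) =
      (comul (R := k)).lTensor P (homogCoact π u) := by
  have comul_map : comul ∘ₗ (π : P →ₐ[k] H).toLinearMap =
      (π : P →ₐ[k] H).toLinearMap.lTensor H ∘ₗ (homogLeftCoact π).toLinearMap := by
    ext v
    refine (CoalgHomClass.map_comp_comul_apply π v).symm.trans ?_
    rw [toLinearMap_homogLeftCoact, ← LinearMap.comp_assoc, lTensor_comp_rTensor]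
    rfl
  have hδ : homogCoact π u = (π : P →ₐ[k] H).toLinearMap.lTensor P (comul (R := k) u) := rfl
  have assoc_last : (TensorProduct.assoc k P H H).toLinearMap ∘ₗ
      (π : P →ₐ[k] H).toLinearMap.lTensor (P ⊗[k] H) =
        ((π : P →ₐ[k] H).toLinearMap.lTensor H).lTensor P ∘ₗ
          (TensorProduct.assoc k P H P).toLinearMap :=
    TensorProduct.ext_threefold fun x y z => rfl
  rw [hδ, ← lTensor_comp_apply, comul_map, lTensor_comp_apply, ← assoc_rTensor_homogCoact_comul,
    ← LinearMap.comp_apply (rTensor _ _), rTensor_comp_lTensor, ← lTensor_comp_rTensor]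
  exact LinearMap.congr_fun assoc_last _

/-- The map `galois` transports the forms generated by the base to the cotensor product of `P` with
itself over `H`. -/
theorem rTensor_homogCoact_eq_iff (π : P →ₐc[k] H) (t : P ⊗[k] P) :
    (homogCoact π).toLinearMap.rTensor P t = (inLeft k P H).rTensor P t ↔
      TensorProduct.assoc k P H P ((homogCoact π).toLinearMap.rTensor P (galois k P t)) =
        (homogLeftCoact π).toLinearMap.lTensor P (galois k P t) := by
  have galois_inLeft : (TensorProduct.assoc k P H P).toLinearMap ∘ₗ
      leftExt ((homogCoact π).toLinearMap.rTensor P ∘ₗ comul) ∘ₗ (inLeft k P H).rTensor P =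
        (homogLeftCoact π).toLinearMap.lTensor P ∘ₗ galois k P := by
    refine TensorProduct.ext' fun u v => ?_
    have hassoc (s : (P ⊗[k] H) ⊗[k] P) : TensorProduct.assoc k P H P (((u ⊗ₜ 1) ⊗ₜ 1) * s) =
        (u ⊗ₜ (1 ⊗ₜ 1)) * TensorProduct.assoc k P H P s :=
      map_mul (Algebra.TensorProduct.assoc k k k P H P) _ s
    refine (hassoc _).trans ?_
    rw [LinearMap.comp_apply, assoc_rTensor_homogCoact_comul, galois, LinearMap.comp_apply,
      leftExt_tmul]
    refine .trans ?_ (map_mul (Algebra.TensorProduct.map (AlgHom.id k P) (homogLeftCoact π))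
      (u ⊗ₜ 1) (comul v)).symm
    rw [Algebra.TensorProduct.map_tmul, map_one]
    rfl
  rw [← (leftExt_rTensor_comul_injective (homogCoact π) (id_mul_antipode (R := k))).eq_iff,
    ← (TensorProduct.assoc k P H P).injective.eq_iff]
  refine Eq.congr ?_ (LinearMap.congr_fun galois_inLeft t)
  exact congr(TensorProduct.assoc k P H P
    ($(rTensor_comp_leftExt (homogCoact π) (comul (R := k) (A := P))) t)).symm

theorem coe_lmul_lTensor {A V : Type*} [Ring A] [Algebra k A] [AddCommGroup V] [Module k V]
    (f : V →ₗ[k] univForms k A) (t : A ⊗[k] V) :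
    (univForms.lmul k A (f.lTensor A t) : A ⊗[k] A) =
      leftExt ((univForms k A).subtype ∘ₗ f) t := by
  induction t using TensorProduct.induction_on with
  | zero => simp
  | add x y hx hy => simp only [map_add, Submodule.coe_add, hx, hy]
  | tmul u v => rw [lTensor_tmul, univForms.coe_lmul, leftExt_tmul]; rfl

theorem leftExt_sub {A D V : Type*} [Ring A] [Algebra k A] [Ring D] [Algebra k D] [AddCommGroup V]
    [Module k V] (f g : V →ₗ[k] A ⊗[k] D) : leftExt (f - g) = leftExt f - leftExt g :=
  TensorProduct.ext' fun u v => by simp [leftExt_tmul, mul_sub]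

theorem lTensor_counit_homogCoact (π : P →ₐc[k] H) (u : P) :
    (counit (R := k)).lTensor P (homogCoact π u) = u ⊗ₜ 1 := by
  rw [← Coalgebra.lTensor_counit_comul (R := k) u,
    ← (CoalgHomClass.counit_comp π : counit ∘ₗ (π : P →ₐ[k] H).toLinearMap = counit)]
  exact (lTensor_comp_apply P _ _ _).symm

theorem leftExt_counit_homogCoact (π : P →ₐc[k] H) (u : P) :
    leftExt (Algebra.linearMap k (P ⊗[k] P) ∘ₗ counit) (homogCoact π u) = u ⊗ₜ 1 := by
  have leftExt_counit : leftExt (Algebra.linearMap k (P ⊗[k] P) ∘ₗ counit) = inLeft k P P ∘ₗ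
      (TensorProduct.rid k P).toLinearMap ∘ₗ (counit (R := k) (A := H)).lTensor P :=
    TensorProduct.ext' fun v h => by
      simp [leftExt_tmul, Algebra.algebraMap_eq_smul_one, Algebra.TensorProduct.one_def,
        TensorProduct.smul_tmul']
  rw [leftExt_counit, LinearMap.comp_apply, LinearMap.comp_apply, lTensor_counit_homogCoact]
  simp

theorem coe_d_sub_connProj_canonicalConn (π : P →ₐc[k] H) (i : augKer k H →ₗ[k] augKer k P)
    (u : P) :
    ((univForms.d k P u - connProj (homogCoact π) (canonicalConn i) (univForms.d k P u) :
      univForms k P) : P ⊗[k] P) = 1 ⊗ₜ u -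
        leftExt (maurerCartan (antipode k) ∘ₗ augExt ((augKer k P).subtype ∘ₗ i))
          (homogCoact π u) := by
  have canMap_d : canMap (homogCoact π) (univForms.d k P u : P ⊗[k] P) =
      homogCoact π u - u ⊗ₜ 1 := by
    rw [canMap_homogCoact, univForms.coe_d, map_sub, map_sub, galois, leftExt_one_tmul,
      leftExt_tmul, Bialgebra.comul_one, mul_one, lTensor_tmul]
    exact congrArg (_ - u ⊗ₜ ·) (map_one π)
  have hform : (univForms k P).subtype ∘ₗ canonicalConn i ∘ₗ augProj k H =
      maurerCartan (antipode k) ∘ₗ augExt ((augKer k P).subtype ∘ₗ i) -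
        Algebra.linearMap k _ ∘ₗ counit := by
    have hconv := toConv_comp_augProj (T := maurerCartan (antipode k))
      (maurerCartan_one Bialgebra.comul_one antipode_one) ((augKer k P).subtype ∘ₗ i)
    refine .trans ?_ (toConv_injective hconv)
    ext h
    exact coe_canonicalConn i _
  rw [Submodule.coe_sub, connProj]
  simp only [LinearMap.comp_apply, Submodule.subtype_apply]
  rw [coe_lmul_lTensor, canMap_d, map_sub, hform, leftExt_sub, LinearMap.sub_apply,
    LinearMap.sub_apply, leftExt_counit_homogCoact]
  simp [univForms.coe_d, leftExt_tmul, augExt_one,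
    maurerCartan_one (R := k) (C := P) Bialgebra.comul_one antipode_one]

theorem galois_comp_leftExt_maurerCartan {V : Type*} [AddCommGroup V] [Module k V]
    (p : V →ₗ[k] P) :
    galois k P ∘ₗ leftExt (maurerCartan (antipode k) ∘ₗ p) = p.lTensor P := by
  rw [galois, leftExt_comp_leftExt, ← LinearMap.comp_assoc, ← galois,
    galois_comp_maurerCartan antipode_mul_id]
  exact TensorProduct.ext' fun u v => by simp [leftExt_tmul]

theorem counitLeft_homogCoact (π : P →ₐc[k] H) (u : P) : counitLeft k (homogCoact π u) = π u :=
  (counitLeft_lTensor (π : P →ₐ[k] H).toLinearMap (comul u)).trans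
    (congrArg π (counitLeft_comul u))

theorem lTensor_homogCoact_eq_iff {π : P →ₐc[k] H} (hπ : Function.Surjective π) {V : Type*}
    [AddCommGroup V] [Module k V] {f g : H →ₗ[k] V} :
    (∀ u, f.lTensor P (homogCoact π u) = g.lTensor P (homogCoact π u)) ↔ f = g := by
  refine ⟨fun h => ?_, fun h u => by rw [h]⟩
  ext x
  obtain ⟨u, rfl⟩ := hπ x
  rw [← counitLeft_homogCoact, ← counitLeft_lTensor, h, counitLeft_lTensor]

/-- Left colinearity of a linear map `p : H → P` for the coactions of `H` on itself and on `P`. -/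
def IsLeftColinear (π : P →ₐc[k] H) (p : H →ₗ[k] P) : Prop :=
  (homogLeftCoact π).toLinearMap ∘ₗ p = p.lTensor H ∘ₗ comul

theorem isStrong_canonicalConn_iff {π : P →ₐc[k] H} (hπ : Function.Surjective π)
    (i : augKer k H →ₗ[k] augKer k P) : IsStrong (homogCoact π) (canonicalConn i) ↔
      IsLeftColinear π (augExt ((augKer k P).subtype ∘ₗ i)) := by
  set p := augExt ((augKer k P).subtype ∘ₗ i)
  rw [IsStrong, IsLeftColinear, eq_comm, ← lTensor_homogCoact_eq_iff hπ]
  refine forall_congr' fun u => ?_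
  have hgalois : galois k P (1 ⊗ₜ u - leftExt (maurerCartan (antipode k) ∘ₗ p) (homogCoact π u)) =
      comul u - p.lTensor P (homogCoact π u) := by
    rw [map_sub, ← LinearMap.comp_apply, galois_comp_leftExt_maurerCartan, galois,
      leftExt_one_tmul]
  have hright : TensorProduct.assoc k P H P ((homogCoact π).toLinearMap.rTensor P
      (p.lTensor P (homogCoact π u))) = (p.lTensor H ∘ₗ comul).lTensor P (homogCoact π u) := by
    have assoc_last : (TensorProduct.assoc k P H P).toLinearMap ∘ₗ p.lTensor (P ⊗[k] H) =
        (p.lTensor H).lTensor P ∘ₗ (TensorProduct.assoc k P H H).toLinearMap :=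
      TensorProduct.ext_threefold fun x y z => rfl
    rw [lTensor_comp_apply, ← assoc_rTensor_homogCoact, ← LinearMap.comp_apply (rTensor _ _),
      rTensor_comp_lTensor, ← lTensor_comp_rTensor]
    exact LinearMap.congr_fun assoc_last _
  rw [mem_strongHor_iff, coe_d_sub_connProj_canonicalConn, rTensor_homogCoact_eq_iff, hgalois,
    map_sub, map_sub, map_sub, assoc_rTensor_homogCoact_comul, sub_right_inj, hright,
    lTensor_comp_apply P (homogLeftCoact π).toLinearMap]

end Cotensor

/-! ### Connections defined by Hopf algebra maps -/

section CanonicalConnections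

open WithConv LinearMap HopfAlgebra

variable {k P H : Type*} [Field k] [Ring P] [HopfAlgebra k P] [Ring H] [HopfAlgebra k H]

/-- The map `h ↦ (ε ⊗ id) ω(h)`; it recovers a splitting from its canonical connection. -/
noncomputable def counitForm (ω : augKer k H →ₗ[k] univForms k P) : augKer k H →ₗ[k] augKer k P :=
  (counitLeft k ∘ₗ (univForms k P).subtype ∘ₗ ω).codRestrict _ fun h => by
    change counit (R := k) (counitLeft k (ω h : P ⊗[k] P)) = 0
    rw [counit_counitLeft Bialgebra.counit_mul, show mul' k P _ = 0 from (ω h).2, map_zero]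

theorem coe_counitForm (ω : augKer k H →ₗ[k] univForms k P) (h : augKer k H) :
    (counitForm ω h : P) = counitLeft k (ω h : P ⊗[k] P) := rfl

theorem canonicalConn_bijOn : Set.BijOn (canonicalConn (k := k) (H := H) (P := P)) Set.univ
    {ω | IsLeftInvariant ω} := by
  refine Set.InvOn.bijOn (f' := counitForm) ⟨fun i _ => ?_, fun ω hω => ?_⟩ (fun i _ h => ?_)
    fun _ _ => Set.mem_univ _
  · ext h
    rw [coe_counitForm, coe_canonicalConn, counitLeft_maurerCartan_antipode]
  · ext h
    rw [coe_canonicalConn, coe_counitForm]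
    exact ((leftRegCoact_eq_iff _).1 (hω h)).symm
  · rw [leftRegCoact_eq_iff, coe_canonicalConn, counitLeft_maurerCartan_antipode]

theorem isConnection_canonicalConn_iff (π : P →ₐc[k] H) (i : augKer k H →ₗ[k] augKer k P) :
    IsConnection (homogCoact π) (canonicalConn i) ↔ IsSplitting π i := by
  have canMap_iff (h : augKer k H) :
      canMap (homogCoact π) (canonicalConn i h : P ⊗[k] P) = 1 ⊗ₜ (h : H) ↔ π (i h : P) = h := by
    rw [coe_canonicalConn, canMap_homogCoact, galois_maurerCartan antipode_mul_id, lTensor_tmul]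
    refine ⟨fun hi => ?_, fun hi => congrArg (1 ⊗ₜ ·) hi⟩
    simpa [counitLeft_tmul] using congrArg (counitLeft k) hi
  have rTensor_maurerCartan_injective :
      Function.Injective ((maurerCartan (antipode k) : P →ₗ[k] P ⊗[k] P).rTensor H) := by
    refine injective_of_comp_eq_id _ ((counitLeft k).rTensor H) ?_
    rw [← rTensor_comp, show counitLeft k ∘ₗ maurerCartan (antipode k) = LinearMap.id from
      LinearMap.ext counitLeft_maurerCartan_antipode, rTensor_id]
  have covariant_iff (h : augKer k H) :
      rightTensorCoact (homogCoact π) (canonicalConn i h : P ⊗[k] P) =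
          ((univForms k P).subtype ∘ₗ canonicalConn i ∘ₗ augProj k H).rTensor H (adR k H h) ↔
        (π : P →ₐ[k] H).toLinearMap.lTensor P (adR k P (i h : P)) =
          ((augKer k P).subtype ∘ₗ i ∘ₗ augProj k H).rTensor H (adR k H h) := by
    have factor : (univForms k P).subtype ∘ₗ canonicalConn i ∘ₗ augProj k H =
        maurerCartan (antipode k) ∘ₗ (augKer k P).subtype ∘ₗ i ∘ₗ augProj k H :=
      LinearMap.ext fun x => coe_canonicalConn i _
    rw [factor, coe_canonicalConn, ← LinearMap.comp_apply (rightTensorCoact _),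
      rightTensorCoact_comp_maurerCartan, rTensor_comp_apply, LinearMap.comp_apply,
      ← rTensor_comp_lTensor, LinearMap.comp_apply, rTensor_maurerCartan_injective.eq_iff]
  exact ⟨fun hω => ⟨fun h => (canMap_iff h).1 (hω.1 h), fun h => (covariant_iff h).1 (hω.2 h)⟩,
    fun hi => ⟨fun h => (canMap_iff h).2 (hi.1 h), fun h => (covariant_iff h).2 (hi.2 h)⟩⟩

/-- Right colinearity of a linear map `p : H → P` for the coactions of `H` on itself and on `P`. -/
def IsRightColinear (π : P →ₐc[k] H) (p : H →ₗ[k] P) : Prop :=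
  (homogCoact π).toLinearMap ∘ₗ p = p.rTensor H ∘ₗ comul

theorem isLeftColinear_iff {π : P →ₐc[k] H} {p : H →ₗ[k] P} : IsLeftColinear π p ↔
    toConv ((homogLeftCoact π).toLinearMap ∘ₗ p) =
      toConv (inLeft k H P) * toConv (inRight k H P ∘ₗ p) := by
  rw [IsLeftColinear, ← toConv_injective.eq_iff, lTensor, toConv_map_comul, comp_id]

theorem isRightColinear_iff {π : P →ₐc[k] H} {p : H →ₗ[k] P} : IsRightColinear π p ↔
    toConv ((homogCoact π).toLinearMap ∘ₗ p) =
      toConv (inLeft k P H ∘ₗ p) * toConv (inRight k P H) := by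
  rw [IsRightColinear, ← toConv_injective.eq_iff, rTensor, toConv_map_comul, comp_id]

theorem toConv_homogLeftCoact (π : P →ₐc[k] H) : toConv (homogLeftCoact π).toLinearMap =
    toConv (inLeft k H P ∘ₗ (π : P →ₐ[k] H).toLinearMap) * toConv (inRight k H P) :=
  toConv_map_comul (π : P →ₐ[k] H).toLinearMap LinearMap.id

theorem toConv_lTensor_adR (π : P →ₐc[k] H) :
    toConv ((π : P →ₐ[k] H).toLinearMap.lTensor P ∘ₗ adR k P) =
      toConv (inRight k P H ∘ₗ antipode k ∘ₗ (π : P →ₐ[k] H).toLinearMap) *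
        toConv (homogCoact π).toLinearMap := by
  rw [lTensor, toConv_map_adR, bialgHom_comp_antipode, toConv_homogCoact, mul_assoc, comp_id]

theorem IsLeftColinear.toConv_adR_comp {π : P →ₐc[k] H} {p : H →ₗ[k] P}
    (hp : IsLeftColinear π p) :
    toConv (((π : P →ₐ[k] H).toLinearMap.lTensor P ∘ₗ adR k P) ∘ₗ p) =
      toConv (inRight k P H ∘ₗ antipode k) * toConv ((homogCoact π).toLinearMap ∘ₗ p) := by
  let T : H ⊗[k] P →ₗ[k] P ⊗[k] H := mul' k _ ∘ₗ
    TensorProduct.map (inRight k P H ∘ₗ antipode k) (homogCoact π).toLinearMap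
  have hT (x : H) (y : P) : T ((x ⊗ₜ 1) * (1 ⊗ₜ y)) = (1 ⊗ₜ antipode k x) * homogCoact π y := by
    simp [T]
  have factor : (π : P →ₐ[k] H).toLinearMap.lTensor P ∘ₗ adR k P =
      T ∘ₗ (homogLeftCoact π).toLinearMap := by
    apply toConv_injective
    rw [toConv_lTensor_adR, ← ofConv_toConv (homogLeftCoact π).toLinearMap, toConv_homogLeftCoact]
    exact (toConv_comp_convMul fun x y => hT _ _).symm
  rw [factor, LinearMap.comp_assoc, ← ofConv_toConv ((homogLeftCoact π).toLinearMap ∘ₗ p),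
    isLeftColinear_iff.1 hp]
  exact toConv_comp_convMul fun x y => hT _ _

theorem IsLeftColinear.covariant_iff {π : P →ₐc[k] H} {p : H →ₗ[k] P}
    (hp : IsLeftColinear π p) :
    toConv (((π : P →ₐ[k] H).toLinearMap.lTensor P ∘ₗ adR k P) ∘ₗ p) =
      toConv (inRight k P H ∘ₗ antipode k) * toConv (inLeft k P H ∘ₗ p) *
        toConv (inRight k P H) ↔ IsRightColinear π p := by
  rw [hp.toConv_adR_comp, mul_assoc, isRightColinear_iff]
  refine ⟨fun h => ?_, congrArg _⟩
  simpa only [← mul_assoc, toConv_mul_comp_antipode, one_mul] using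
    congrArg (toConv (inRight k P H) * ·) h

theorem IsRightColinear.proj_apply {π : P →ₐc[k] H} {p : H →ₗ[k] P} (hp : IsRightColinear π p)
    (hε : ∀ h, counit (R := k) (p h) = counit (R := k) h) (h : H) : π (p h) = h := by
  have hrTensor (t : H ⊗[k] H) : counitLeft k (p.rTensor H t) = counitLeft k t := by
    induction t using TensorProduct.induction_on with
    | zero => simp
    | add x y hx hy => simp only [map_add, hx, hy]
    | tmul x y => simp [counitLeft_tmul, hε]
  rw [← counitLeft_homogCoact]
  refine (congrArg (counitLeft k) (LinearMap.congr_fun hp h)).trans ?_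
  rw [LinearMap.comp_apply, hrTensor, counitLeft_comul]

theorem IsLeftColinear.isSplitting_iff {π : P →ₐc[k] H} {i : augKer k H →ₗ[k] augKer k P}
    (hi : IsLeftColinear π (augExt ((augKer k P).subtype ∘ₗ i))) :
    IsSplitting π i ↔ IsRightColinear π (augExt ((augKer k P).subtype ∘ₗ i)) := by
  have hadR : ((π : P →ₐ[k] H).toLinearMap.lTensor P ∘ₗ adR k P) 1 = 1 := by
    simp [adR, Algebra.TensorProduct.one_def]
  have hcov : (∀ h : augKer k H, ((π : P →ₐ[k] H).toLinearMap.lTensor P ∘ₗ adR k P) (i h : P) =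
      ((augKer k P).subtype ∘ₗ i ∘ₗ augProj k H).rTensor H (adR k H h)) ↔ _ :=
    (adR_covariant_iff hadR ((augKer k P).subtype ∘ₗ i)).trans hi.covariant_iff
  refine ⟨fun h => hcov.1 h.2, fun h => ⟨fun x => ?_, hcov.2 h⟩⟩
  have hε (x : H) : counit (R := k) (augExt ((augKer k P).subtype ∘ₗ i) x) = counit (R := k) x := by
    have : counit (R := k) (i (augProj k H x) : P) = 0 := (i _).2
    simp [augExt, this]
  simpa only [augExt_coe, LinearMap.comp_apply, Submodule.subtype_apply] using h.proj_apply hε x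

theorem canonicalConn_bijOn_strong {π : P →ₐc[k] H} (hπ : Function.Surjective π) :
    Set.BijOn canonicalConn
      {i | IsLeftColinear π (augExt ((augKer k P).subtype ∘ₗ i)) ∧
        IsRightColinear π (augExt ((augKer k P).subtype ∘ₗ i))}
      {ω | IsConnection (homogCoact π) ω ∧ IsStrong (homogCoact π) ω ∧ IsLeftInvariant ω} := by
  have hmem (i : augKer k H →ₗ[k] augKer k P) :
      IsConnection (homogCoact π) (canonicalConn i) ∧ IsStrong (homogCoact π) (canonicalConn i) ∧
          IsLeftInvariant (canonicalConn i) ↔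
        IsLeftColinear π (augExt ((augKer k P).subtype ∘ₗ i)) ∧
          IsRightColinear π (augExt ((augKer k P).subtype ∘ₗ i)) := by
    have hinv : IsLeftInvariant (canonicalConn i) := canonicalConn_bijOn.mapsTo (Set.mem_univ i)
    rw [isConnection_canonicalConn_iff, isStrong_canonicalConn_iff hπ, and_iff_left hinv, and_comm]
    exact and_congr_right fun hi => hi.isSplitting_iff
  refine ⟨fun i hi => (hmem i).2 hi,
    canonicalConn_bijOn.injOn.mono (Set.subset_univ _), fun ω hω => ?_⟩
  obtain ⟨i, -, rfl⟩ := canonicalConn_bijOn.surjOn hω.2.2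
  exact ⟨i, (hmem i).1 hω, rfl⟩

end CanonicalConnections

/-! ### Connections on the biproduct -/

section ConnOfForm

open WithConv LinearMap

variable {k P H M : Type*} [Field k] [Ring P] [Algebra k P] [Ring H] [HopfAlgebra k H]
  [Ring M] [Algebra k M]

theorem toConv_subtype_comp_lmul (Φ : H →ₗ[k] P) (g : H →ₗ[k] univForms k P) :
    toConv ((univForms k P).subtype ∘ₗ univForms.lmul k P ∘ₗ TensorProduct.map Φ g ∘ₗ comul) =
      toConv (inLeft k P P ∘ₗ Φ) * toConv ((univForms k P).subtype ∘ₗ g) :=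
  toConv_comp_comul (T := (univForms k P).subtype ∘ₗ univForms.lmul k P ∘ₗ TensorProduct.map Φ g)
    fun _ _ => univForms.coe_lmul _ _

theorem toConv_subtype_comp_rmul (g : H →ₗ[k] univForms k P) (Φ : H →ₗ[k] P) :
    toConv ((univForms k P).subtype ∘ₗ univForms.rmul k P ∘ₗ TensorProduct.map g Φ ∘ₗ comul) =
      toConv ((univForms k P).subtype ∘ₗ g) * toConv (inRight k P P ∘ₗ Φ) :=
  toConv_comp_comul (T := (univForms k P).subtype ∘ₗ univForms.rmul k P ∘ₗ TensorProduct.map g Φ)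
    fun _ _ => univForms.coe_rmul _ _

theorem coe_mulD_map_comul {Φ Φ' : H →ₗ[k] P} (hΦ : toConv Φ' * toConv Φ = 1) (h : augKer k H) :
    (univForms.mulD k P (TensorProduct.map Φ' Φ (comul (R := k) (h : H))) : P ⊗[k] P) =
      (toConv (inLeft k P P ∘ₗ Φ') * toConv (inRight k P P ∘ₗ Φ)) h := by
  have hε : counit (R := k) (h : H) = 0 := h.2
  have hmul : mul' k P (TensorProduct.map Φ' Φ (comul (R := k) (h : H))) = 0 := by
    refine (congr($(hΦ) (h : H))).trans ?_
    rw [convOne_apply, hε, map_zero]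
  rw [univForms.coe_mulD, hmul, TensorProduct.zero_tmul, sub_zero]
  exact congr($(toConv_map_comul Φ' Φ) (h : H))

theorem coe_connOfForm (f : M →ₐ[k] P) {Φ Φ' : H →ₗ[k] P} (hΦ : toConv Φ' * toConv Φ = 1)
    (β : augKer k H →ₗ[k] univForms k M) (h : augKer k H) :
    (connOfForm f Φ Φ' β h : P ⊗[k] P) = (toConv (inLeft k P P ∘ₗ Φ') *
      (toConv ((Algebra.TensorProduct.map f f).toLinearMap ∘ₗ
        augExt ((univForms k M).subtype ∘ₗ β)) * toConv (inRight k P P ∘ₗ Φ))) h := by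
  let ff := (Algebra.TensorProduct.map f f).toLinearMap
  let βf : H →ₗ[k] univForms k P := univForms.map f ∘ₗ β ∘ₗ augProj k H
  have hβf : toConv ((univForms k P).subtype ∘ₗ βf) =
      toConv (ff ∘ₗ augExt ((univForms k M).subtype ∘ₗ β)) - 1 :=
    toConv_comp_augProj (T := ff) (map_one (Algebra.TensorProduct.map f f))
      ((univForms k M).subtype ∘ₗ β)
  have hinner := toConv_subtype_comp_rmul βf Φ
  have houter := toConv_subtype_comp_lmul Φ' (univForms.rmul k P ∘ₗ TensorProduct.map βf Φ ∘ₗ comul)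
  rw [hinner, hβf, sub_mul, one_mul, mul_sub] at houter
  refine (congrArg₂ (· + ·) (congr($(houter) (h : H))) (coe_mulD_map_comul hΦ h)).trans ?_
  exact sub_add_cancel _ _

end ConnOfForm

section

open WithConv LinearMap

variable {k P H : Type*} [Field k] [Ring P] [HopfAlgebra k P] [Ring H] [HopfAlgebra k H]

theorem galois_mul_right (t : P ⊗[k] P) (y : P) :
    galois k P (t * (1 ⊗ₜ y)) = galois k P t * comul y := by
  induction t using TensorProduct.induction_on with
  | zero => simp
  | add x y hx hy => simp only [map_add, add_mul, hx, hy]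
  | tmul u v => simp [galois, leftExt_tmul, mul_assoc]

theorem toConv_galois_comp_convMul (a b : H →ₗ[k] P) (X : H →ₗ[k] P ⊗[k] P) :
    toConv (galois k P ∘ₗ (toConv (inLeft k P P ∘ₗ a) *
        (toConv X * toConv (inRight k P P ∘ₗ b))).ofConv) =
      toConv (inLeft k P P ∘ₗ a) * (toConv (galois k P ∘ₗ X) * toConv (comul ∘ₗ b)) := by
  have hright : toConv (galois k P ∘ₗ (toConv X * toConv (inRight k P P ∘ₗ b)).ofConv) =
      toConv (galois k P ∘ₗ X) * toConv (comul ∘ₗ b) :=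
    toConv_comp_convMul fun _ _ => galois_mul_right _ _
  rw [← hright]
  exact toConv_comp_convMul fun _ _ => leftExt_mul _ _ _

end

namespace Biproduct

open WithConv LinearMap BraidedGroup

variable {k H B : Type*} [Field k] [Ring H] [HopfAlgebra k H] [Ring B] [Algebra k B]
  [Coalgebra k B] [CrossedModule k H B] [BraidedGroup k H B]

theorem map_projHom_coactP (b : B) :
    Algebra.TensorProduct.map (projHom k H B) (AlgHom.id k _) (coactP k H B b) =
      (incl k H B).toLinearMap.lTensor H (coact (k := k) b) := by
  rw [coactP_apply]
  induction coact (k := k) (H := H) b using TensorProduct.induction_on with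
  | zero => simp
  | add x y hx hy => simp only [map_add, hx, hy]
  | tmul x y => simp [projHom_inclH]

theorem homogLeftCoact_incl (b : B) : homogLeftCoact (proj k H B) (incl k H B b) =
    (incl k H B).toLinearMap.lTensor H (coact (k := k) b) := by
  have map_comulAux (t : B ⊗[k] B) :
      Algebra.TensorProduct.map (projHom k H B) (AlgHom.id k _) (comulAux k H B t) =
        (incl k H B).toLinearMap.lTensor H (coact (k := k) (counitLeft k t)) := by
    induction t using TensorProduct.induction_on with
    | zero => simp
    | add x y hx hy => simp only [map_add, hx, hy]
    | tmul x y =>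
      rw [comulAux_tmul, map_mul, map_projHom_coactP, counitLeft_tmul, map_smul, map_smul,
        Algebra.TensorProduct.map_tmul, projHom_incl, map_one, ← TensorProduct.smul_tmul',
        smul_mul_assoc, ← Algebra.TensorProduct.one_def, one_mul]
  refine (congrArg _ (comul_incl b)).trans ((map_comulAux (comul b)).trans ?_)
  rw [counitLeft_comul]

variable (k H B) in
theorem comul_comp_inclH : comul ∘ₗ (inclH k H B).toLinearMap =
    TensorProduct.map (inclH k H B).toLinearMap (inclH k H B).toLinearMap ∘ₗ comul :=
  LinearMap.ext comul_inclH

variable (k H B) in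
theorem isLeftColinear_inclH : IsLeftColinear (proj k H B) (inclH k H B).toLinearMap := by
  have hproj : (projHom k H B).toLinearMap ∘ₗ (inclH k H B).toLinearMap = LinearMap.id :=
    LinearMap.ext projHom_inclH
  rw [IsLeftColinear, toLinearMap_homogLeftCoact, LinearMap.comp_assoc, comul_comp_inclH,
    ← LinearMap.comp_assoc, rTensor_comp_map]
  exact congr(TensorProduct.map $hproj _ ∘ₗ _)

variable (k H B) in
theorem isRightColinear_inclH : IsRightColinear (proj k H B) (inclH k H B).toLinearMap :=
  LinearMap.ext homogCoact_inclH

/-- The map `h ↦ γ(h₁) ⊗ h₂` from `H` to the biproduct. -/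
noncomputable def crossLift (γ : H →ₗ[k] B) : H →ₗ[k] Biproduct k H B :=
  (toConv ((incl k H B).toLinearMap ∘ₗ γ) * toConv (inclH k H B).toLinearMap).ofConv

theorem crossLift_one {γ : H →ₗ[k] B} (hγ : γ 1 = 1) : crossLift γ 1 = 1 := by
  refine (convMul_apply_one (toConv ((incl k H B).toLinearMap ∘ₗ γ)) _).trans ?_
  simp [hγ]

theorem toConv_algHom_comp_crossLift {A : Type*} [Ring A] [Algebra k A]
    (φ : Biproduct k H B →ₐ[k] A) (γ : H →ₗ[k] B) : toConv (φ.toLinearMap ∘ₗ crossLift γ) =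
      toConv (φ.toLinearMap ∘ₗ (incl k H B).toLinearMap ∘ₗ γ) *
        toConv (φ.toLinearMap ∘ₗ (inclH k H B).toLinearMap) :=
  toConv_algHom_comp_convMul φ _ _

theorem isRightColinear_crossLift (γ : H →ₗ[k] B) :
    IsRightColinear (proj k H B) (crossLift γ) := by
  have hincl : (homogCoact (proj k H B)).toLinearMap ∘ₗ (incl k H B).toLinearMap ∘ₗ γ =
      inLeft k (Biproduct k H B) H ∘ₗ (incl k H B).toLinearMap ∘ₗ γ :=
    LinearMap.ext fun h => homogCoact_incl (γ h)
  rw [isRightColinear_iff, toConv_algHom_comp_crossLift, toConv_algHom_comp_crossLift, hincl,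
    isRightColinear_iff.1 (isRightColinear_inclH k H B), mul_assoc]

variable (k H B) in
/-- The projection `b ⊗ h ↦ b ε(h)` of the biproduct onto `B`. -/
noncomputable def retract : Biproduct k H B →ₗ[k] B :=
  (TensorProduct.rid k B).toLinearMap ∘ₗ (counit (R := k) (A := H)).lTensor B ∘ₗ
    (of k H B).symm.toLinearMap

theorem retract_of (b : B) (h : H) :
    retract k H B (of k H B (b ⊗ₜ h)) = counit (R := k) h • b := by
  simp [retract]

theorem retract_incl (b : B) : retract k H B (incl k H B b) = b := by
  rw [incl_apply, retract_of, Bialgebra.counit_one, one_smul]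

theorem counit_retract (x : Biproduct k H B) :
    counit (R := k) (retract k H B x) = counit (R := k) x := by
  induction x using induction_on with
  | hz => simp
  | ha x y hx hy => simp only [map_add, hx, hy]
  | ht b h =>
    rw [retract_of, of_tmul, Bialgebra.counit_mul, counit_incl, counit_inclH, map_smul, mul_comm,
      smul_eq_mul]

theorem retract_comp_crossLift (γ : H →ₗ[k] B) : retract k H B ∘ₗ crossLift γ = γ := by
  refine toConv_injective ((toConv_comp_convMul (f' := toConv γ) (g' := 1) fun x y => ?_).trans
    (mul_one _))
  change retract k H B (incl k H B (γ x) * inclH k H B y) = γ x * algebraMap k B (counit y)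
  rw [← of_tmul, retract_of, Algebra.algebraMap_eq_smul_one, mul_smul_comm, mul_one]

variable (k H B) in
/-- The map `x ⊗ h ↦ (b ε(g)) ⊗ h` for `x = b ⊗ g`, a retraction of the coaction on the
biproduct. -/
noncomputable def coactRetract : Biproduct k H B ⊗[k] H →ₗ[k] Biproduct k H B :=
  mul' k _ ∘ₗ TensorProduct.map ((incl k H B).toLinearMap ∘ₗ retract k H B)
    (inclH k H B).toLinearMap

variable (k H B) in
theorem coactRetract_comp_homogCoact :
    coactRetract k H B ∘ₗ (homogCoact (proj k H B)).toLinearMap = LinearMap.id := by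
  have coactRetract_mul (b : B) (t : H ⊗[k] H) : coactRetract k H B
      ((incl k H B b ⊗ₜ 1) * (inclH k H B).toLinearMap.rTensor H t) =
        incl k H B b * inclH k H B (counitLeft k t) := by
    induction t using TensorProduct.induction_on with
    | zero => simp
    | add x y hx hy => simp only [map_add, mul_add, hx, hy]
    | tmul x y => simp [coactRetract, ← of_tmul, retract_of, counitLeft_tmul]
  ext x
  induction x using induction_on with
  | hz => simp
  | ha x y hx hy => simp only [map_add, hx, hy]
  | ht b h =>
    rw [LinearMap.comp_apply, AlgHom.toLinearMap_apply, of_tmul, map_mul, homogCoact_incl,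
      homogCoact_inclH, coactRetract_mul, counitLeft_comul]
    rfl

theorem eq_crossLift {p : H →ₗ[k] Biproduct k H B} (hp : IsRightColinear (proj k H B) p) :
    p = crossLift (retract k H B ∘ₗ p) := by
  calc p = coactRetract k H B ∘ₗ (homogCoact (proj k H B)).toLinearMap ∘ₗ p := by
        rw [← LinearMap.comp_assoc, coactRetract_comp_homogCoact, id_comp]
    _ = coactRetract k H B ∘ₗ p.rTensor H ∘ₗ comul := by rw [hp]
    _ = crossLift (retract k H B ∘ₗ p) := toConv_injective <|
        toConv_comp_comul (T := coactRetract k H B ∘ₗ p.rTensor H)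
          (f := toConv ((incl k H B).toLinearMap ∘ₗ retract k H B ∘ₗ p))
          (g := toConv (inclH k H B).toLinearMap) fun x y => by simp [coactRetract]

theorem toConv_lTensor_incl_comp_inj {C : Type*} [AddCommMonoid C] [Module k C] :
    Function.Injective fun f : WithConv (C →ₗ[k] H ⊗[k] B) =>
      toConv ((incl k H B).toLinearMap.lTensor H ∘ₗ f.ofConv) := by
  have retract_comp_incl : retract k H B ∘ₗ (incl k H B).toLinearMap = LinearMap.id :=
    LinearMap.ext retract_incl
  refine Function.LeftInverse.injective
    (g := fun f => toConv ((retract k H B).lTensor H ∘ₗ f.ofConv)) fun f => ?_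
  change toConv (_ ∘ₗ _ ∘ₗ f.ofConv) = f
  rw [← LinearMap.comp_assoc, ← lTensor_comp, retract_comp_incl, lTensor_id, id_comp, toConv_ofConv]

theorem toConv_map_incl_comp_conj {D : Type*} [Ring D] [Algebra k D] (φ : H →ₐ[k] D)
    (γ : H →ₗ[k] B) :
    toConv ((Algebra.TensorProduct.map φ (incl k H B)).toLinearMap ∘ₗ
      (toConv (inLeft k H B) * toConv (inRight k H B ∘ₗ γ) *
        toConv (inLeft k H B ∘ₗ HopfAlgebra.antipode k)).ofConv) =
    toConv (inLeft k D (Biproduct k H B) ∘ₗ φ.toLinearMap) *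
      toConv (inRight k D (Biproduct k H B) ∘ₗ (incl k H B).toLinearMap ∘ₗ γ) *
      toConv (inLeft k D (Biproduct k H B) ∘ₗ φ.toLinearMap ∘ₗ HopfAlgebra.antipode k) := by
  rw [toConv_algHom_comp_convMul, toConv_algHom_comp_convMul]
  congr 2
  exact congrArg toConv (LinearMap.ext fun h => by simp)

/-- The condition `Δ_H(γ(h)) = h₁ S h₃ ⊗ γ(h₂)`, that is, colinearity of `γ` for the left adjoint
coaction of `H`. Convolution makes it conjugation by `h ↦ h ⊗ 1`. -/
def IsAdColinear (γ : H →ₗ[k] B) : Prop :=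
  toConv (coact (k := k) (H := H) ∘ₗ γ) = toConv (inLeft k H B) * toConv (inRight k H B ∘ₗ γ) *
    toConv (inLeft k H B ∘ₗ HopfAlgebra.antipode k)

theorem isAdColinear_iff_isLeftColinear_crossLift (γ : H →ₗ[k] B) :
    IsAdColinear γ ↔ IsLeftColinear (proj k H B) (crossLift γ) := by
  let left : H →ₐ[k] H ⊗[k] Biproduct k H B := Algebra.TensorProduct.includeLeft
  let right : H →ₐ[k] H ⊗[k] Biproduct k H B :=
    Algebra.TensorProduct.includeRight.comp (inclH k H B)
  let a : (WithConv (H →ₗ[k] H ⊗[k] Biproduct k H B))ˣ :=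
    ⟨_, _, toConv_mul_comp_antipode left, toConv_comp_antipode_mul left⟩
  let c : (WithConv (H →ₗ[k] H ⊗[k] Biproduct k H B))ˣ :=
    ⟨_, _, toConv_mul_comp_antipode right, toConv_comp_antipode_mul right⟩
  have hcoact : (homogLeftCoact (proj k H B)).toLinearMap ∘ₗ (incl k H B).toLinearMap ∘ₗ γ =
      (incl k H B).toLinearMap.lTensor H ∘ₗ coact (k := k) (H := H) ∘ₗ γ :=
    LinearMap.ext fun h => homogLeftCoact_incl (γ h)
  rw [IsAdColinear, isLeftColinear_iff, toConv_algHom_comp_crossLift,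
    toConv_algHom_comp_crossLift, hcoact,
    isLeftColinear_iff.1 (isLeftColinear_inclH k H B), ← mul_assoc, ← mul_assoc]
  refine Iff.trans ?_ c.mul_left_inj.symm
  refine Iff.trans ?_ a.eq_mul_inv_iff_mul_eq
  refine (toConv_lTensor_incl_comp_inj.eq_iff).symm.trans (Eq.congr_right ?_)
  exact toConv_map_incl_comp_conj (AlgHom.id k H) γ

theorem galois_map_incl (t : B ⊗[k] B) : galois k (Biproduct k H B)
    (Algebra.TensorProduct.map (incl k H B) (incl k H B) t) =
      comulAux k H B (galois k B t) := by
  have comulAux_mul (u : B) (r : B ⊗[k] B) : comulAux k H B ((u ⊗ₜ 1) * r) =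
      (incl k H B u ⊗ₜ 1) * comulAux k H B r := by
    induction r using TensorProduct.induction_on with
    | zero => simp
    | add x y hx hy => simp only [map_add, mul_add, hx, hy]
    | tmul x y => simp [comulAux_tmul, ← mul_assoc]
  induction t using TensorProduct.induction_on with
  | zero => simp
  | add x y hx hy => simp only [map_add, hx, hy]
  | tmul x y => exact (congrArg _ (comul_incl y)).trans (comulAux_mul x (comul y)).symm

theorem galois_map_incl_maurerCartan (b : B) : galois k (Biproduct k H B)
    (Algebra.TensorProduct.map (incl k H B) (incl k H B)
      (maurerCartan (bantipode (k := k) H) b)) = coactP k H B b := by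
  rw [galois_map_incl, galois_maurerCartan (bantipode_mul_id k H B), comulAux_tmul, map_one,
    ← Algebra.TensorProduct.one_def, one_mul]

theorem toConv_galois_map_incl_maurerCartan {γ : H →ₗ[k] B} (hγ : IsAdColinear γ) :
    toConv (galois k (Biproduct k H B) ∘ₗ
        (Algebra.TensorProduct.map (incl k H B) (incl k H B)).toLinearMap ∘ₗ
          maurerCartan (bantipode (k := k) H) ∘ₗ γ) =
      toConv (inLeft k (Biproduct k H B) (Biproduct k H B) ∘ₗ (inclH k H B).toLinearMap) *
        toConv (inRight k (Biproduct k H B) (Biproduct k H B) ∘ₗ (incl k H B).toLinearMap ∘ₗ γ) *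
        toConv (inLeft k (Biproduct k H B) (Biproduct k H B) ∘ₗ
          (inclH k H B).toLinearMap ∘ₗ HopfAlgebra.antipode k) := by
  have hcoactP : galois k (Biproduct k H B) ∘ₗ
      (Algebra.TensorProduct.map (incl k H B) (incl k H B)).toLinearMap ∘ₗ
        maurerCartan (bantipode (k := k) H) ∘ₗ γ =
      (Algebra.TensorProduct.map (inclH k H B) (incl k H B)).toLinearMap ∘ₗ
        coact (k := k) (H := H) ∘ₗ γ :=
    LinearMap.ext fun h => galois_map_incl_maurerCartan (γ h)
  rw [hcoactP, ← toConv_map_incl_comp_conj, ← hγ]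

theorem maurerCartan_crossLift {γ : H →ₗ[k] B} (hγ : IsAdColinear γ) (h : H) :
    maurerCartan (HopfAlgebra.antipode k) (crossLift γ h) =
      (toConv (inLeft k (Biproduct k H B) (Biproduct k H B) ∘ₗ
          (inclH k H B).toLinearMap ∘ₗ HopfAlgebra.antipode k) *
        (toConv ((Algebra.TensorProduct.map (incl k H B) (incl k H B)).toLinearMap ∘ₗ
          maurerCartan (bantipode (k := k) H) ∘ₗ γ) *
        toConv (inRight k (Biproduct k H B) (Biproduct k H B) ∘ₗ (inclH k H B).toLinearMap)))
      h := by
  let P := Biproduct k H B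
  let j := (inclH k H B).toLinearMap
  let X := (Algebra.TensorProduct.map (incl k H B) (incl k H B)).toLinearMap ∘ₗ
    maurerCartan (bantipode (k := k) H) ∘ₗ γ
  have inv_mul_cancel : toConv (inLeft k P P ∘ₗ j ∘ₗ HopfAlgebra.antipode k) *
      toConv (inLeft k P P ∘ₗ j) = 1 :=
    toConv_comp_antipode_mul
      ((Algebra.TensorProduct.includeLeft : P →ₐ[k] P ⊗[k] P).comp (inclH k H B))
  have hj : toConv (comul ∘ₗ j) = toConv (inLeft k P P ∘ₗ j) * toConv (inRight k P P ∘ₗ j) := by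
    rw [comul_comp_inclH, toConv_map_comul]
  refine ((eq_maurerCartan_iff antipode_mul_id id_mul_antipode).2 ?_).symm
  suffices hgalois : toConv (galois k P ∘ₗ
      (toConv (inLeft k P P ∘ₗ j ∘ₗ HopfAlgebra.antipode k) *
        (toConv X * toConv (inRight k P P ∘ₗ j))).ofConv) =
      toConv (inRight k P P ∘ₗ crossLift γ) from congrArg (fun f => f h) hgalois
  calc _ = toConv (inLeft k P P ∘ₗ j ∘ₗ HopfAlgebra.antipode k) *
        (toConv (galois k P ∘ₗ X) * toConv (comul ∘ₗ j)) := toConv_galois_comp_convMul _ _ _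
    _ = (toConv (inLeft k P P ∘ₗ j ∘ₗ HopfAlgebra.antipode k) * toConv (inLeft k P P ∘ₗ j)) *
        (toConv (inRight k P P ∘ₗ (incl k H B).toLinearMap ∘ₗ γ) *
          ((toConv (inLeft k P P ∘ₗ j ∘ₗ HopfAlgebra.antipode k) * toConv (inLeft k P P ∘ₗ j)) *
            toConv (inRight k P P ∘ₗ j))) := by
      rw [toConv_galois_map_incl_maurerCartan hγ, hj]
      simp only [P, j, mul_assoc]
    _ = toConv (inRight k P P ∘ₗ (incl k H B).toLinearMap ∘ₗ γ) *
        toConv (inRight k P P ∘ₗ j) := by rw [inv_mul_cancel, one_mul, one_mul]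
    _ = toConv (inRight k P P ∘ₗ crossLift γ) :=
      (toConv_algHom_comp_crossLift
        (Algebra.TensorProduct.includeRight : P →ₐ[k] P ⊗[k] P) γ).symm

theorem coe_biproductConn (β : augKer k H →ₗ[k] univForms k B) (h : augKer k H) :
    (biproductConn β h : Biproduct k H B ⊗[k] Biproduct k H B) =
      (toConv (inLeft k (Biproduct k H B) (Biproduct k H B) ∘ₗ
          (inclH k H B).toLinearMap ∘ₗ HopfAlgebra.antipode k) *
        (toConv ((Algebra.TensorProduct.map (incl k H B) (incl k H B)).toLinearMap ∘ₗ
          augExt ((univForms k B).subtype ∘ₗ β)) *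
        toConv (inRight k (Biproduct k H B) (Biproduct k H B) ∘ₗ (inclH k H B).toLinearMap))) h :=
  coe_connOfForm _ (toConv_comp_antipode_mul (inclH k H B)) β h

theorem augExt_splittingOfMap (γ : augKer k H →ₗ[k] augKer k B) :
    augExt ((augKer k (Biproduct k H B)).subtype ∘ₗ splittingOfMap γ) =
      crossLift (augExt ((augKer k B).subtype ∘ₗ γ)) := by
  let γ' := (augKer k B).subtype ∘ₗ γ
  have hsplit : toConv ((of k H B).toLinearMap ∘ₗ
      ((γ' ∘ₗ augProj k H).rTensor H ∘ₗ comul + TensorProduct.mk k B H 1)) =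
        toConv (crossLift (augExt γ')) := by
    have hmul : toConv ((of k H B).toLinearMap ∘ₗ (γ' ∘ₗ augProj k H).rTensor H ∘ₗ comul) =
        toConv ((incl k H B).toLinearMap ∘ₗ γ' ∘ₗ augProj k H) * toConv (inclH k H B).toLinearMap :=
      toConv_comp_comul (T := (of k H B).toLinearMap ∘ₗ (γ' ∘ₗ augProj k H).rTensor H)
        fun x y => of_tmul _ _
    have hone : (of k H B).toLinearMap ∘ₗ TensorProduct.mk k B H 1 = (inclH k H B).toLinearMap :=
      LinearMap.ext fun h => (inclH_apply h).symm
    rw [LinearMap.comp_add, toConv_add, hmul, hone,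
      toConv_comp_augProj (T := (incl k H B).toLinearMap) (map_one (incl k H B)), sub_mul, one_mul,
      sub_add_cancel]
    rfl
  exact (augExt_unique (crossLift_one (augExt_one _)) fun x => (congr($hsplit (x : H))).symm).symm

theorem mem_adIntertwiners_iff (γ : augKer k H →ₗ[k] augKer k B) : γ ∈ adIntertwiners k H B ↔
    IsAdColinear (augExt ((augKer k B).subtype ∘ₗ γ)) :=
  intertwinesAd_iff coact_one _

theorem mem_adIntertwiners_iff_isLeftColinear (γ : augKer k H →ₗ[k] augKer k B) :
    γ ∈ adIntertwiners k H B ↔ IsLeftColinear (proj k H B)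
      (augExt ((augKer k (Biproduct k H B)).subtype ∘ₗ splittingOfMap γ)) := by
  rw [augExt_splittingOfMap, ← isAdColinear_iff_isLeftColinear_crossLift, mem_adIntertwiners_iff]

theorem isRightColinear_splittingOfMap (γ : augKer k H →ₗ[k] augKer k B) :
    IsRightColinear (proj k H B)
      (augExt ((augKer k (Biproduct k H B)).subtype ∘ₗ splittingOfMap γ)) := by
  rw [augExt_splittingOfMap]
  exact isRightColinear_crossLift _

theorem isSplitting_splittingOfMap {γ : augKer k H →ₗ[k] augKer k B}
    (hγ : γ ∈ adIntertwiners k H B) : IsSplitting (proj k H B) (splittingOfMap γ) :=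
  ((mem_adIntertwiners_iff_isLeftColinear γ).1 hγ).isSplitting_iff.2
    (isRightColinear_splittingOfMap γ)

theorem biproductConn_formOfMap {γ : augKer k H →ₗ[k] augKer k B}
    (hγ : γ ∈ adIntertwiners k H B) :
    biproductConn (formOfMap γ) = canonicalConn (P := Biproduct k H B) (splittingOfMap γ) := by
  have hform : augExt ((univForms k B).subtype ∘ₗ formOfMap γ) =
      maurerCartan (bantipode (k := k) H) ∘ₗ augExt ((augKer k B).subtype ∘ₗ γ) := by
    rw [comp_augExt (maurerCartan_one (BraidedGroup.comul_one (H := H)) (bantipode_one k H B))]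
    exact congrArg augExt (LinearMap.ext (coe_formOfMap γ))
  ext h : 2
  rw [coe_biproductConn, hform, coe_canonicalConn,
    ← maurerCartan_crossLift ((mem_adIntertwiners_iff γ).1 hγ), ← augExt_splittingOfMap, augExt_coe]
  rfl

theorem splittingOfMap_bijOn : Set.BijOn splittingOfMap (adIntertwiners k H B)
    {i | IsLeftColinear (proj k H B) (augExt ((augKer k (Biproduct k H B)).subtype ∘ₗ i)) ∧
      IsRightColinear (proj k H B) (augExt ((augKer k (Biproduct k H B)).subtype ∘ₗ i))} := by
  refine ⟨fun γ hγ => ⟨(mem_adIntertwiners_iff_isLeftColinear γ).1 hγ,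
    isRightColinear_splittingOfMap γ⟩, fun γ _ γ' _ h => ?_, fun i ⟨hleft, hright⟩ => ?_⟩
  · have hext : augExt ((augKer k B).subtype ∘ₗ γ) = augExt ((augKer k B).subtype ∘ₗ γ') := by
      rw [← retract_comp_crossLift (augExt ((augKer k B).subtype ∘ₗ γ)), ← augExt_splittingOfMap, h,
        augExt_splittingOfMap, retract_comp_crossLift]
    exact augExt_subtype_comp_injective hext
  · let γ : augKer k H →ₗ[k] augKer k B :=
      (retract k H B ∘ₗ (augKer k (Biproduct k H B)).subtype ∘ₗ i).codRestrict _ fun h =>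
        (counit_retract _).trans (i h).2
    have retract_one : retract k H B 1 = 1 := by rw [← map_one (incl k H B), retract_incl]
    have hext : augExt ((augKer k (Biproduct k H B)).subtype ∘ₗ splittingOfMap γ) =
        augExt ((augKer k (Biproduct k H B)).subtype ∘ₗ i) := by
      rw [augExt_splittingOfMap, eq_crossLift hright, comp_augExt retract_one]
      rfl
    exact ⟨γ, (mem_adIntertwiners_iff_isLeftColinear γ).2 (hext ▸ hleft),
      augExt_subtype_comp_injective hext⟩

theorem biproductConn_bijOn :
    Set.BijOn biproductConn (invariantForms k H B) (strongLeftInvariantConnections k H B) := by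
  have hproj : Function.Surjective (proj k H B) := fun h => ⟨inclH k H B h, projHom_inclH h⟩
  have hcomp : Set.BijOn (biproductConn ∘ formOfMap) (adIntertwiners k H B)
      (strongLeftInvariantConnections k H B) :=
    ((canonicalConn_bijOn_strong hproj).comp splittingOfMap_bijOn).congr
      fun _ hγ => (biproductConn_formOfMap hγ).symm
  rw [← (formOfMap_bijOn (k := k) (H := H) (B := B)).image_eq]
  exact (Set.bijOn_comp_iff formOfMap_bijOn.injOn).1 hcomp

end Biproduct

theorem proposition6p6 {k H B : Type*} [Field k] [Ring H] [HopfAlgebra k H]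
    [Ring B] [Algebra k B] [Coalgebra k B] [CrossedModule k H B] [BraidedGroup k H B] :
    Set.BijOn biproductConn (invariantForms k H B) (strongLeftInvariantConnections k H B) ∧
    Set.BijOn formOfMap (adIntertwiners k H B) (invariantForms k H B) ∧
    ∀ γ ∈ adIntertwiners k H B,
      IsSplitting (Biproduct.proj k H B) (splittingOfMap γ) ∧
      biproductConn (formOfMap γ) = canonicalConn (P := Biproduct k H B) (splittingOfMap γ) :=
  ⟨Biproduct.biproductConn_bijOn, formOfMap_bijOn, fun _ hγ =>
    ⟨Biproduct.isSplitting_splittingOfMap hγ, Biproduct.biproductConn_formOfMap hγ⟩⟩
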